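/- Consider the initial value problem $u'(t)=-A(t)u(t)+b(t)$, $u(0)=u_0$, on $[0,T]$, $T>0$, in $\mathbb C^N$ with the Euclidean norm (matrices carry the spectral norm). Write $A(t)=L(t)+iH(t)$ with $L=\frac{A+A^\dagger}{2}$, $H=\frac{A-A^\dagger}{2i}$. Let $p\ge 1$ be an integer and assume that $A$ is $p$ times and $b$ is twice continuously differentiable on $[0,T]$, that $L(t)\succeq 0$ for all $t\in[0,T]$, and that $u(T)\ne 0$. Let $0<\epsilon\le 1$ and put $\|L\|=\max_{[0,T]}\|L(\tau)\|$, $\|H\|=\max_{[0,T]}\|H(\tau)\|$, $$q=\frac{\|u_0\|+\|b\|_{L^1}}{\|u(T)\|},\quad \|b\|_{L^1}=\int_0^T\|b(s)\|\,ds,\quad \|b\|_{C^2}=\sum_{i=0}^2\max_{\tau\in[0,T]}\|b^{(i)}(\tau)\|,\quad \Gamma_p=\max_{0\le i\le p,\ \tau\in[0,T]}\bigl(\|H^{(i)}(\tau)\|+\|L^{(i)}(\tau)\|\bigr)^{1/(i+1)} .$$ Input model. For grid parameters $K>0$, $M=2^m-1$, $M_t=2^{m_t}-1$ ($m,m_t\ge1$)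 chosen by the algorithm, let $k_j=-K+2jK/M$, $s_{j'}=j'T/M_t$, $c_j=\frac{w_j}{\pi(1+k_j^2)}$ and $\tilde c_{j,j'}=v_{j'}c_j\|b(s_{j'})\|$, where $w_j$, $v_{j'}$ are the trapezoidal weights on $[-K,K]$ and $[0,T]$. With $|v\rangle=v/\|v\|$, one is given unitaries - $O_{\rm prep}:|0\rangle\mapsto|u_0\rangle$ and $O_b:|j'\rangle|0\rangle\mapsto|j'\rangle|b(s_{j'})\rangle$; - $O_{\rm coef}:|0\rangle\mapsto\|c\|_1^{-1/2}\sum_j\sqrt{c_j}\,|j\rangle$ and $O'_{\rm coef}:|0\rangle\mapsto\|\tilde c\|_1^{-1/2}\sum_{j,j'}\sqrt{\tilde c_{j,j'}}\,|j'\rangle|j\rangle$; - $O_L(s,\tau)=e^{-iL(\tau)s}$ for $\tau\in[0,T]$, $|s|\,\|L\|\le 1$, and $O_L'(s,\tau_0,\tau_1)=\sum_{j'=0}^{M_t}|j'\rangle\langle j'|\otimes e^{-iL(\tau_0j'+\tau_1(M_t-j'))\,s\,(M_t-j')}$ whenever $|s|M_t\|L\|\le 1$ and all the times that occur lie in $[0,T]$;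 similarly $O_H$, $O_H'$. Inverses and controlled versions of oracles may be used, each use counting as one query. Besides queries, circuits consist of uncontrolled one-qubit gates on ancilla qubits and reflections $I-2|0\cdots0\rangle\langle0\cdots0|$ on subsets of the registers. Then there is a quantum algorithm, whose circuit is determined by the scalars $p,T,\epsilon,\|u_0\|,\|u(T)\|,\Gamma_p,\Gamma_1,\|b\|_{C^2}$ and the function $s\mapsto\|b(s)\|$ on $[0,T]$, that starts from $|0\cdots0\rangle$ and, for every such problem and every choice of oracles as above, ends with a measurement of the ancilla qubits whose all-zero outcome, the success flag, has probability $\Omega(1)$ and leaves the system in a state within $\epsilon$ (in norm) of $|u(T)\rangle=u(T)/\|u(T)\|$. It uses 1. $\widetilde{\mathcal O}\!\left(q^{2+2/p}\,\dfrac{\Gamma_p^{1+1/p}T^{1+1/p}}{\epsilon^{1+2/p}}\right)$ queries to the input models $O_L,O_H,O_L',O_H'$ of $H$ and $L$, where $\widetilde{\mathcal O}$ hides a fixed power of $\log\frac{(2+q)(2+\Gamma_pT)}{\epsilon}$; 2. $\mathcal O(q)$ queries to $O_{\rm prep}$ and $O_b$, and $\mathcal O(q)$ queries to $O_{\rm coef}$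 and $O_{\rm coef}'$; 3. $\mathcal O\!\left(\log\dfrac{(2+q)(2+\Gamma_1)(2+T)\bigl(2+\|b\|_{C^2}/\|u(T)\|\bigr)}{\epsilon}\right)$ ancilla qubits; 4. $\mathcal O(q)$ additional one-qubit gates and reflections. The implied constants and the power of the logarithm depend only on $p$; the lower bound on the success probability is an absolute constant. -/

import Mathlib

open scoped Matrix.Norms.L2Operator ComplexOrder

noncomputable section

namespace LCHS

/-! ### The differential equation -/

/-- The data of an initial value problem `u' = -A(t) u + b(t)`, `u(0) = u₀`, on `[0, T]` in `ℂ^N`.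
Matrices carry the spectral (`L²` operator) norm, vectors the Euclidean norm. -/
structure ODEData (N : ℕ) where
  T : ℝ
  A : ℝ → Matrix (Fin N) (Fin N) ℂ
  b : ℝ → EuclideanSpace ℂ (Fin N)
  u₀ : EuclideanSpace ℂ (Fin N)

/-- The supremum over `[0, T]` of the norm of a function. -/
def supNorm {E : Type*} [NormedAddCommGroup E] (T : ℝ) (f : ℝ → E) : ℝ :=
  sSup ((fun τ => ‖f τ‖) '' Set.Icc 0 T)

namespace ODEData

variable {N : ℕ} (P : ODEData N)

/-- The Hermitian part `L = (A + A†) / 2`. -/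
def L (t : ℝ) : Matrix (Fin N) (Fin N) ℂ :=
  (1 / 2 : ℂ) • (P.A t + (P.A t).conjTranspose)

/-- The matrix `H = (A - A†) / (2 i)`, so that `A = L + i H`. -/
def H (t : ℝ) : Matrix (Fin N) (Fin N) ℂ :=
  (1 / (2 * Complex.I) : ℂ) • (P.A t - (P.A t).conjTranspose)

/-- The standing assumptions: `A` is `p` times and `b` twice continuously differentiable on
`[0, T]`, and the Hermitian part of `A(t)` is positive semidefinite. -/
structure Admissible (p : ℕ) : Prop where
  T_pos : 0 < P.T
  smooth_A : ContDiffOn ℝ p P.A (Set.Icc 0 P.T)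
  smooth_b : ContDiffOn ℝ 2 P.b (Set.Icc 0 P.T)
  dissipative : ∀ t ∈ Set.Icc 0 P.T, (P.L t).PosSemidef

/-- `u` is the solution of the initial value problem on `[0, T]`. -/
structure IsSolution (u : ℝ → EuclideanSpace ℂ (Fin N)) : Prop where
  initial : u 0 = P.u₀
  deriv : ∀ t ∈ Set.Icc 0 P.T, HasDerivWithinAt u
    (-(Matrix.toEuclideanCLM (n := Fin N) (𝕜 := ℂ) (P.A t) (u t)) + P.b t) (Set.Icc 0 P.T) t

/-- `‖b‖_{L¹}`. -/
def bL1 : ℝ := ∫ s in (0 : ℝ)..P.T, ‖P.b s‖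

/-- `‖b‖_{C²}`. -/
def bC2 : ℝ :=
  ∑ q ∈ Finset.range 3, supNorm P.T (iteratedDerivWithin q P.b (Set.Icc 0 P.T))

/-- `Γ_p = max_{0 ≤ q ≤ p, τ ∈ [0,T]} (‖H^{(q)}(τ)‖ + ‖L^{(q)}(τ)‖)^{1/(q+1)}`. -/
def Gam (p : ℕ) : ℝ :=
  sSup {x : ℝ | ∃ q ≤ p, ∃ τ ∈ Set.Icc 0 P.T,
    x = (‖iteratedDerivWithin q P.H (Set.Icc 0 P.T) τ‖ +
          ‖iteratedDerivWithin q P.L (Set.Icc 0 P.T) τ‖) ^ (1 / ((q : ℝ) + 1))}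

end ODEData

/-! ### Quadrature grids

Grids have `2 ^ m` points, `j = 0, …, M` with `M = 2 ^ m - 1`, so that an index fits exactly into
`m` qubits. -/

/-- `M = 2 ^ m - 1` as a real number. -/
def gridM (m : ℕ) : ℝ := (2 : ℝ) ^ m - 1

/-- The trapezoidal end point correction `2 - 1_{j = 0, M}`. -/
def endFactor (m j : ℕ) : ℝ := if j = 0 ∨ j + 1 = 2 ^ m then 1 else 2

/-- The node `k_j = -K + 2 j K / M` on `[-K, K]`. -/
def kNode (K : ℝ) (m j : ℕ) : ℝ := -K + 2 * j * K / gridM m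

/-- `c_j = w_j / (π (1 + k_j²))` with `w_j = (2 - 1_{j = 0, M}) K / M`. -/
def cCoef (K : ℝ) (m j : ℕ) : ℝ :=
  (endFactor m j * K / gridM m) / (Real.pi * (1 + kNode K m j ^ 2))

/-- The time node `s_{j'} = j' T / M_t` on `[0, T]`. -/
def tNode (T : ℝ) (mt j' : ℕ) : ℝ := j' * T / gridM mt

/-- `c̃_{j,j'} = v_{j'} w_j ‖b(s_{j'})‖ / (π (1 + k_j²))` with
`v_{j'} = (2 - 1_{j' = 0, M_t}) T / (2 M_t)`. -/
def cCoefB {N : ℕ} (P : ODEData N) (K : ℝ) (m mt j j' : ℕ) : ℝ :=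
  (endFactor mt j' * P.T / (2 * gridM mt)) * cCoef K m j * ‖P.b (tNode P.T mt j')‖

/-! ### Qubit registers, oracles and circuits -/

/-- Computational basis labels of a register of qubits indexed by `κ`. -/
abbrev Bits (κ : Type*) := κ → Fin 2

/-- The number encoded by a bit string (qubit `l` has weight `2 ^ l`). -/
def val {m : ℕ} (x : Bits (Fin m)) : ℕ := (finFunctionFinEquiv x : Fin (2 ^ m))

/-- Basis labels of `w` ancilla qubits together with the `N`-dimensional system register. -/
abbrev Idx (w N : ℕ) := Bits (Fin w) × Fin N

/-- The unitaries behind the oracles. The register of `m` qubits holds the index `j` of the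
`k`-grid, the register of `mt` qubits the index `j'` of the time grid. -/
structure Oracles (m mt N : ℕ) where
  prep : Matrix.unitaryGroup (Fin N) ℂ
  src : Matrix.unitaryGroup (Bits (Fin mt) × Fin N) ℂ
  coef : Matrix.unitaryGroup (Bits (Fin m)) ℂ
  coefB : Matrix.unitaryGroup (Bits (Fin mt ⊕ Fin m)) ℂ
  simL : ℝ → ℝ → Matrix.unitaryGroup (Fin N) ℂ
  simH : ℝ → ℝ → Matrix.unitaryGroup (Fin N) ℂ
  simLT : ℝ → ℝ → ℝ → Matrix.unitaryGroup (Bits (Fin mt) × Fin N) ℂ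
  simHT : ℝ → ℝ → ℝ → Matrix.unitaryGroup (Bits (Fin mt) × Fin N) ℂ

/-- `e^{-i G s}`. -/
def evol {N : ℕ} (G : Matrix (Fin N) (Fin N) ℂ) (s : ℝ) : Matrix (Fin N) (Fin N) ℂ :=
  NormedSpace.exp ((-(Complex.I * (s : ℂ))) • G)

/-- The time `τ₀ j' + τ₁ (M_t - j')`. -/
def oracleTime (mt : ℕ) (τ₀ τ₁ : ℝ) (j' : ℕ) : ℝ := τ₀ * j' + τ₁ * (gridM mt - j')

/-- `∑_{j'} |j'⟩⟨j'| ⊗ e^{-i G(τ₀ j' + τ₁ (M_t - j')) s (M_t - j')}`. -/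
def evolT {N : ℕ} (mt : ℕ) (G : ℝ → Matrix (Fin N) (Fin N) ℂ) (s τ₀ τ₁ : ℝ) :
    Matrix (Bits (Fin mt) × Fin N) (Bits (Fin mt) × Fin N) ℂ :=
  Matrix.of fun x y =>
    if x.1 = y.1 then
      evol (G (oracleTime mt τ₀ τ₁ (val x.1))) (s * (gridM mt - val x.1)) x.2 y.2
    else 0

/-- The oracles are input models of the problem `P` for the grids given by `K`, `m`, `mt`.
A normalized state `|v⟩` is described by `‖v‖ |v⟩ = v`, which says nothing if `v = 0`. Outside the
stated ranges of their parameters the evolution oracles are arbitrary. -/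
structure Oracles.Implements {m mt N : ℕ} [NeZero N] (O : Oracles m mt N) (P : ODEData N)
    (K : ℝ) : Prop where
  /-- `|0⟩ ↦ |u₀⟩` -/
  prep : ∀ n : Fin N, (‖P.u₀‖ : ℂ) * O.prep.1 n 0 = P.u₀ n
  /-- `|j'⟩|0⟩ ↦ |j'⟩|b(s_{j'})⟩` -/
  src : ∀ (x y : Bits (Fin mt)) (n : Fin N),
    (‖P.b (tNode P.T mt (val x))‖ : ℂ) * O.src.1 (y, n) (x, 0) =
      if y = x then P.b (tNode P.T mt (val x)) n else 0
  /-- `|0⟩ ↦ ‖c‖₁^{-1/2} ∑_j √c_j |j⟩` -/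
  coef : ∀ x : Bits (Fin m),
    (√(∑ y : Bits (Fin m), cCoef K m (val y)) : ℂ) * O.coef.1 x 0 = (√(cCoef K m (val x)) : ℂ)
  /-- `|0⟩ ↦ ‖c̃‖₁^{-1/2} ∑_{j,j'} √c̃_{j,j'} |j'⟩|j⟩` -/
  coefB : ∀ (x' : Bits (Fin mt)) (x : Bits (Fin m)),
    (√(∑ y' : Bits (Fin mt), ∑ y : Bits (Fin m), cCoefB P K m mt (val y) (val y')) : ℂ) *
      O.coefB.1 (Sum.elim x' x) 0 = (√(cCoefB P K m mt (val x) (val x')) : ℂ)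
  /-- `O_L(s, τ) = e^{-i L(τ) s}` for `|s| ≤ 1 / ‖L‖` -/
  simL : ∀ s τ : ℝ, τ ∈ Set.Icc 0 P.T → |s| * supNorm P.T P.L ≤ 1 →
    (O.simL s τ).1 = evol (P.L τ) s
  /-- `O_H(s, τ) = e^{-i H(τ) s}` for `|s| ≤ 1 / ‖H‖` -/
  simH : ∀ s τ : ℝ, τ ∈ Set.Icc 0 P.T → |s| * supNorm P.T P.H ≤ 1 →
    (O.simH s τ).1 = evol (P.H τ) s
  /-- the coherent version of `O_L`, for `|s| M_t ≤ 1 / ‖L‖` -/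
  simLT : ∀ s τ₀ τ₁ : ℝ, (∀ x : Bits (Fin mt), oracleTime mt τ₀ τ₁ (val x) ∈ Set.Icc 0 P.T) →
    |s| * gridM mt * supNorm P.T P.L ≤ 1 → (O.simLT s τ₀ τ₁).1 = evolT mt P.L s τ₀ τ₁
  /-- the coherent version of `O_H`, for `|s| M_t ≤ 1 / ‖H‖` -/
  simHT : ∀ s τ₀ τ₁ : ℝ, (∀ x : Bits (Fin mt), oracleTime mt τ₀ τ₁ (val x) ∈ Set.Icc 0 P.T) →
    |s| * gridM mt * supNorm P.T P.H ≤ 1 → (O.simHT s τ₀ τ₁).1 = evolT mt P.H s τ₀ τ₁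

/-- An oracle query, with the ancilla qubits that it acts on. The flag `inv` selects the inverse
of the oracle. -/
inductive Query (m mt w : ℕ) where
  | prep (inv : Bool)
  | src (e : Fin mt ↪ Fin w) (inv : Bool)
  | coef (e : Fin m ↪ Fin w) (inv : Bool)
  | coefB (e : (Fin mt ⊕ Fin m) ↪ Fin w) (inv : Bool)
  | simL (s τ : ℝ)
  | simH (s τ : ℝ)
  | simLT (e : Fin mt ↪ Fin w) (s τ₀ τ₁ : ℝ)
  | simHT (e : Fin mt ↪ Fin w) (s τ₀ τ₁ : ℝ)

/-- The ancilla qubits that a query acts on. -/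
def Query.wires {m mt w : ℕ} : Query m mt w → Set (Fin w)
  | .prep _ => ∅
  | .src e _ => Set.range e
  | .coef e _ => Set.range e
  | .coefB e _ => Set.range e
  | .simL _ _ => ∅
  | .simH _ _ => ∅
  | .simLT e _ _ _ => Set.range e
  | .simHT e _ _ _ => Set.range e

/-- A gate of a circuit on `w` ancilla qubits and the system register: a one-qubit gate, a
reflection `I - 2 |0…0⟩⟨0…0|` on the ancilla qubits in `S` (and on the system register if `sys`),
or an oracle query, possibly controlled by the values of other ancilla qubits. -/
inductive Gate (m mt w : ℕ) where
  | oneQubit (i : Fin w) (U : Matrix.unitaryGroup (Fin 2) ℂ)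
  | reflect (S : Finset (Fin w)) (sys : Bool)
  | query (o : Query m mt w) (ctrl : Fin w → Option (Fin 2))
      (disj : ∀ i ∈ o.wires, ctrl i = none)

open Classical in
/-- The operator that applies `V` to the ancilla qubits `e` and to the system register, provided
that all qubits with a control have the prescribed value, and does nothing otherwise. -/
def embed {w N : ℕ} {κ : Type} (e : κ ↪ Fin w) (ctrl : Fin w → Option (Fin 2))
    (V : Matrix (Bits κ × Fin N) (Bits κ × Fin N) ℂ) : Matrix (Idx w N) (Idx w N) ℂ :=
  Matrix.of fun x y =>
    if ∀ i v, ctrl i = some v → x.1 i = v then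
      if ∀ i, i ∉ Set.range e → x.1 i = y.1 i then V (x.1 ∘ e, x.2) (y.1 ∘ e, y.2) else 0
    else if x = y then 1 else 0

/-- The empty set of ancilla qubits. -/
def noWires (w : ℕ) : Empty ↪ Fin w := ⟨Empty.elim, fun x => x.elim⟩

/-- An operator on the system register alone. -/
def onSystem {N : ℕ} (V : Matrix (Fin N) (Fin N) ℂ) :
    Matrix (Bits Empty × Fin N) (Bits Empty × Fin N) ℂ :=
  Matrix.of fun x y => V x.2 y.2

/-- An operator on a register of qubits alone. -/
def onQubits {κ : Type} {N : ℕ} (V : Matrix (Bits κ) (Bits κ) ℂ) :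
    Matrix (Bits κ × Fin N) (Bits κ × Fin N) ℂ :=
  Matrix.of fun x y => if x.2 = y.2 then V x.1 y.1 else 0

/-- `V`, or its inverse `V†`. -/
def orInv {ι : Type*} [Fintype ι] [DecidableEq ι] (inv : Bool) (V : Matrix.unitaryGroup ι ℂ) :
    Matrix ι ι ℂ :=
  if inv then V.1.conjTranspose else V.1

/-- The operator of a (controlled) query. -/
def Query.matrix {m mt w N : ℕ} (O : Oracles m mt N) (ctrl : Fin w → Option (Fin 2)) :
    Query m mt w → Matrix (Idx w N) (Idx w N) ℂ
  | .prep inv => embed (noWires w) ctrl (onSystem (orInv inv O.prep))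
  | .src e inv => embed e ctrl (orInv inv O.src)
  | .coef e inv => embed e ctrl (onQubits (orInv inv O.coef))
  | .coefB e inv => embed e ctrl (onQubits (orInv inv O.coefB))
  | .simL s τ => embed (noWires w) ctrl (onSystem (O.simL s τ).1)
  | .simH s τ => embed (noWires w) ctrl (onSystem (O.simH s τ).1)
  | .simLT e s τ₀ τ₁ => embed e ctrl (O.simLT s τ₀ τ₁).1
  | .simHT e s τ₀ τ₁ => embed e ctrl (O.simHT s τ₀ τ₁).1

/-- A single ancilla qubit as a register. -/
def wire {w : ℕ} (i : Fin w) : Unit ↪ Fin w := ⟨fun _ => i, fun _ _ _ => rfl⟩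

open Classical in
/-- The operator of a gate. -/
def Gate.matrix {m mt w N : ℕ} [NeZero N] (O : Oracles m mt N) :
    Gate m mt w → Matrix (Idx w N) (Idx w N) ℂ
  | .oneQubit i U =>
      embed (wire i) (fun _ => none) (onQubits (Matrix.of fun x y => U.1 (x ()) (y ())))
  | .reflect S sys =>
      Matrix.diagonal fun x =>
        if (∀ i ∈ S, x.1 i = 0) ∧ (sys = true → x.2 = 0) then -1 else 1
  | .query o ctrl _ => o.matrix O ctrl

/-- A quantum query circuit: the grid parameters `K`, `m`, `mt` for which its oracles are
provided, the number `w` of ancilla qubits, and the gates in the order of their application. -/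
structure Circuit where
  K : ℝ
  m : ℕ
  mt : ℕ
  w : ℕ
  gates : List (Gate m mt w)
  K_pos : 0 < K
  m_pos : 0 < m
  mt_pos : 0 < mt

namespace Circuit

/-- The unitary of the circuit. -/
def matrix (Q : Circuit) {N : ℕ} [NeZero N] (O : Oracles Q.m Q.mt N) :
    Matrix (Idx Q.w N) (Idx Q.w N) ℂ :=
  Q.gates.foldl (fun U g => g.matrix O * U) 1

/-- The circuit is run on `|0…0⟩|0⟩` and all ancilla qubits are measured; the run is successful
if all outcomes are `0`. This is the unnormalized state of the system register on success: its
squared norm is the success probability. -/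
def output (Q : Circuit) {N : ℕ} [NeZero N] (O : Oracles Q.m Q.mt N) :
    EuclideanSpace ℂ (Fin N) :=
  WithLp.toLp 2 fun n => Q.matrix O (0, n) (0, 0)

/-- The number of queries to the input models of `H` and `L`. -/
def matrixQueries (Q : Circuit) : ℕ :=
  Q.gates.countP fun
    | .query (.simL _ _) _ _ => true
    | .query (.simH _ _) _ _ => true
    | .query (.simLT _ _ _ _) _ _ => true
    | .query (.simHT _ _ _ _) _ _ => true
    | _ => false

/-- The number of queries to the state preparation oracle and to the source term input model. -/
def stateQueries (Q : Circuit) : ℕ :=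
  Q.gates.countP fun
    | .query (.prep _) _ _ => true
    | .query (.src _ _) _ _ => true
    | _ => false

/-- The number of queries to the two coefficient oracles. -/
def coefQueries (Q : Circuit) : ℕ :=
  Q.gates.countP fun
    | .query (.coef _ _) _ _ => true
    | .query (.coefB _ _) _ _ => true
    | _ => false

/-- The number of gates other than oracle queries: one-qubit gates and reflections. -/
def otherGates (Q : Circuit) : ℕ :=
  Q.gates.countP fun
    | .query _ _ _ => false
    | _ => true

end Circuit

/-- The normalized state `|v⟩ = v / ‖v‖`. -/
def ket {N : ℕ} (v : EuclideanSpace ℂ (Fin N)) : EuclideanSpace ℂ (Fin N) :=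
  ((‖v‖ : ℂ)⁻¹) • v

/-- The scalars from which an algorithm chooses its circuit. Everything else about the
differential equation is accessible only through the oracles. -/
structure ClassicalData where
  T : ℝ
  ε : ℝ
  u₀Norm : ℝ
  bNorm : ℝ → ℝ
  uTNorm : ℝ
  Γp : ℝ
  Γ₁ : ℝ
  bC2 : ℝ

/-- The classical data of the problem `P` with solution `u`, order `p` and target precision `ε`:
`T`, `ε`, `‖u₀‖`, the function `s ↦ ‖b(s)‖` on `[0, T]`, `‖u(T)‖`, `Γ_p`, `Γ_1`, `‖b‖_{C²}`. -/
def classicalData {N : ℕ} (P : ODEData N) (u : ℝ → EuclideanSpace ℂ (Fin N)) (p : ℕ) (ε : ℝ) :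
    ClassicalData where
  T := P.T
  ε := ε
  u₀Norm := ‖P.u₀‖
  bNorm := (Set.Icc 0 P.T).indicator fun s => ‖P.b s‖
  uTNorm := ‖u P.T‖
  Γp := P.Gam p
  Γ₁ := P.Gam 1
  bC2 := P.bC2

/-- The ratio `(‖u₀‖ + ‖b‖_{L¹}) / ‖u(T)‖`. -/
def ratio {N : ℕ} (P : ODEData N) (u : ℝ → EuclideanSpace ℂ (Fin N)) : ℝ :=
  (‖P.u₀‖ + P.bL1) / ‖u P.T‖

end LCHS

end

open scoped Matrix.Norms.L2Operator ComplexOrder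

set_option linter.unusedSectionVars false

noncomputable section

open Set MeasureTheory NormedSpace
open scoped Interval ContDiff

/-! ### Linear differential equations in Banach spaces -/

section LinearODE

variable {E : Type*} [NormedAddCommGroup E] [NormedSpace ℝ E] [CompleteSpace E]

/-! Because `L` is positive semidefinite, the generator `-i (z L + H)` is dissipative for every `z`
in the closed lower half plane, and its propagator is a contraction. For real `z = k` the propagator
is unitary, and at `z = -i` the generator is `-A`. A bounded holomorphic function on the lower half
plane has at `-i` the value `∫ f(k) / (π (1 + k²)) dk`. So the solution operator of the dissipative
equation is an average of Hamiltonian evolutions, and Duhamel's formula extends this to the source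
term.

The average is taken of a product formula, not of the exact propagator. With the number `r` of steps
fixed, `approxProp` is an entire function of `z`, so Cauchy's theorem on the rectangle `[-K, K] ×
[-K, 0]` applies to it directly. It needs only a bound of order one there and has truncation error
of order `1 / K` (`norm_cauchy_average_sub_le`). What remains is `exists_approxProp_bounds`. On the
rectangle `|z| ≤ 2 K`, and an error of order one against the contractive propagator suffices. At
`-i` the generator is smaller by a factor of order `K`, and the same step number already gives
accuracy `2 / K`. Both hold once `r` is of order `(K Γ_p T)^(1 + 1/p)`. With `K` of order `q / ε`
and `O(q)` uses of the block encoding, the query bound follows (`ratio_mul_steps_le`).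

The local error of the product formula must have a constant independent of the dimension and of the
matrices. Suzuki's recursion is analysed for smooth generators in an arbitrary Banach algebra: the
five-fold composition removes the leading error term, and time symmetry removes the next one
(`exists_suzuki_error`). Applied once, in the bounded product of all matrix algebras, this yields
one constant for all polynomial generators with coefficients of norm at most one
(`CoeffFamily.exists_uniform_error`). Rescaling time by `Γ_p` and comparing with Taylor polynomials
gives order `p` for generators of class `C^p` (`exists_step_error`).

The integrals over `k` and over time are replaced by trapezoidal sums. Grid sizes enter the costs
through logarithms only, so Lipschitz estimates are enough; `exists_lchsVector_error` collects all
errors.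

In the circuit a flag qubit separates the initial state from the source. The coherent evolution
oracles accept a time that is affine in the grid index, which is just what steps of length `(T -
s_{j'}) / r` require, and the factor `k_j` is assembled from the binary digits of `j`. The all-zero
block of the circuit is the discretized sum divided by its total weight (`zeroBlock_lchsGates`).
Amplitude amplification multiplies this block by a positive scalar and leaves its direction alone
(`norm_smul_zeroBlock_amplified`). The number of rounds can be fixed in advance because the
classical data determine the amplitude up to a relative error of `1 / 15`. -/

/-- The Picard iterates (Dyson series terms) of a linear differential equation. -/
def dysonTerm (Λ : ℝ → E →L[ℝ] E) (x₀ : E) : ℕ → ℝ → E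
  | 0, _ => x₀
  | n + 1, t => ∫ s in (0 : ℝ)..t, Λ s (dysonTerm Λ x₀ n s)

lemma continuous_dysonTerm {Λ : ℝ → E →L[ℝ] E} (hΛ : Continuous Λ) (x₀ : E) (n : ℕ) :
    Continuous (dysonTerm Λ x₀ n) := by
  induction n with
  | zero => exact continuous_const
  | succ n ih =>
    exact intervalIntegral.continuous_primitive
      (fun a b => (hΛ.clm_apply ih).intervalIntegrable a b) 0

lemma hasDerivAt_dysonTerm_succ {Λ : ℝ → E →L[ℝ] E} (hΛ : Continuous Λ) (x₀ : E) (n : ℕ) (t : ℝ) :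
    HasDerivAt (dysonTerm Λ x₀ (n + 1)) (Λ t (dysonTerm Λ x₀ n t)) t :=
  intervalIntegral.integral_hasDerivAt_right
    ((hΛ.clm_apply (continuous_dysonTerm hΛ x₀ n)).intervalIntegrable _ _)
    ((hΛ.clm_apply (continuous_dysonTerm hΛ x₀ n)).stronglyMeasurableAtFilter _ _)
    (hΛ.clm_apply (continuous_dysonTerm hΛ x₀ n)).continuousAt

/-- Each iterated integral raises the power of `|s|` by one and divides by the new exponent; the
resulting factorial makes the series summable at all times. -/
lemma norm_dysonTerm_le {Λ : ℝ → E →L[ℝ] E} (x₀ : E) {R M : ℝ} 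
    (hM : ∀ s, |s| ≤ R → ‖Λ s‖ ≤ M) (n : ℕ) {t : ℝ} (ht : |t| ≤ R) :
    ‖dysonTerm Λ x₀ n t‖ ≤ ‖x₀‖ * ((M * |t|) ^ n / n.factorial) := by
  induction n generalizing t with
  | zero => simp [dysonTerm]
  | succ n ih =>
    have hM0 : 0 ≤ M := (norm_nonneg _).trans (hM t ht)
    have hsub : ∀ s ∈ Ι (0 : ℝ) t, |s| ≤ R := by
      intro s hs
      have := uIoc_subset_uIcc hs
      rw [mem_uIcc] at this
      refine le_trans ?_ ht
      rcases this with h | h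
      · rw [abs_of_nonneg h.1, abs_of_nonneg (h.1.trans h.2)]; exact h.2
      · rw [abs_of_nonpos h.2, abs_of_nonpos (h.1.trans h.2)]; linarith
    have key : ‖dysonTerm Λ x₀ (n + 1) t‖ ≤
        ∫ s in Ι (0 : ℝ) t, M * (‖x₀‖ * (M ^ n / n.factorial)) * |s - 0| ^ n := by
      show ‖∫ s in (0 : ℝ)..t, Λ s (dysonTerm Λ x₀ n s)‖ ≤ _
      rw [intervalIntegral.norm_integral_eq_norm_integral_uIoc]
      refine norm_integral_le_of_norm_le ?_ ?_
      · have : Continuous fun s : ℝ => M * (‖x₀‖ * (M ^ n / n.factorial)) * |s - 0| ^ n := by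
          fun_prop
        exact (this.intervalIntegrable 0 t).def'
      · refine (ae_restrict_iff' measurableSet_uIoc).2 (Filter.Eventually.of_forall fun s hs => ?_)
        calc ‖Λ s (dysonTerm Λ x₀ n s)‖ ≤ ‖Λ s‖ * ‖dysonTerm Λ x₀ n s‖ := (Λ s).le_opNorm _
          _ ≤ M * (‖x₀‖ * ((M * |s|) ^ n / n.factorial)) :=
            mul_le_mul (hM s (hsub s hs)) (ih (hsub s hs)) (norm_nonneg _) hM0
          _ = _ := by rw [sub_zero, mul_pow]; ring
    refine key.trans (le_of_eq ?_)
    rw [integral_const_mul, integral_pow_abs_sub_uIoc, Nat.factorial_succ]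
    push_cast
    rw [sub_zero, mul_pow]
    field_simp
    ring

/-- The Dyson series is differentiated term by term: the derivative of each term is `Λ t` applied to
its predecessor. Finite dimension is not assumed, since the equation is later solved in an infinite
product of matrix algebras. -/
theorem exists_linear_ode_solution {Λ : ℝ → E →L[ℝ] E} (hΛ : Continuous Λ) (x₀ : E) :
    ∃ x : ℝ → E, x 0 = x₀ ∧ ∀ t, HasDerivAt x (Λ t (x t)) t := by
  have hbd : ∀ R : ℝ, ∃ M, 0 ≤ M ∧ ∀ s, |s| ≤ R → ‖Λ s‖ ≤ M := by
    intro R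
    obtain ⟨M, hM⟩ := (isCompact_Icc (a := -R) (b := R)).exists_bound_of_continuousOn
      hΛ.continuousOn
    exact ⟨max M 0, le_max_right _ _, fun s hs => (hM s (abs_le.1 hs)).trans (le_max_left _ _)⟩
  have hsum : ∀ t, Summable fun n => dysonTerm Λ x₀ n t := by
    intro t
    obtain ⟨M, -, hM⟩ := hbd |t|
    refine Summable.of_norm_bounded ?_ (fun n => norm_dysonTerm_le x₀ hM n le_rfl)
    exact (Real.summable_pow_div_factorial _).mul_left _
  have hzero : ∀ n, dysonTerm Λ x₀ (n + 1) 0 = 0 := fun n => by simp [dysonTerm]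
  refine ⟨fun t => ∑' n, dysonTerm Λ x₀ n t, ?_, fun t => ?_⟩
  · show ∑' n, dysonTerm Λ x₀ n 0 = x₀
    rw [(hsum 0).tsum_eq_zero_add]
    simp [dysonTerm]
  -- The margin of one leaves an open interval around both `0` and `t` on which the derivatives are
  -- dominated.
  · obtain ⟨M, hM0, hM⟩ := hbd (|t| + 1)
    have hd : HasDerivAt (fun z => ∑' n, dysonTerm Λ x₀ (n + 1) z)
        (∑' n, Λ t (dysonTerm Λ x₀ n t)) t := by
      refine hasDerivAt_tsum_of_isPreconnected
        (u := fun n => M * (‖x₀‖ * ((M * (|t| + 1)) ^ n / n.factorial)))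
        (t := Ioo (-(|t| + 1)) (|t| + 1)) (g' := fun n z => Λ z (dysonTerm Λ x₀ n z)) (y₀ := 0)
        ?_ isOpen_Ioo isPreconnected_Ioo ?_ ?_ ?_ ?_ ?_
      · exact ((Real.summable_pow_div_factorial _).mul_left _).mul_left _
      · exact fun n y _ => hasDerivAt_dysonTerm_succ hΛ x₀ n y
      · intro n y hy
        have hy' : |y| ≤ |t| + 1 := abs_le.2 ⟨hy.1.le, hy.2.le⟩
        refine ((Λ y).le_opNorm _).trans ?_
        refine mul_le_mul (hM y hy') ((norm_dysonTerm_le x₀ hM n hy').trans ?_)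
          (norm_nonneg _) hM0
        gcongr
      · constructor <;> [skip; skip] <;> have := abs_nonneg t <;> linarith
      · simp [hzero]
      · constructor <;> [have := neg_abs_le t; have := le_abs_self t] <;> linarith
    have h2 : (fun z => ∑' n, dysonTerm Λ x₀ n z) =
        fun z => x₀ + ∑' n, dysonTerm Λ x₀ (n + 1) z := by
      funext z
      rw [(hsum z).tsum_eq_zero_add]
      rfl
    rw [h2]
    simp only
    have h3 : Λ t (x₀ + ∑' n, dysonTerm Λ x₀ (n + 1) t) = ∑' n, Λ t (dysonTerm Λ x₀ n t) := by
      rw [← congrFun h2 t, (Λ t).map_tsum (hsum t)]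
    rw [h3]
    exact hd.const_add x₀

end LinearODE

/-! ### Fundamental solutions in a Banach algebra. -/

section Propagator

variable {𝔸 : Type*} [NormedRing 𝔸] [NormedAlgebra ℝ 𝔸] [CompleteSpace 𝔸]

/-- The fundamental solution `V` of `V' = G V` together with its inverse. -/
theorem exists_fundamental_solution {G : ℝ → 𝔸} (hG : Continuous G) :
    ∃ V W : ℝ → 𝔸, V 0 = 1 ∧ (∀ t, HasDerivAt V (G t * V t) t) ∧
      (∀ t, HasDerivAt W (-(W t * G t)) t) ∧ (∀ t, V t * W t = 1) ∧ ∀ t, W t * V t = 1 := by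
  obtain ⟨V, hV0, hV⟩ := exists_linear_ode_solution
    (Λ := fun t => ContinuousLinearMap.mul ℝ 𝔸 (G t)) (by fun_prop) 1
  obtain ⟨W, hW0, hW⟩ := exists_linear_ode_solution
    (Λ := fun t => -((ContinuousLinearMap.mul ℝ 𝔸).flip (G t))) (by fun_prop) 1
  simp only [ContinuousLinearMap.mul_apply', neg_apply,
    ContinuousLinearMap.flip_apply] at hV hW
  have hWV : ∀ t, W t * V t = 1 := by
    have hd : ∀ t, HasDerivAt (fun t => W t * V t) 0 t := by
      intro t
      convert! (hW t).mul (hV t) using 1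
      noncomm_ring
    have hc := is_const_of_deriv_eq_zero (fun t => (hd t).differentiableAt)
      (fun t => (hd t).deriv)
    intro t
    rw [hc t 0, hV0, hW0, mul_one]
  refine ⟨V, W, hV0, hV, hW, ?_, hWV⟩
  -- `V W` solves the same linear equation as the constant `1`
  intro t
  have hZ : ∀ s, HasDerivAt (fun s => V s * W s) (G s * (V s * W s) - (V s * W s) * G s) s := by
    intro s
    convert! (hV s).mul (hW s) using 1
    noncomm_ring
  obtain ⟨M, hM⟩ := (isCompact_Icc (a := -(|t| + 1)) (b := |t| + 1)).exists_bound_of_continuousOn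
      hG.continuousOn
  have h0 : (0 : ℝ) ∈ Ioo (-(|t| + 1)) (|t| + 1) := by
    constructor <;> have := abs_nonneg t <;> linarith
  have hM0 : 0 ≤ M := (norm_nonneg _).trans (hM 0 (Ioo_subset_Icc_self h0))
  have huniq := ODE_solution_unique_of_mem_Ioo (v := fun s x => G s * x - x * G s)
    (s := fun _ => univ) (K := ⟨2 * M, by positivity⟩) (a := -(|t| + 1)) (b := |t| + 1) (t₀ := 0)
    (f := fun s => V s * W s) (g := fun _ => 1) ?_ h0
    (fun s _ => ⟨hZ s, mem_univ _⟩) (fun s _ => ⟨by simpa using hasDerivAt_const s (1 : 𝔸), mem_univ _⟩)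
    (by simp [hV0, hW0])
  · exact huniq (by constructor <;> [have := neg_abs_le t; have := le_abs_self t] <;> linarith)
  · intro s hs
    refine LipschitzOnWith.of_dist_le_mul fun x _ y _ => ?_
    rw [dist_eq_norm, dist_eq_norm]
    have hb := hM s (Ioo_subset_Icc_self hs)
    calc ‖G s * x - x * G s - (G s * y - y * G s)‖ = ‖G s * (x - y) - (x - y) * G s‖ := by
          congr 1; noncomm_ring
      _ ≤ ‖G s‖ * ‖x - y‖ + ‖x - y‖ * ‖G s‖ :=
          (norm_sub_le _ _).trans (add_le_add (norm_mul_le _ _) (norm_mul_le _ _))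
      _ ≤ M * ‖x - y‖ + ‖x - y‖ * M := by gcongr
      _ = (2 * M) * ‖x - y‖ := by ring

end Propagator

/-! ### Perturbation bounds for exponentials and their products. -/

section ExpBounds

variable {𝔸 : Type*} [NormedRing 𝔸] [NormedAlgebra ℝ 𝔸] [CompleteSpace 𝔸] [NormOneClass 𝔸]

lemma norm_exp_le_exp_norm (x : 𝔸) : ‖exp x‖ ≤ Real.exp ‖x‖ := by
  rw [exp_eq_tsum ℝ, Real.exp_eq_exp_ℝ, exp_eq_tsum ℝ]
  refine tsum_of_norm_bounded (NormedSpace.expSeries_summable' (𝕂 := ℝ) ‖x‖).hasSum fun n => ?_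
  rw [norm_smul, smul_eq_mul]
  refine mul_le_mul (le_of_eq ?_) (norm_pow_le _ _) (norm_nonneg _) (by positivity)
  rw [Real.norm_of_nonneg (by positivity)]

/-- Differentiating `s ↦ exp (s x) exp ((1 - s) y)` leaves only `x - y` between the two
exponentials, so no commutation is needed; the two outer norms multiply to at most `exp c`. -/
lemma norm_exp_sub_exp_le {x y : 𝔸} {c : ℝ} (hx : ‖x‖ ≤ c) (hy : ‖y‖ ≤ c) :
    ‖exp x - exp y‖ ≤ Real.exp c * ‖x - y‖ := by
  have hd : ∀ s : ℝ, HasDerivAt (fun s : ℝ => exp (s • x) * exp ((1 - s) • y))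
      (exp (s • x) * (x - y) * exp ((1 - s) • y)) s := by
    intro s
    have h1 := hasDerivAt_exp_smul_const (𝕂 := ℝ) x s
    have h2 := (hasDerivAt_exp_smul_const' (𝕂 := ℝ) y (1 - s)).scomp s
      ((hasDerivAt_id s).const_sub 1)
    convert! h1.mul h2 using 1
    simp only [Function.comp, neg_smul, one_smul]
    noncomm_ring
  have := norm_image_sub_le_of_norm_deriv_le_segment_01'
    (f := fun s : ℝ => exp (s • x) * exp ((1 - s) • y)) (C := Real.exp c * ‖x - y‖)
    (fun s _ => (hd s).hasDerivWithinAt) ?_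
  · simpa using this
  · intro s hs
    have hs1 : 0 ≤ 1 - s := by linarith [hs.2]
    have e1 : ‖exp (s • x)‖ ≤ Real.exp (s * c) := by
      refine (norm_exp_le_exp_norm _).trans (Real.exp_le_exp.2 ?_)
      rw [norm_smul, Real.norm_of_nonneg hs.1]
      exact mul_le_mul_of_nonneg_left hx hs.1
    have e2 : ‖exp ((1 - s) • y)‖ ≤ Real.exp ((1 - s) * c) := by
      refine (norm_exp_le_exp_norm _).trans (Real.exp_le_exp.2 ?_)
      rw [norm_smul, Real.norm_of_nonneg hs1]
      exact mul_le_mul_of_nonneg_left hy hs1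
    calc _ ≤ ‖exp (s • x)‖ * ‖x - y‖ * ‖exp ((1 - s) • y)‖ := by
          refine (norm_mul_le _ _).trans ?_
          gcongr
          exact norm_mul_le _ _
      _ ≤ Real.exp (s * c) * ‖x - y‖ * Real.exp ((1 - s) * c) := by gcongr
      _ = Real.exp (s * c + (1 - s) * c) * ‖x - y‖ := by rw [Real.exp_add]; ring
      _ = _ := by ring_nf

/-- Perturbation of a product of bounded factors. -/
lemma norm_list_prod_sub_le {α : Type*} (l : List α) (f g : α → 𝔸) {B δ : ℝ} (hB : 1 ≤ B)
    (hf : ∀ a ∈ l, ‖f a‖ ≤ B) (hg : ∀ a ∈ l, ‖g a‖ ≤ B) (hfg : ∀ a ∈ l, ‖f a - g a‖ ≤ δ) :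
    ‖(l.map f).prod‖ ≤ B ^ l.length ∧ ‖(l.map f).prod - (l.map g).prod‖ ≤ l.length * B ^ l.length * δ := by
  induction l with
  | nil => simp
  | cons a l ih =>
    obtain ⟨ih1, ih2⟩ := ih (fun b hb => hf b (List.mem_cons_of_mem _ hb))
      (fun b hb => hg b (List.mem_cons_of_mem _ hb)) (fun b hb => hfg b (List.mem_cons_of_mem _ hb))
    have ha := hf a List.mem_cons_self
    have ha' := hg a List.mem_cons_self
    have hδ := hfg a List.mem_cons_self
    have hδ0 : 0 ≤ δ := (norm_nonneg _).trans hδ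
    simp only [List.map_cons, List.prod_cons, List.length_cons, pow_succ]
    constructor
    · refine (norm_mul_le _ _).trans ?_
      rw [mul_comm (B ^ _)]
      gcongr
    · have : f a * (l.map f).prod - g a * (l.map g).prod =
          (f a - g a) * (l.map f).prod + g a * ((l.map f).prod - (l.map g).prod) := by noncomm_ring
      rw [this]
      calc _ ≤ ‖f a - g a‖ * ‖(l.map f).prod‖ + ‖g a‖ * ‖(l.map f).prod - (l.map g).prod‖ :=
            (norm_add_le _ _).trans (add_le_add (norm_mul_le _ _) (norm_mul_le _ _))
        _ ≤ δ * B ^ l.length + B * (l.length * B ^ l.length * δ) := by gcongr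
        _ ≤ δ * (B ^ l.length * B) + B * (l.length * B ^ l.length * δ) := by
            gcongr
            exact le_mul_of_one_le_right (by positivity) hB
        _ = _ := by push_cast; ring

end ExpBounds

/-! ### Hadamard's lemma -/

section Hadamard

universe v

/-- Differentiation under the integral produces an integral of the same kind with values in `ℝ × ℝ
→L[ℝ] F`, so the induction has to run over all target spaces at once. -/
lemma contDiff_integral_param_nat (n : ℕ) : ∀ {F : Type v} [NormedAddCommGroup F] [NormedSpace ℝ F]
    {f : (ℝ × ℝ) × ℝ → F}, ContDiff ℝ ∞ f →
      ContDiff ℝ n (fun q => ∫ x in (0 : ℝ)..1, f (q, x)) := by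
  induction n with
  | zero =>
    intro F _ _ f hf
    rw [Nat.cast_zero, contDiff_zero]
    exact intervalIntegral.continuous_parametric_intervalIntegral_of_continuous'
      (f := fun q x => f (q, x)) hf.continuous 0 1
  | succ n ih =>
    intro F _ _ f hf
    set f' : (ℝ × ℝ) × ℝ → (ℝ × ℝ →L[ℝ] F) := fun y =>
      (fderiv ℝ f y).comp (ContinuousLinearMap.inl ℝ (ℝ × ℝ) ℝ) with hf'
    have hf's : ContDiff ℝ ∞ f' :=
      (hf.fderiv_right (m := ∞) (by simp)).clm_comp contDiff_const
    have hd : ∀ q, HasFDerivAt (fun q => ∫ x in (0 : ℝ)..1, f (q, x))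
        (∫ x in (0 : ℝ)..1, f' (q, x)) q := by
      intro q
      obtain ⟨B, hB⟩ := ((isCompact_closedBall q 1).prod (isCompact_Icc (a := (0 : ℝ)) (b := 1))).exists_bound_of_continuousOn
        hf's.continuous.continuousOn
      refine intervalIntegral.hasFDerivAt_integral_of_dominated_of_fderiv_le
        (F := fun q x => f (q, x)) (F' := fun q x => f' (q, x)) (bound := fun _ => B)
        (s := Metric.ball q 1) (Metric.ball_mem_nhds q one_pos) ?_ ?_ ?_ ?_ ?_ ?_
      · refine Filter.Eventually.of_forall fun x => ?_
        exact (hf.continuous.comp (by fun_prop)).aestronglyMeasurable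
      · exact (hf.continuous.comp (by fun_prop : Continuous fun x : ℝ => (q, x))).intervalIntegrable _ _
      · exact (hf's.continuous.comp (by fun_prop : Continuous fun x : ℝ => (q, x))).aestronglyMeasurable
      · refine Filter.Eventually.of_forall fun x hx y hy => hB (y, x) ⟨?_, ?_⟩
        · exact Metric.ball_subset_closedBall hy
        · rw [uIoc_of_le zero_le_one] at hx
          exact Ioc_subset_Icc_self hx
      · exact intervalIntegrable_const
      · refine Filter.Eventually.of_forall fun x hx y hy => ?_
        have h1 := (hf.differentiable (by simp) (y, x)).hasFDerivAt
        have h2 : HasFDerivAt (fun y : ℝ × ℝ => (y, x)) (ContinuousLinearMap.inl ℝ (ℝ × ℝ) ℝ) y :=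
          (hasFDerivAt_id y).prodMk (hasFDerivAt_const x y)
        exact h1.comp y h2
    rw [Nat.cast_succ, contDiff_succ_iff_fderiv]
    refine ⟨fun q => (hd q).differentiableAt, by simp, ?_⟩
    rw [show fderiv ℝ (fun q => ∫ x in (0 : ℝ)..1, f (q, x)) = fun q => ∫ x in (0 : ℝ)..1, f' (q, x)
      from funext fun q => (hd q).fderiv]
    exact ih hf's

lemma contDiff_integral_param {F : Type v} [NormedAddCommGroup F] [NormedSpace ℝ F]
    {f : (ℝ × ℝ) × ℝ → F} (hf : ContDiff ℝ ∞ f) :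
    ContDiff ℝ ∞ (fun q => ∫ x in (0 : ℝ)..1, f (q, x)) :=
  contDiff_infty.2 fun n => contDiff_integral_param_nat n hf

variable {F : Type v} [NormedAddCommGroup F] [NormedSpace ℝ F] [CompleteSpace F]

/-- **Hadamard's lemma** in the second variable. -/
theorem exists_eq_smul_of_contDiff {f : ℝ × ℝ → F} (hf : ContDiff ℝ ∞ f) :
    ∃ R : ℝ × ℝ → F, ContDiff ℝ ∞ R ∧ ∀ q, f q = f (q.1, 0) + q.2 • R q := by
  set g : ℝ × ℝ → F := fun q => fderiv ℝ f q (0, 1) with hg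
  have hgs : ContDiff ℝ ∞ g := (hf.fderiv_right (m := ∞) (by simp)).clm_apply contDiff_const
  -- The fundamental theorem of calculus along `x ↦ (q.1, x * q.2)`, where the chain rule supplies
  -- the factor `q.2`.
  refine ⟨fun q => ∫ x in (0 : ℝ)..1, g (q.1, x * q.2),
    contDiff_integral_param (f := fun y => g (y.1.1, y.2 * y.1.2)) (hgs.comp (by fun_prop)),
    fun q => ?_⟩
  have hd : ∀ x ∈ uIcc (0 : ℝ) 1, HasDerivAt (fun x : ℝ => f (q.1, x * q.2))
      (q.2 • g (q.1, x * q.2)) x := by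
    intro x _
    have h1 := (hf.differentiable (by simp) (q.1, x * q.2)).hasFDerivAt
    have h2 : HasDerivAt (fun x : ℝ => (q.1, x * q.2)) ((0 : ℝ), q.2) x :=
      (hasDerivAt_const x q.1).prodMk (by simpa using (hasDerivAt_id x).mul_const q.2)
    have h3 := h1.comp_hasDerivAt x h2
    have h4 : ((0 : ℝ), q.2) = q.2 • ((0 : ℝ), (1 : ℝ)) := by simp
    rw [h4, map_smul] at h3
    exact h3
  have := intervalIntegral.integral_eq_sub_of_hasDerivAt hd
    (Continuous.intervalIntegrable (by
      have := hgs.continuous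
      fun_prop) _ _)
  rw [intervalIntegral.integral_smul] at this
  rw [this]
  simp

end Hadamard

/-! ### Suzuki product formulas for time-dependent generators -/

/-- A stage `exp (α h X_b (t + β h))` of a product formula for two generators `X_true`,
`X_false`. -/
structure Stage where
  b : Bool
  α : ℝ
  β : ℝ

/-- The stages of a product formula applied on the subinterval `[t + σ h, t + (σ + s) h]`. -/
def Stage.rescale (σ s : ℝ) (a : Stage) : Stage := ⟨a.b, s * a.α, σ + s * a.β⟩

/-- The coefficient of Suzuki's five-fold composition that removes the error term of
degree `n`. -/
def suzukiCoef (n : ℕ) : ℝ := 1 / (4 - (4 : ℝ) ^ (1 / (n : ℝ)))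

/-- Suzuki's five-fold composition of a product formula. -/
def fiveFold (s : ℝ) (l : List Stage) : List Stage :=
  l.map (Stage.rescale (1 - s) s) ++ (l.map (Stage.rescale (1 - 2 * s) s) ++
    (l.map (Stage.rescale (2 * s) (1 - 4 * s)) ++
      (l.map (Stage.rescale s s) ++ l.map (Stage.rescale 0 s))))

/-- Suzuki's product formula of order `2 k + 2`; the stages are listed in the order of the factors
of the product. -/
def suzuki : ℕ → List Stage
  | 0 => [⟨true, 1 / 2, 1 / 2⟩, ⟨false, 1, 1 / 2⟩, ⟨true, 1 / 2, 1 / 2⟩]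
  | k + 1 => fiveFold (suzukiCoef (2 * k + 3)) (suzuki k)

/-- This range makes `|1 - 4 s| ≤ 1` and keeps the end points of all five substeps in `[0, 1]`,
including the middle one, which runs backwards in time. -/
lemma suzukiCoef_mem (n : ℕ) (hn : 2 ≤ n) : suzukiCoef n ∈ Icc (1 / 3 : ℝ) (1 / 2) := by
  have h1 : (1 : ℝ) ≤ (4 : ℝ) ^ (1 / (n : ℝ)) := Real.one_le_rpow (by norm_num) (by positivity)
  have h2 : (4 : ℝ) ^ (1 / (n : ℝ)) ≤ 2 := by
    calc (4 : ℝ) ^ (1 / (n : ℝ)) ≤ (4 : ℝ) ^ (1 / 2 : ℝ) := by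
          apply Real.rpow_le_rpow_of_exponent_le (by norm_num)
          have : (2 : ℝ) ≤ n := by exact_mod_cast hn
          exact one_div_le_one_div_of_le (by norm_num) this
      _ = 2 := by
          rw [← Real.sqrt_eq_rpow, show (4 : ℝ) = 2 ^ 2 by norm_num]
          exact Real.sqrt_sq (by norm_num)
  unfold suzukiCoef
  constructor
  · exact one_div_le_one_div_of_le (by linarith) (by linarith)
  · exact one_div_le_one_div_of_le (by linarith) (by linarith)

/-- Since `1 - 4 s = -4 ^ (1 / n) s`, its odd power of exponent `n` is `-4 s ^ n`. -/
lemma suzukiCoef_eq (n : ℕ) (hn : Odd n) (hn2 : 2 ≤ n) :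
    4 * suzukiCoef n ^ n + (1 - 4 * suzukiCoef n) ^ n = 0 := by
  have h2 := suzukiCoef_mem n hn2
  have h0 : (4 : ℝ) - (4 : ℝ) ^ (1 / (n : ℝ)) ≠ 0 := by
    intro h
    unfold suzukiCoef at h2
    rw [h] at h2
    norm_num at h2
  have h3 : 1 - 4 * suzukiCoef n = -((4 : ℝ) ^ (1 / (n : ℝ)) * suzukiCoef n) := by
    unfold suzukiCoef
    field_simp
    ring
  have h4 : ((4 : ℝ) ^ (1 / (n : ℝ))) ^ n = 4 := by
    rw [← Real.rpow_natCast, ← Real.rpow_mul (by norm_num)]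
    rw [one_div_mul_cancel (by positivity), Real.rpow_one]
  rw [h3, hn.neg_pow, mul_pow, h4]
  ring

/-- A sampling time within a substep is a convex combination of the end points of that substep,
which lie in the step. Sampling outside could leave `[0, T]`, where neither the generators nor the
oracles are controlled. -/
lemma suzuki_bounds (k : ℕ) : ∀ a ∈ suzuki k, |a.α| ≤ 1 ∧ a.β ∈ Icc (0 : ℝ) 1 := by
  induction k with
  | zero =>
    intro a ha
    simp only [suzuki, List.mem_cons, List.not_mem_nil, or_false] at ha
    rcases ha with rfl | rfl | rfl <;> norm_num [abs_of_pos]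
  | succ k ih =>
    obtain ⟨h1, h2⟩ := suzukiCoef_mem (2 * k + 3) (by omega)
    set s := suzukiCoef (2 * k + 3) with hs
    have key : ∀ σ s' : ℝ, |s'| ≤ 1 → σ ∈ Icc (0 : ℝ) 1 → σ + s' ∈ Icc (0 : ℝ) 1 →
        ∀ a ∈ (suzuki k).map (Stage.rescale σ s'), |a.α| ≤ 1 ∧ a.β ∈ Icc (0 : ℝ) 1 := by
      intro σ s' h3 h4 h5 a ha
      obtain ⟨a', ha', rfl⟩ := List.mem_map.1 ha
      obtain ⟨i1, i2⟩ := ih a' ha'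
      refine ⟨?_, ?_⟩
      · show |s' * a'.α| ≤ 1
        rw [abs_mul]
        exact mul_le_one₀ h3 (abs_nonneg _) i1
      · show σ + s' * a'.β ∈ Icc (0 : ℝ) 1
        have : σ + s' * a'.β = (1 - a'.β) * σ + a'.β * (σ + s') := by ring
        rw [this]
        exact convex_Icc (0 : ℝ) 1 h4 h5 (by linarith [i2.2]) i2.1 (by ring)
    intro a ha
    simp only [suzuki, fiveFold, List.mem_append, ← hs] at ha
    rcases ha with ha | ha | ha | ha | ha
    all_goals
      refine key _ _ ?_ ?_ ?_ a ha <;> first | (rw [abs_le]; constructor <;> linarith) |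
        (constructor <;> linarith)

/-! ### The order of Suzuki's formulas for smooth generators in a Banach algebra. -/

section Order

variable {𝔸 : Type*} [NormedRing 𝔸] [NormedAlgebra ℝ 𝔸] [CompleteSpace 𝔸]

/-- The product formula with stages `l` on the step `[t, t + h]`. -/
def formulaStep (X : Bool → ℝ → 𝔸) (l : List Stage) (t h : ℝ) : 𝔸 :=
  (l.map fun a => exp ((a.α * h) • X a.b (t + a.β * h))).prod

lemma formulaStep_append (X : Bool → ℝ → 𝔸) (l l' : List Stage) (t h : ℝ) :
    formulaStep X (l ++ l') t h = formulaStep X l t h * formulaStep X l' t h := by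
  simp [formulaStep]

lemma formulaStep_rescale (X : Bool → ℝ → 𝔸) (l : List Stage) (σ s t h : ℝ) :
    formulaStep X (l.map (Stage.rescale σ s)) t h = formulaStep X l (t + σ * h) (s * h) := by
  simp only [formulaStep, List.map_map]
  congr 1
  refine List.map_congr_left fun a _ => ?_
  simp only [Function.comp, Stage.rescale]
  congr 2
  · ring
  · congr 1; ring

lemma formulaStep_fiveFold (X : Bool → ℝ → 𝔸) (s : ℝ) (l : List Stage) (t h : ℝ) :
    formulaStep X (fiveFold s l) t h =
      formulaStep X l (t + (1 - s) * h) (s * h) * (formulaStep X l (t + (1 - 2 * s) * h) (s * h) *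
        (formulaStep X l (t + 2 * s * h) ((1 - 4 * s) * h) *
          (formulaStep X l (t + s * h) (s * h) * formulaStep X l t (s * h)))) := by
  simp only [fiveFold, formulaStep_append, formulaStep_rescale, zero_mul, add_zero]

lemma contDiff_exp_comp {f : ℝ × ℝ → 𝔸} (hf : ContDiff ℝ ∞ f) :
    ContDiff ℝ ∞ fun q => exp (f q) := by
  have : ContDiff ℝ ∞ (exp : 𝔸 → 𝔸) :=
    (AnalyticOnNhd.contDiff (𝕜 := ℝ) fun x _ => exp_analytic x)
  exact this.comp hf

lemma contDiff_formulaStep {X : Bool → ℝ → 𝔸} (hX : ∀ b, ContDiff ℝ ∞ (X b)) (l : List Stage) :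
    ContDiff ℝ ∞ fun q : ℝ × ℝ => formulaStep X l q.1 q.2 := by
  induction l with
  | nil => exact contDiff_const
  | cons a l ih =>
    simp only [formulaStep, List.map_cons, List.prod_cons] at ih ⊢
    have h1 : ContDiff ℝ ∞ fun q : ℝ × ℝ => a.α * q.2 := by fun_prop
    have h2 : ContDiff ℝ ∞ fun q : ℝ × ℝ => q.1 + a.β * q.2 := by fun_prop
    exact ContDiff.mul (contDiff_exp_comp (h1.smul ((hX a.b).comp h2))) ih

/-- The base formula is palindromic and the five-fold composition preserves this: the substeps of
the backward step invert the forward substeps in opposite order and cancel from the inside outwards.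
-/
lemma formulaStep_suzuki_symm (X : Bool → ℝ → 𝔸) (k : ℕ) : ∀ t h : ℝ,
    formulaStep X (suzuki k) t h * formulaStep X (suzuki k) (t + h) (-h) = 1 := by
  let _ : NormedAlgebra ℚ 𝔸 := NormedAlgebra.restrictScalars ℚ ℝ 𝔸
  have hinv : ∀ x : 𝔸, exp x * exp (-x) = 1 := fun x => by
    rw [← exp_add_of_commute (Commute.neg_right (Commute.refl x)), add_neg_cancel, exp_zero]
  induction k with
  | zero =>
    intro t h
    simp only [formulaStep, suzuki, List.map_cons, List.map_nil, List.prod_cons, List.prod_nil,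
      mul_one]
    have e : t + h + 1 / 2 * -h = t + 1 / 2 * h := by ring
    rw [e]
    simp only [mul_neg, neg_smul]
    set a := exp ((1 / 2 * h) • X true (t + 1 / 2 * h))
    set a' := exp (-((1 / 2 * h) • X true (t + 1 / 2 * h)))
    set b := exp ((1 * h) • X false (t + 1 / 2 * h))
    set b' := exp (-((1 * h) • X false (t + 1 / 2 * h)))
    have ha : a * a' = 1 := hinv _
    have hb : b * b' = 1 := hinv _
    calc a * (b * a) * (a' * (b' * a')) = a * (b * (a * a') * b') * a' := by noncomm_ring
      _ = 1 := by rw [ha, mul_one, hb, mul_one, ha]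
  | succ k ih =>
    intro t h
    simp only [suzuki, formulaStep_fiveFold]
    set s := suzukiCoef (2 * k + 3)
    set S := formulaStep X (suzuki k)
    have i1 := ih t (s * h)
    have i2 := ih (t + s * h) (s * h)
    have i3 := ih (t + 2 * s * h) ((1 - 4 * s) * h)
    have i4 := ih (t + (1 - 2 * s) * h) (s * h)
    have i5 := ih (t + (1 - s) * h) (s * h)
    have j1 : S (t + h + (1 - s) * -h) (s * -h) = S (t + s * h) (-(s * h)) := by
      congr 1 <;> ring
    have j2 : S (t + h + (1 - 2 * s) * -h) (s * -h) = S (t + s * h + s * h) (-(s * h)) := by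
      congr 1 <;> ring
    have j3 : S (t + h + 2 * s * -h) ((1 - 4 * s) * -h) =
        S (t + 2 * s * h + (1 - 4 * s) * h) (-((1 - 4 * s) * h)) := by
      congr 1 <;> ring
    have j4 : S (t + h + s * -h) (s * -h) = S (t + (1 - 2 * s) * h + s * h) (-(s * h)) := by
      congr 1 <;> ring
    have j5 : S (t + h) (s * -h) = S (t + (1 - s) * h + s * h) (-(s * h)) := by
      congr 1 <;> ring
    rw [j1, j2, j3, j4, j5]
    generalize S (t + s * h) (-(s * h)) = y1 at *
    generalize S (t + s * h + s * h) (-(s * h)) = y2 at *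
    generalize S (t + 2 * s * h + (1 - 4 * s) * h) (-((1 - 4 * s) * h)) = y3 at *
    generalize S (t + (1 - 2 * s) * h + s * h) (-(s * h)) = y4 at *
    generalize S (t + (1 - s) * h + s * h) (-(s * h)) = y5 at *
    generalize S t (s * h) = x1 at *
    generalize S (t + s * h) (s * h) = x2 at *
    generalize S (t + 2 * s * h) ((1 - 4 * s) * h) = x3 at *
    generalize S (t + (1 - 2 * s) * h) (s * h) = x4 at *
    generalize S (t + (1 - s) * h) (s * h) = x5 at *
    calc x5 * (x4 * (x3 * (x2 * x1))) * (y1 * (y2 * (y3 * (y4 * y5))))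
        = x5 * (x4 * (x3 * (x2 * (x1 * y1) * y2) * y3) * y4) * y5 := by noncomm_ring
      _ = 1 := by rw [i1, mul_one, i2, mul_one, i3, mul_one, i4, mul_one, i5]

/-- `S` agrees with `U` up to `c • hⁿ R(t, 0)` and terms of order `n + 1` in `h`, and `U` is a
smooth perturbation of the identity. -/
structure LeadingError (n : ℕ) (R₀ : ℝ × ℝ → 𝔸) (S U : ℝ × ℝ → 𝔸) (c : ℝ) : Prop where
  smooth : ContDiff ℝ ∞ U
  near_one : ∃ Y, ContDiff ℝ ∞ Y ∧ ∀ q, U q = 1 + q.2 • Y q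
  err : ∃ Q, ContDiff ℝ ∞ Q ∧ ∀ q, S q = U q + q.2 ^ n • (c • R₀ q + q.2 • Q q)

/-- Both exact evolutions are `1 + O(h)`, so multiplying an error term by them changes it only at
the next order, and the leading coefficients add. The product of the two errors has degree `2 n + 2
≥ n + 2` and goes into the remainder. -/
lemma LeadingError.mul {n : ℕ} {R₀ S₁ U₁ S₂ U₂ : ℝ × ℝ → 𝔸} {c₁ c₂ : ℝ}
    (hR : ContDiff ℝ ∞ R₀) (h₁ : LeadingError (n + 1) R₀ S₁ U₁ c₁)
    (h₂ : LeadingError (n + 1) R₀ S₂ U₂ c₂) :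
    LeadingError (n + 1) R₀ (fun q => S₁ q * S₂ q) (fun q => U₁ q * U₂ q) (c₁ + c₂) := by
  obtain ⟨u1, ⟨Y1, hY1, eY1⟩, ⟨Q1, hQ1, eQ1⟩⟩ := h₁
  obtain ⟨u2, ⟨Y2, hY2, eY2⟩, ⟨Q2, hQ2, eQ2⟩⟩ := h₂
  refine ⟨u1.mul u2, ⟨fun q => Y1 q + Y2 q + q.2 • (Y1 q * Y2 q), ?_, fun q => ?_⟩,
    ⟨fun q => c₁ • (R₀ q * Y2 q) + c₂ • (Y1 q * R₀ q) + Q1 q * U₂ q + U₁ q * Q2 q +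
      q.2 ^ n • ((c₁ • R₀ q + q.2 • Q1 q) * (c₂ • R₀ q + q.2 • Q2 q)), ?_, fun q => ?_⟩⟩
  · fun_prop
  · rw [eY1, eY2]
    simp only [mul_add, add_mul, smul_add, smul_mul_assoc, mul_smul_comm, smul_smul, one_mul,
      mul_one]
    module
  · fun_prop
  · have e1 : R₀ q * U₂ q = R₀ q + q.2 • (R₀ q * Y2 q) := by
      rw [eY2, mul_add, mul_one, mul_smul_comm]
    have e2 : U₁ q * R₀ q = R₀ q + q.2 • (Y1 q * R₀ q) := by
      rw [eY1, add_mul, one_mul, smul_mul_assoc]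
    simp only [eQ1 q, eQ2 q]
    simp only [mul_add, add_mul, smul_add, smul_mul_assoc, mul_smul_comm, smul_smul, e1, e2]
    module

/-- The subinterval `[t + σ h, t + (σ + s) h]` of the step `[t, t + h]`. -/
def subStep (S : ℝ × ℝ → 𝔸) (σ s : ℝ) (q : ℝ × ℝ) : 𝔸 := S (q.1 + σ * q.2, s * q.2)

/-- The error of a substep is `(s h) ^ n R (t + σ h, s h)`; Hadamard's lemma replaces `R` by its
value at `(t, 0)` at the cost of a further factor `h`. All substeps thus share one leading term up
to the scalar `s ^ n`. -/
lemma LeadingError.subStep {n : ℕ} {S U R : ℝ × ℝ → 𝔸} (hU : ContDiff ℝ ∞ U)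
    (hU0 : ∀ t, U (t, 0) = 1) (hR : ContDiff ℝ ∞ R)
    (hSU : ∀ q, S q = U q + q.2 ^ n • R q) (σ s : ℝ) :
    LeadingError n (fun q => R (q.1, 0)) (subStep S σ s) (subStep U σ s) (s ^ n) := by
  have hsub : ∀ {f : ℝ × ℝ → 𝔸}, ContDiff ℝ ∞ f → ContDiff ℝ ∞ (_root_.subStep f σ s) := by
    intro f hf
    exact hf.comp (by fun_prop)
  obtain ⟨Y, hY, eY⟩ := exists_eq_smul_of_contDiff (hsub hU)
  obtain ⟨Q, hQ, eQ⟩ := exists_eq_smul_of_contDiff (hsub hR)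
  refine ⟨hsub hU, ⟨Y, hY, fun q => ?_⟩, ⟨fun q => s ^ n • Q q, by fun_prop, fun q => ?_⟩⟩
  · rw [eY]
    simp [_root_.subStep, hU0]
  · have h1 : _root_.subStep S σ s q = _root_.subStep U σ s q +
        (s * q.2) ^ n • _root_.subStep R σ s q := hSU _
    rw [h1, eQ q]
    simp only [_root_.subStep, mul_zero, add_zero, mul_pow, smul_add, smul_smul]
    module

/-- Suzuki's composition removes the leading error term. -/
lemma exists_fiveFold_error {n : ℕ} {S U R : ℝ × ℝ → 𝔸} {s : ℝ}
    (hs : 4 * s ^ (n + 1) + (1 - 4 * s) ^ (n + 1) = 0) (hU : ContDiff ℝ ∞ U)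
    (hU0 : ∀ t, U (t, 0) = 1) (hUU : ∀ t h h', U (t + h, h') * U (t, h) = U (t, h + h'))
    (hR : ContDiff ℝ ∞ R) (hSU : ∀ q, S q = U q + q.2 ^ (n + 1) • R q) :
    ∃ Q, ContDiff ℝ ∞ Q ∧ ∀ q : ℝ × ℝ,
      S (q.1 + (1 - s) * q.2, s * q.2) * (S (q.1 + (1 - 2 * s) * q.2, s * q.2) *
        (S (q.1 + 2 * s * q.2, (1 - 4 * s) * q.2) * (S (q.1 + s * q.2, s * q.2) *
          S (q.1, s * q.2)))) = U q + q.2 ^ (n + 2) • Q q := by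
  have hL := LeadingError.subStep hU hU0 hR hSU
  have hR0 : ContDiff ℝ ∞ fun q : ℝ × ℝ => R (q.1, 0) := hR.comp (by fun_prop)
  have := (hL (1 - s) s).mul hR0 ((hL (1 - 2 * s) s).mul hR0 ((hL (2 * s) (1 - 4 * s)).mul hR0
    ((hL s s).mul hR0 (hL 0 s))))
  obtain ⟨Q, hQ, eQ⟩ := this.err
  refine ⟨Q, hQ, fun q => ?_⟩
  have e1 := eQ q
  simp only [_root_.subStep, zero_mul, add_zero] at e1
  rw [e1]
  -- The leading terms of the five substeps cancel by the choice of `s`.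
  have hc : s ^ (n + 1) + (s ^ (n + 1) + ((1 - 4 * s) ^ (n + 1) + (s ^ (n + 1) + s ^ (n + 1)))) = 0 := by
    linarith
  rw [hc, zero_smul, zero_add, smul_smul, ← pow_succ]
  congr 1
  -- The exact evolutions over consecutive substeps compose to the one over the whole step.
  have c1 := hUU q.1 (s * q.2) (s * q.2)
  have c2 := hUU q.1 (s * q.2 + s * q.2) ((1 - 4 * s) * q.2)
  have c3 := hUU q.1 (s * q.2 + s * q.2 + (1 - 4 * s) * q.2) (s * q.2)
  have c4 := hUU q.1 (s * q.2 + s * q.2 + (1 - 4 * s) * q.2 + s * q.2) (s * q.2)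
  rw [c1, show q.1 + 2 * s * q.2 = q.1 + (s * q.2 + s * q.2) by ring, c2,
    show q.1 + (1 - 2 * s) * q.2 = q.1 + (s * q.2 + s * q.2 + (1 - 4 * s) * q.2) by ring, c3,
    show q.1 + (1 - s) * q.2 = q.1 + (s * q.2 + s * q.2 + (1 - 4 * s) * q.2 + s * q.2) by ring, c4]
  congr 2
  ring

/-- The error of a time-symmetric formula has odd order. -/
lemma exists_symm_error {n : ℕ} (hn : Even (n + 1)) {S U R : ℝ × ℝ → 𝔸}
    (hS : ∀ t h, S (t, h) * S (t + h, -h) = 1) (hU : ContDiff ℝ ∞ U) (hU0 : ∀ t, U (t, 0) = 1)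
    (hUU : ∀ t h h', U (t + h, h') * U (t, h) = U (t, h + h'))
    (hR : ContDiff ℝ ∞ R) (hSU : ∀ q, S q = U q + q.2 ^ (n + 1) • R q) :
    ∃ Q, ContDiff ℝ ∞ Q ∧ ∀ q : ℝ × ℝ, S q = U q + q.2 ^ (n + 2) • Q q := by
  obtain ⟨Q, hQ, eQ⟩ := exists_eq_smul_of_contDiff hR
  refine ⟨Q, hQ, fun q => ?_⟩
  have hR0 : ∀ t, R (t, 0) = 0 := by
    intro t
    -- Expanding `S (t, h) S (t + h, -h) = 1` around `U` gives `h ^ (n + 1) f h = 0`, because `(-h)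
    -- ^ (n + 1) = h ^ (n + 1)`. So `f` vanishes off zero, and by continuity `f 0 = 2 R (t, 0)`
    -- vanishes as well.
    set f : ℝ → 𝔸 := fun h => U (t, h) * R (t + h, -h) + R (t, h) * U (t + h, -h) +
      h ^ (n + 1) • (R (t, h) * R (t + h, -h)) with hf
    have hfc : Continuous f := by
      have h1 := hU.continuous
      have h2 := hR.continuous
      fun_prop
    have hz : ∀ h ≠ 0, f h = 0 := by
      intro h hh
      have e := hS t h
      have e2 : U (t, h) * U (t + h, -h) = 1 := by
        have := hUU (t + h) (-h) h
        rwa [add_neg_cancel_right, neg_add_cancel, hU0] at this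
      rw [hSU, hSU] at e
      simp only [hn.neg_pow, mul_add, add_mul, smul_mul_assoc, mul_smul_comm, e2] at e
      have e3 : h ^ (n + 1) • f h = 0 := by
        rw [hf]
        simp only [smul_add, smul_smul] at e ⊢
        rw [← sub_eq_zero] at e
        rw [← e]
        module
      exact (smul_eq_zero.1 e3).resolve_left (pow_ne_zero _ hh)
    have hf0 : f 0 = 0 := by
      have h1 : Filter.Tendsto f (nhdsWithin 0 {0}ᶜ) (nhds (f 0)) := hfc.continuousWithinAt
      have h2 : Filter.Tendsto f (nhdsWithin 0 {0}ᶜ) (nhds 0) :=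
        tendsto_const_nhds.congr' (by
          filter_upwards [self_mem_nhdsWithin] with h hh
          exact (hz h hh).symm)
      exact tendsto_nhds_unique h1 h2
    have h2 : (2 : ℝ) • R (t, 0) = 0 := by
      rw [← hf0, hf]
      simp only [hU0, neg_zero, add_zero, one_mul, mul_one, zero_pow (Nat.succ_ne_zero n), zero_smul]
      module
    exact (smul_eq_zero.1 h2).resolve_left two_ne_zero
  rw [hSU, eQ q, hR0, zero_add, smul_smul, ← pow_succ]

/-- First order consistency of the symmetric base formula. -/
lemma exists_base_error {X : Bool → ℝ → 𝔸} (hX : ∀ b, ContDiff ℝ ∞ (X b)) {U : ℝ × ℝ → 𝔸}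
    (hU : ContDiff ℝ ∞ U) (hU0 : ∀ t, U (t, 0) = 1)
    (hUd : ∀ t, HasDerivAt (fun h => U (t, h)) (X true t + X false t) 0) :
    ∃ Q, ContDiff ℝ ∞ Q ∧ ∀ q : ℝ × ℝ, formulaStep X (suzuki 0) q.1 q.2 = U q + q.2 ^ 2 • Q q := by
  have hD : ContDiff ℝ ∞ fun q : ℝ × ℝ => formulaStep X (suzuki 0) q.1 q.2 - U q :=
    (contDiff_formulaStep hX _).sub hU
  -- Formula and evolution agree to first order at `h = 0`, so Hadamard's lemma can divide their
  -- difference by `h` twice.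
  obtain ⟨R, hR, eR⟩ := exists_eq_smul_of_contDiff hD
  obtain ⟨Q, hQ, eQ⟩ := exists_eq_smul_of_contDiff hR
  have hstep0 : ∀ t, formulaStep X (suzuki 0) t 0 = 1 := by
    intro t
    simp [formulaStep, suzuki]
  have hR0 : ∀ t, R (t, 0) = 0 := by
    intro t
    have hexp : ∀ (b : Bool) (α β : ℝ),
        HasDerivAt (fun h : ℝ => exp ((α * h) • X b (t + β * h))) (α • X b t) 0 := by
      intro b α β
      have h1 : HasDerivAt (fun h : ℝ => (α * h) • X b (t + β * h)) (α • X b t) 0 := by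
        have h2 : HasDerivAt (fun h : ℝ => X b (t + β * h)) (deriv (fun h : ℝ => X b (t + β * h)) 0) 0 := by
          apply DifferentiableAt.hasDerivAt
          exact (((hX b).differentiable (by simp)).comp (by fun_prop :
            Differentiable ℝ fun h : ℝ => t + β * h)) 0
        have h3 : HasDerivAt (fun h : ℝ => α * h) α 0 := by
          simpa using (hasDerivAt_id (0 : ℝ)).const_mul α
        convert! h3.smul h2 using 1
        simp
      have h5 : HasFDerivAt (exp : 𝔸 → 𝔸) (1 : 𝔸 →L[ℝ] 𝔸) ((fun h : ℝ => (α * h) • X b (t + β * h)) 0) := by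
        simpa using hasFDerivAt_exp_zero (𝕂 := ℝ) (𝔸 := 𝔸)
      exact h5.comp_hasDerivAt (0 : ℝ) h1
    have hS : HasDerivAt (fun h => formulaStep X (suzuki 0) t h) (X true t + X false t) 0 := by
      have h1 := (hexp true (1 / 2) (1 / 2)).mul
        ((hexp false 1 (1 / 2)).mul (hexp true (1 / 2) (1 / 2)))
      simp only [mul_zero, zero_smul, exp_zero, mul_one, one_mul, one_smul] at h1
      have e : (fun h => formulaStep X (suzuki 0) t h) = fun h : ℝ =>
          exp ((1 / 2 * h) • X true (t + 1 / 2 * h)) * (exp ((1 * h) • X false (t + 1 / 2 * h)) *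
            exp ((1 / 2 * h) • X true (t + 1 / 2 * h))) := by
        funext h
        simp [formulaStep, suzuki]
      rw [e]
      refine (h1.congr_deriv ?_).congr_of_eventuallyEq (Filter.Eventually.of_forall fun h => ?_)
      · simp only [Pi.mul_apply, zero_smul, mul_zero, exp_zero, mul_one]
        module
      · simp only [Pi.mul_apply, one_mul]
    have h1 : HasDerivAt (fun h : ℝ => h • R (t, h)) 0 0 := by
      have := hS.sub (hUd t)
      rw [sub_self] at this
      refine this.congr_of_eventuallyEq (Filter.Eventually.of_forall fun h => ?_)
      have := eR (t, h)
      simp only [hstep0, hU0, sub_self, zero_add] at this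
      exact this.symm
    have h2 : HasDerivAt (fun h : ℝ => h • R (t, h)) (R (t, 0)) 0 := by
      have h3 : HasDerivAt (fun h : ℝ => R (t, h)) (deriv (fun h : ℝ => R (t, h)) 0) 0 := by
        apply DifferentiableAt.hasDerivAt
        exact ((hR.differentiable (by simp)).comp (by fun_prop :
            Differentiable ℝ fun h : ℝ => (t, h))) 0
      convert! (hasDerivAt_id (0 : ℝ)).smul h3 using 1
      simp
    exact h2.unique h1
  refine ⟨Q, hQ, fun q => ?_⟩
  have e1 := eR q
  simp only [hstep0, hU0, sub_self, zero_add] at e1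
  rw [sub_eq_iff_eq_add'] at e1
  rw [e1, eQ q, hR0, zero_add, smul_smul, sq]

/-- Each level gains two orders: the composition removes the error term of degree `2 k + 3`, and
since the new formula is again symmetric, its leading error cannot have the even degree `2 k + 4`.
-/
theorem exists_suzuki_error {X : Bool → ℝ → 𝔸} (hX : ∀ b, ContDiff ℝ ∞ (X b)) {U : ℝ × ℝ → 𝔸}
    (hU : ContDiff ℝ ∞ U) (hU0 : ∀ t, U (t, 0) = 1)
    (hUU : ∀ t h h', U (t + h, h') * U (t, h) = U (t, h + h'))
    (hUd : ∀ t, HasDerivAt (fun h => U (t, h)) (X true t + X false t) 0) (k : ℕ) :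
    ∃ Q, ContDiff ℝ ∞ Q ∧
      ∀ q : ℝ × ℝ, formulaStep X (suzuki k) q.1 q.2 = U q + q.2 ^ (2 * k + 3) • Q q := by
  have hsymm := formulaStep_suzuki_symm X
  induction k with
  | zero =>
    obtain ⟨Q, hQ, eQ⟩ := exists_base_error hX hU hU0 hUd
    exact exists_symm_error (n := 1) (by decide) (S := fun q => formulaStep X (suzuki 0) q.1 q.2)
      (hsymm 0) hU hU0 hUU hQ eQ
  | succ k ih =>
    obtain ⟨Q, hQ, eQ⟩ := ih
    have hodd : Odd (2 * k + 3) := ⟨k + 1, by ring⟩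
    obtain ⟨R, hR, eR⟩ := exists_fiveFold_error (n := 2 * k + 2)
      (suzukiCoef_eq (2 * k + 3) hodd (by omega)) hU hU0 hUU hQ
      (S := fun q => formulaStep X (suzuki k) q.1 q.2) eQ
    refine exists_symm_error (n := 2 * k + 3) ⟨k + 2, by ring⟩
      (S := fun q => formulaStep X (suzuki (k + 1)) q.1 q.2)
      (hsymm (k + 1)) hU hU0 hUU hR fun q => ?_
    rw [← eR q]
    simp only [suzuki, formulaStep_fiveFold]

/-- **Suzuki's product formula for smooth time-dependent generators** has order `2 k + 2`. -/
theorem exists_suzuki_error_fundamental {X : Bool → ℝ → 𝔸} (hX : ∀ b, ContDiff ℝ ∞ (X b))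
    {V W : ℝ → 𝔸} (hV : ∀ t, HasDerivAt V ((X true t + X false t) * V t) t)
    (hW : ∀ t, HasDerivAt W (-(W t * (X true t + X false t))) t)
    (hVW : ∀ t, V t * W t = 1) (hWV : ∀ t, W t * V t = 1) (k : ℕ) :
    ∃ C : ℝ, ∀ h ∈ Icc (0 : ℝ) 1,
      ‖formulaStep X (suzuki k) 0 h - V h * W 0‖ ≤ C * h ^ (2 * k + 3) := by
  have hG : ContDiff ℝ ∞ fun t => X true t + X false t := (hX true).add (hX false)
  -- Bootstrapping: the equation gives a solution one more derivative than it was known to have.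
  have hsm : ∀ {Z F : ℝ → 𝔸}, (∀ t, HasDerivAt Z (F t) t) →
      (∀ n : ℕ, ContDiff ℝ n Z → ContDiff ℝ n F) → ContDiff ℝ ∞ Z := by
    intro Z F hZ hF
    refine contDiff_infty.2 fun n => ?_
    induction n with
    | zero =>
      rw [Nat.cast_zero, contDiff_zero]
      exact continuous_iff_continuousAt.2 fun t => (hZ t).continuousAt
    | succ n ih =>
      rw [Nat.cast_succ, contDiff_succ_iff_deriv]
      refine ⟨fun t => (hZ t).differentiableAt, by simp, ?_⟩
      rw [show deriv Z = F from funext fun t => (hZ t).deriv]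
      exact hF n ih
  have hVs : ContDiff ℝ ∞ V := hsm hV fun n hn => (hG.of_le (by exact_mod_cast le_top)).mul hn
  have hWs : ContDiff ℝ ∞ W :=
    hsm hW fun n hn => (hn.mul (hG.of_le (by exact_mod_cast le_top))).neg
  obtain ⟨Q, hQ, eQ⟩ := exists_suzuki_error (U := fun q => V (q.1 + q.2) * W q.1) hX
    ((hVs.comp (by fun_prop)).mul (hWs.comp (by fun_prop))) (fun t => by simp [hVW])
    (fun t h h' => by
      show V (t + h + h') * W (t + h) * (V (t + h) * W t) = _
      rw [mul_assoc, ← mul_assoc (W (t + h)), hWV, one_mul, add_assoc])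
    (fun t => by
      have h1 : HasDerivAt (fun h => V (t + h)) ((X true t + X false t) * V t) 0 := by
        have h2 : HasDerivAt V ((X true t + X false t) * V t) (t + 0) := by
          rw [add_zero]
          exact hV t
        exact h2.comp_const_add t 0
      have h3 := h1.mul_const (W t)
      rwa [mul_assoc, hVW, mul_one] at h3) k
  obtain ⟨C, hC⟩ := (isCompact_Icc (a := (0 : ℝ)) (b := 1)).exists_bound_of_continuousOn
    (f := fun h => Q (0, h)) (hQ.continuous.comp (by fun_prop)).continuousOn
  refine ⟨C, fun h hh => ?_⟩
  have e := eQ (0, h)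
  simp only [zero_add] at e
  rw [e, add_sub_cancel_left, norm_smul, norm_pow, Real.norm_of_nonneg hh.1, mul_comm]
  exact mul_le_mul_of_nonneg_right (hC h hh) (pow_nonneg hh.1 _)

end Order

end

noncomputable section

open Set MeasureTheory NormedSpace
open scoped Interval ContDiff ENNReal

/-! ### Uniformity of the error constant -/

/-- The coefficients of a pair of matrix-valued power series, of norm at most one. -/
structure CoeffFamily where
  N : ℕ
  ne : NeZero N
  g : Bool → ℕ → Matrix (Fin N) (Fin N) ℂ
  bound : ∀ b i, ‖g b i‖ ≤ 1

namespace CoeffFamily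

instance (i : CoeffFamily) : NeZero i.N := i.ne

/-- Bounded families of matrices over all coefficient families. -/
abbrev Total := lp (fun i : CoeffFamily => Matrix (Fin i.N) (Fin i.N) ℂ) ∞

/-- Evaluation of a bounded family of matrices. -/
def eval (i : CoeffFamily) : Total →+* Matrix (Fin i.N) (Fin i.N) ℂ where
  toFun f := f i
  map_one' := by rw [lp.infty_coeFn_one]; rfl
  map_mul' f g := by rw [lp.infty_coeFn_mul]; rfl
  map_zero' := rfl
  map_add' _ _ := rfl

lemma norm_eval_le (i : CoeffFamily) (f : Total) : ‖i.eval f‖ ≤ ‖f‖ :=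
  lp.norm_apply_le_norm ENNReal.top_ne_zero f i

lemma eval_smul (i : CoeffFamily) (r : ℝ) (f : Total) : i.eval (r • f) = r • i.eval f := rfl

lemma continuous_eval (i : CoeffFamily) : Continuous i.eval :=
  (lp.evalCLM ℝ (fun i : CoeffFamily => Matrix (Fin i.N) (Fin i.N) ℂ) ∞ i).continuous

lemma hasDerivAt_eval (i : CoeffFamily) {f : ℝ → Total} {f' : Total} {t : ℝ}
    (hf : HasDerivAt f f' t) : HasDerivAt (fun t => i.eval (f t)) (i.eval f') t :=
  (lp.evalCLM ℝ (fun i : CoeffFamily => Matrix (Fin i.N) (Fin i.N) ℂ) ∞ i).hasFDerivAt.comp_hasDerivAt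
    t hf

lemma eval_exp (i : CoeffFamily) (f : Total) : i.eval (exp f) = exp (i.eval f) := by
  let _ : NormedAlgebra ℚ Total := NormedAlgebra.restrictScalars ℚ ℝ Total
  exact map_exp i.eval i.continuous_eval f

/-- The coefficients as bounded families. -/
def totalCoeff (b : Bool) (k : ℕ) : Total :=
  ⟨fun i => i.g b k, memℓp_infty ⟨1, by rintro _ ⟨i, rfl⟩; exact i.bound b k⟩⟩

/-- The generators of a coefficient family, truncated at degree `p`. -/
def generator (i : CoeffFamily) (p : ℕ) (b : Bool) (t : ℝ) : Matrix (Fin i.N) (Fin i.N) ℂ :=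
  ∑ k ∈ Finset.range p, t ^ k • i.g b k

/-- The generators as bounded families. -/
def totalGenerator (p : ℕ) (b : Bool) (t : ℝ) : Total :=
  ∑ k ∈ Finset.range p, t ^ k • totalCoeff b k

lemma eval_totalGenerator (i : CoeffFamily) (p : ℕ) (b : Bool) (t : ℝ) :
    i.eval (totalGenerator p b t) = i.generator p b t := by
  simp only [totalGenerator, generator, map_sum, eval_smul]
  rfl

lemma eval_formulaStep (i : CoeffFamily) (p : ℕ) (l : List Stage) (t h : ℝ) :
    i.eval (formulaStep (totalGenerator p) l t h) = formulaStep (i.generator p) l t h := by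
  simp only [formulaStep, map_list_prod, List.map_map]
  congr 1
  refine List.map_congr_left fun a _ => ?_
  simp only [Function.comp, eval_exp, eval_smul, eval_totalGenerator]

/-- The bounded families of matrices over all coefficient families form a single Banach algebra, in
which the truncated generators are smooth. The constant found there is inherited by every component,
because evaluation is a contractive ring homomorphism that commutes with exponentials and
derivatives. -/
theorem exists_uniform_error (p k : ℕ) : ∃ C B : ℝ, 0 ≤ C ∧ 0 ≤ B ∧ ∀ i : CoeffFamily,
    ∃ V : ℝ → Matrix (Fin i.N) (Fin i.N) ℂ, V 0 = 1 ∧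
      (∀ t, HasDerivAt V ((i.generator p true t + i.generator p false t) * V t) t) ∧
      (∀ t ∈ Icc (0 : ℝ) 1, ‖V t‖ ≤ B) ∧
      ∀ h ∈ Icc (0 : ℝ) 1,
        ‖formulaStep (i.generator p) (suzuki k) 0 h - V h‖ ≤ C * h ^ (2 * k + 3) := by
  have hX : ∀ b, ContDiff ℝ ∞ (totalGenerator p b) := fun b => by
    unfold totalGenerator
    fun_prop
  obtain ⟨V, W, hV0, hV, hW, hVW, hWV⟩ := exists_fundamental_solution
    (G := fun t => totalGenerator p true t + totalGenerator p false t)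
    ((hX true).continuous.add (hX false).continuous)
  obtain ⟨C, hC⟩ := exists_suzuki_error_fundamental hX hV hW hVW hWV k
  obtain ⟨B, hB⟩ := (isCompact_Icc (a := (0 : ℝ)) (b := 1)).exists_bound_of_continuousOn
    (f := V) (continuous_iff_continuousAt.2 fun t => (hV t).continuousAt).continuousOn
  have hW0 : W 0 = 1 := by
    have := hVW 0
    rwa [hV0, one_mul] at this
  refine ⟨max C 0, max B 0, le_max_right _ _, le_max_right _ _,
    fun i => ⟨fun t => i.eval (V t), by simp only [hV0, map_one], fun t => ?_, fun t ht => ?_,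
      fun h hh => ?_⟩⟩
  · have := i.hasDerivAt_eval (hV t)
    rwa [map_mul, map_add, eval_totalGenerator, eval_totalGenerator] at this
  · exact ((i.norm_eval_le _).trans (hB t ht)).trans (le_max_left _ _)
  · have := hC h hh
    rw [hW0, mul_one] at this
    rw [← eval_formulaStep, ← map_sub]
    refine ((i.norm_eval_le _).trans this).trans ?_
    exact mul_le_mul_of_nonneg_right (le_max_left _ _) (pow_nonneg hh.1 _)

end CoeffFamily

/-! ### The error of one step for matrices of finite smoothness -/

/-- Measuring time in units of `1 / μ` turns generators with derivatives of size `μ ^ (k + 1)` into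
generators with derivatives of size one, and the step `h` into `μ h`. -/
lemma formulaStep_congr {𝔸 : Type*} [NormedRing 𝔸] [NormedAlgebra ℝ 𝔸] [CompleteSpace 𝔸]
    (X : Bool → ℝ → 𝔸) (l : List Stage) (t h μ : ℝ) (hμ : μ ≠ 0) :
    formulaStep X l t h = formulaStep (fun b x => μ⁻¹ • X b (t + x / μ)) l 0 (μ * h) := by
  simp only [formulaStep]
  congr 1
  refine List.map_congr_left fun a _ => ?_
  rw [smul_smul, zero_add]
  congr 2
  · field_simp
  · congr 1
    field_simp

/-- Perturbation of the generators in a product formula. -/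
lemma norm_formulaStep_sub_le {𝔸 : Type*} [NormedRing 𝔸] [NormedAlgebra ℝ 𝔸] [CompleteSpace 𝔸]
    [NormOneClass 𝔸] {X X' : Bool → ℝ → 𝔸} {l : List Stage} {η c δ : ℝ}
    (hl : ∀ a ∈ l, |a.α| ≤ 1 ∧ a.β ∈ Icc (0 : ℝ) 1) (hη : η ∈ Icc (0 : ℝ) 1) (hc : 0 ≤ c)
    (hX : ∀ b, ∀ t ∈ Icc 0 η, ‖X b t‖ ≤ c) (hX' : ∀ b, ∀ t ∈ Icc 0 η, ‖X' b t‖ ≤ c)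
    (hXX : ∀ b, ∀ t ∈ Icc 0 η, ‖X b t - X' b t‖ ≤ δ) :
    ‖formulaStep X l 0 η - formulaStep X' l 0 η‖ ≤
      l.length * Real.exp c ^ l.length * (Real.exp c * (η * δ)) := by
  have hβ : ∀ a ∈ l, 0 + a.β * η ∈ Icc 0 η := fun a ha => by
    obtain ⟨-, h1, h2⟩ := hl a ha
    rw [zero_add]
    exact ⟨mul_nonneg h1 hη.1, mul_le_of_le_one_left hη.1 h2⟩
  have hα : ∀ a ∈ l, ∀ y : 𝔸, ‖(a.α * η) • y‖ ≤ η * ‖y‖ := fun a ha y => by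
    rw [norm_smul, Real.norm_eq_abs, abs_mul, abs_of_nonneg hη.1]
    gcongr
    exact mul_le_of_le_one_left hη.1 (hl a ha).1
  have hα1 : ∀ a ∈ l, ∀ y : 𝔸, ‖y‖ ≤ c → ‖(a.α * η) • y‖ ≤ c := fun a ha y hy => by
    refine (hα a ha y).trans ?_
    calc η * ‖y‖ ≤ 1 * c := mul_le_mul hη.2 hy (norm_nonneg _) zero_le_one
      _ = c := one_mul c
  refine (norm_list_prod_sub_le l _ _ (B := Real.exp c) (δ := Real.exp c * (η * δ))
    (Real.one_le_exp hc) ?_ ?_ ?_).2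
  · exact fun a ha => (norm_exp_le_exp_norm _).trans
      (Real.exp_le_exp.2 (hα1 a ha _ (hX _ _ (hβ a ha))))
  · exact fun a ha => (norm_exp_le_exp_norm _).trans
      (Real.exp_le_exp.2 (hα1 a ha _ (hX' _ _ (hβ a ha))))
  · intro a ha
    refine (norm_exp_sub_exp_le (hα1 a ha _ (hX _ _ (hβ a ha)))
      (hα1 a ha _ (hX' _ _ (hβ a ha)))).trans ?_
    rw [← smul_sub]
    gcongr
    refine (hα a ha _).trans ?_
    exact mul_le_mul_of_nonneg_left (hXX _ _ (hβ a ha)) hη.1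

/-- The length `x` of the interval is kept as a factor; in the local error it supplies the last
power of the step size. -/
lemma gronwallBound_zero_le {K ε x : ℝ} (hK : 0 < K) (hε : 0 ≤ ε) (hx : x ∈ Icc (0 : ℝ) 1) :
    gronwallBound 0 K ε x ≤ Real.exp K * (x * ε) := by
  rw [gronwallBound_of_K_ne_0 hK.ne']
  simp only [zero_mul, zero_add]
  have h1 : Real.exp (K * x) - 1 ≤ K * x * Real.exp (K * x) := by
    have := Real.add_one_le_exp (-(K * x))
    have h2 : Real.exp (-(K * x)) * Real.exp (K * x) = 1 := by
      rw [← Real.exp_add, neg_add_cancel, Real.exp_zero]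
    nlinarith [Real.exp_pos (K * x)]
  have h3 : Real.exp (K * x) ≤ Real.exp K :=
    Real.exp_le_exp.2 (mul_le_of_le_one_right hK.le hx.2)
  calc ε / K * (Real.exp (K * x) - 1) ≤ ε / K * (K * x * Real.exp (K * x)) := by gcongr
    _ = x * ε * Real.exp (K * x) := by field_simp
    _ ≤ x * ε * Real.exp K := by
        have := mul_nonneg hx.1 hε
        gcongr
    _ = _ := by ring

/-- Local error of Suzuki's formula for generators that are close to polynomials. -/
theorem exists_scaled_step_error (p : ℕ) : ∃ C : ℝ, 0 ≤ C ∧ ∀ i : CoeffFamily,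
    ∀ (X : Bool → ℝ → Matrix (Fin i.N) (Fin i.N) ℂ) (η : ℝ), η ∈ Icc (0 : ℝ) 1 →
    (∀ b, ∀ t ∈ Icc 0 η, ‖X b t - i.generator p b t‖ ≤ η ^ p) →
    ∀ Y : ℝ → Matrix (Fin i.N) (Fin i.N) ℂ, Y 0 = 1 →
    (∀ t ∈ Icc 0 η, HasDerivWithinAt Y ((X true t + X false t) * Y t) (Icc 0 η) t) →
    ‖formulaStep X (suzuki p) 0 η - Y η‖ ≤ C * η ^ (p + 1) := by
  -- One `p` serves both as truncation degree and as level of the formula, whose order `2 p + 2` is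
  -- more than needed.
  obtain ⟨C, B, hC0, hB0, hCB⟩ := CoeffFamily.exists_uniform_error p p
  -- The norms of `p` coefficients, plus a perturbation of size `η ^ p ≤ 1`.
  set c : ℝ := p + 1 with hc
  set n := (suzuki p).length with hn
  refine ⟨n * Real.exp c ^ n * Real.exp c + C + Real.exp (2 * c) * (2 * B), by positivity, ?_⟩
  intro i X η hη hX Y hY0 hY
  obtain ⟨V, hV0, hV, hVB, hVC⟩ := hCB i
  have hη1 : η ^ p ≤ 1 := pow_le_one₀ hη.1 hη.2
  have hηp : 0 ≤ η ^ p := pow_nonneg hη.1 _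
  have hG : ∀ b, ∀ t ∈ Icc 0 η, ‖i.generator p b t‖ ≤ p := by
    intro b t ht
    calc ‖i.generator p b t‖ ≤ ∑ k ∈ Finset.range p, ‖t ^ k • i.g b k‖ := norm_sum_le _ _
      _ ≤ ∑ k ∈ Finset.range p, (1 : ℝ) := by
          refine Finset.sum_le_sum fun k _ => ?_
          rw [norm_smul, norm_pow, Real.norm_of_nonneg ht.1]
          exact mul_le_one₀ (pow_le_one₀ ht.1 (ht.2.trans hη.2)) (norm_nonneg _) (i.bound b k)
      _ = p := by simp
  have hXc : ∀ b, ∀ t ∈ Icc 0 η, ‖X b t‖ ≤ c := by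
    intro b t ht
    have := norm_add_le (X b t - i.generator p b t) (i.generator p b t)
    rw [sub_add_cancel] at this
    linarith [hX b t ht, hG b t ht]
  have e1 := norm_formulaStep_sub_le (suzuki_bounds p) hη (by positivity) hXc
    (fun b t ht => (hG b t ht).trans (by rw [hc]; linarith)) hX
  have e2 := hVC η hη
  -- Grönwall's inequality, with `2 η ^ p B` as the defect of the polynomial solution in the true
  -- equation.
  have e3 : ‖V η - Y η‖ ≤ Real.exp (2 * c) * (η * (2 * η ^ p * B)) := by
    have h1 : dist (Y η) (V η) ≤ gronwallBound 0 (⟨2 * c, by positivity⟩ : NNReal)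
        (0 + 2 * η ^ p * B) (η - 0) := by
      refine dist_le_of_approx_trajectories_ODE_of_mem (v := fun t y => (X true t + X false t) * y)
        (s := fun _ => univ) (a := 0) (b := η) (f' := fun t => (X true t + X false t) * Y t)
        (g' := fun t => (i.generator p true t + i.generator p false t) * V t) ?_
        (fun t ht => (hY t ht).continuousWithinAt) ?_ (by simp) (by simp)
        (fun t _ => (hV t).continuousAt.continuousWithinAt) ?_ ?_ (by simp) (by simp [hY0, hV0]) η
        ⟨hη.1, le_rfl⟩
      · intro t ht
        refine LipschitzOnWith.of_dist_le_mul fun x _ y _ => ?_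
        rw [dist_eq_norm, dist_eq_norm, ← mul_sub]
        refine (norm_mul_le _ _).trans ?_
        refine mul_le_mul_of_nonneg_right ?_ (norm_nonneg _)
        have := norm_add_le (X true t) (X false t)
        have h1 := hXc true t (Ico_subset_Icc_self ht)
        have h2 := hXc false t (Ico_subset_Icc_self ht)
        show ‖X true t + X false t‖ ≤ 2 * c
        linarith
      · intro t ht
        exact (hY t (Ico_subset_Icc_self ht)).mono_of_mem_nhdsWithin
          (Icc_mem_nhdsGE_of_mem ht)
      · exact fun t _ => (hV t).hasDerivWithinAt
      · intro t ht
        have ht' := Ico_subset_Icc_self ht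
        rw [dist_eq_norm, ← sub_mul]
        refine (norm_mul_le _ _).trans ?_
        have h1 : ‖i.generator p true t + i.generator p false t - (X true t + X false t)‖ ≤
            2 * η ^ p := by
          have e : i.generator p true t + i.generator p false t - (X true t + X false t) =
            -((X true t - i.generator p true t) + (X false t - i.generator p false t)) := by abel
          rw [e, norm_neg]
          have := norm_add_le (X true t - i.generator p true t) (X false t - i.generator p false t)
          linarith [hX true t ht', hX false t ht']
        exact mul_le_mul h1 (hVB t ⟨ht.1, ht.2.le.trans hη.2⟩) (norm_nonneg _) (by positivity)
    rw [dist_comm, dist_eq_norm, zero_add, sub_zero] at h1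
    exact h1.trans (gronwallBound_zero_le (by positivity) (by positivity) hη)
  have e4 : C * η ^ (2 * p + 3) ≤ C * η ^ (p + 1) := by
    gcongr C * ?_
    exact pow_le_pow_of_le_one hη.1 hη.2 (by omega)
  calc ‖formulaStep X (suzuki p) 0 η - Y η‖
      = ‖(formulaStep X (suzuki p) 0 η - formulaStep (i.generator p) (suzuki p) 0 η) +
          (formulaStep (i.generator p) (suzuki p) 0 η - V η) + (V η - Y η)‖ := by
        congr 1; abel
    _ ≤ _ := norm_add₃_le
    _ ≤ n * Real.exp c ^ n * (Real.exp c * (η * η ^ p)) + C * η ^ (p + 1) +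
          Real.exp (2 * c) * (η * (2 * η ^ p * B)) := by linarith
    _ = _ := by rw [pow_succ]; ring

/-- Local error of Suzuki's formula for generators of class `C^p`. -/
theorem exists_step_error (p : ℕ) (hp : 1 ≤ p) : ∃ C : ℝ, 0 ≤ C ∧ ∀ (N : ℕ) [NeZero N] (T μ : ℝ)
    (X : Bool → ℝ → Matrix (Fin N) (Fin N) ℂ), 0 < T → 0 < μ →
    (∀ b, ContDiffOn ℝ p (X b) (Icc 0 T)) →
    (∀ b, ∀ k ≤ p, ∀ t ∈ Icc 0 T, ‖iteratedDerivWithin k (X b) (Icc 0 T) t‖ ≤ μ ^ (k + 1)) →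
    ∀ (t h : ℝ), 0 ≤ t → 0 ≤ h → t + h ≤ T → μ * h ≤ 1 →
    ∀ Y : ℝ → Matrix (Fin N) (Fin N) ℂ, Y t = 1 →
    (∀ x ∈ Icc t (t + h), HasDerivWithinAt Y ((X true x + X false x) * Y x) (Icc t (t + h)) x) →
    ‖formulaStep X (suzuki p) t h - Y (t + h)‖ ≤ C * (μ * h) ^ (p + 1) := by
  obtain ⟨C, hC0, hC⟩ := exists_scaled_step_error p
  refine ⟨C, hC0, fun N _ T μ X hT hμ hXs hXb t h ht hh hth hμh Y hY0 hY => ?_⟩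
  have hη : μ * h ∈ Icc (0 : ℝ) 1 := ⟨by positivity, hμh⟩
  rcases hh.eq_or_lt with rfl | hh'
  · have : formulaStep X (suzuki p) t 0 = 1 := by
      have hl : ∀ l, formulaStep X l t 0 = 1 := by
        intro l
        induction l with
        | nil => rfl
        | cons a l ih =>
          simp only [formulaStep, List.map_cons, List.prod_cons] at ih ⊢
          rw [ih]
          simp
      exact hl _
    rw [this, add_zero, hY0]
    simp
  -- The Taylor coefficients at `t` in rescaled time; the derivative bounds make their norms at most
  -- one.
  set g : Bool → ℕ → Matrix (Fin N) (Fin N) ℂ := fun b k => if k ≤ p then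
    (μ ^ (k + 1) * k.factorial)⁻¹ • iteratedDerivWithin k (X b) (Icc 0 T) t else 0 with hg
  have htT : t ∈ Icc 0 T := ⟨ht, by linarith⟩
  let i : CoeffFamily := ⟨N, inferInstance, g, fun b k => by
    rw [hg]
    simp only
    split_ifs with hk
    · rw [norm_smul, norm_inv, Real.norm_of_nonneg (by positivity)]
      rw [inv_mul_le_iff₀ (by positivity), mul_one]
      refine (hXb b k hk t htT).trans (le_mul_of_one_le_right (by positivity) ?_)
      exact_mod_cast Nat.one_le_iff_ne_zero.2 k.factorial_ne_zero
    · simp⟩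
  have hmaps : ∀ x ∈ Icc 0 (μ * h), t + x / μ ∈ Icc t (t + h) := by
    intro x hx
    constructor
    · have := div_nonneg hx.1 hμ.le
      linarith
    · have : x / μ ≤ h := by
        rw [div_le_iff₀ hμ]
        linarith [hx.2]
      linarith
  have hsub : Icc t T ⊆ Icc 0 T := Icc_subset_Icc_left ht
  have htlt : t < T := by linarith
  have key := hC i (fun b x => μ⁻¹ • X b (t + x / μ)) (μ * h) hη ?_ (fun x => Y (t + x / μ)) ?_ ?_
  · rw [formulaStep_congr X (suzuki p) t h μ hμ.ne']
    rwa [mul_div_cancel_left₀ _ hμ.ne'] at key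
  · intro b x hx
    have hx' := hmaps x hx
    have hxT : t + x / μ ∈ Icc t T := ⟨hx'.1, hx'.2.trans hth⟩
    -- The Taylor polynomial of degree `p - 1` has `p` terms and a remainder of order `p`, as the
    -- scaled estimate requires.
    obtain ⟨m, rfl⟩ : ∃ m, p = m + 1 := ⟨p - 1, by omega⟩
    -- Taylor's theorem expands at the left end point of its interval, so the derivatives within
    -- `[0, T]` are transferred to `[t, T]`.
    have hiter : ∀ k ≤ m + 1, ∀ y ∈ Icc t T, iteratedDerivWithin k (X b) (Icc t T) y =
        iteratedDerivWithin k (X b) (Icc 0 T) y := by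
      intro k hk y hy
      simp only [iteratedDerivWithin]
      rw [iteratedFDerivWithin_subset hsub (uniqueDiffOn_Icc htlt) (uniqueDiffOn_Icc hT)
        ((hXs b).of_le (by exact_mod_cast hk)) hy]
    have tay := taylor_mean_remainder_bound (f := X b) (n := m) (C := μ ^ (m + 2)) htlt.le
      (by exact_mod_cast (hXs b).mono hsub) hxT (fun y hy => by
        rw [hiter _ le_rfl y hy]
        exact hXb b _ le_rfl y (hsub hy))
    have hpoly : i.generator (m + 1) b x = μ⁻¹ • taylorWithinEval (X b) m (Icc t T) t (t + x / μ) := by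
      rw [taylor_within_apply, Finset.smul_sum]
      refine Finset.sum_congr rfl fun k hk => ?_
      have hk' : k ≤ m + 1 := (Finset.mem_range.1 hk).le
      show x ^ k • g b k = _
      rw [hg]
      simp only [if_pos hk']
      rw [hiter k hk' t ⟨le_rfl, htlt.le⟩, smul_smul, smul_smul]
      congr 1
      rw [add_sub_cancel_left, div_pow]
      field_simp
      ring
    show ‖μ⁻¹ • X b (t + x / μ) - i.generator (m + 1) b x‖ ≤ (μ * h) ^ (m + 1)
    rw [hpoly, ← smul_sub, norm_smul, norm_inv, Real.norm_of_nonneg hμ.le]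
    calc μ⁻¹ * ‖X b (t + x / μ) - taylorWithinEval (X b) m (Icc t T) t (t + x / μ)‖
        ≤ μ⁻¹ * (μ ^ (m + 2) * (t + x / μ - t) ^ (m + 1) / m.factorial) := by gcongr
      _ ≤ μ⁻¹ * (μ ^ (m + 2) * (t + x / μ - t) ^ (m + 1)) := by
          gcongr
          refine div_le_self ?_ (by exact_mod_cast Nat.one_le_iff_ne_zero.2 m.factorial_ne_zero)
          rw [add_sub_cancel_left]
          exact mul_nonneg (by positivity) (pow_nonneg (div_nonneg hx.1 hμ.le) _)
      _ = x ^ (m + 1) := by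
          rw [add_sub_cancel_left, div_pow]
          field_simp
          ring
      _ ≤ (μ * h) ^ (m + 1) := pow_le_pow_left₀ hx.1 hx.2 _
  · simpa using hY0
  · intro x hx
    have h1 := hY _ (hmaps x hx)
    have h2 : HasDerivWithinAt (fun x => t + x / μ) μ⁻¹ (Icc 0 (μ * h)) x := by
      have := ((hasDerivAt_id x).div_const μ).const_add t
      simpa using this.hasDerivWithinAt
    have h3 := h1.scomp x h2 hmaps
    convert! h3 using 1
    rw [← smul_add, smul_mul_assoc]

end

noncomputable section

open Set MeasureTheory NormedSpace
open scoped Interval ContDiff Matrix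

/-! ### Cauchy's formula on the lower half plane -/

section Contour

variable {E : Type*} [NormedAddCommGroup E] [NormedSpace ℂ E] [CompleteSpace E]

/-- The integrand is `(f z - f (-i)) / (z² + 1)`, and `|z² + 1| ≥ K² - 1 ≥ 3 K² / 4` since `K ≥ 2`.
-/
lemma norm_contour_integrand_le {f : ℂ → E} {B K : ℝ} (hK : 2 ≤ K) {z : ℂ} (hz : K ≤ ‖z‖)
    (hf : ‖f z‖ ≤ B) (hf' : ‖f (-Complex.I)‖ ≤ B) :
    ‖(z - Complex.I)⁻¹ • dslope f (-Complex.I) z‖ ≤ 8 * B / (3 * K ^ 2) := by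
  have hne : z ≠ -Complex.I := by
    rintro rfl
    simp at hz
    linarith
  have hB : 0 ≤ B := (norm_nonneg _).trans hf
  rw [dslope_of_ne _ hne, slope_def_module, smul_smul, norm_smul, ← mul_inv,
    show (z - Complex.I) * (z - -Complex.I) = z ^ 2 + 1 by
      linear_combination -Complex.I_sq, norm_inv]
  have h1 : 3 / 4 * K ^ 2 ≤ ‖z ^ 2 + 1‖ := by
    have h2 := norm_sub_le (z ^ 2 + 1) 1
    rw [add_sub_cancel_right, norm_pow, norm_one] at h2
    have h3 : K ^ 2 ≤ ‖z‖ ^ 2 := pow_le_pow_left₀ (by linarith) hz 2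
    nlinarith
  have h4 : ‖f z - f (-Complex.I)‖ ≤ 2 * B := (norm_sub_le _ _).trans (by linarith)
  have h5 : 0 < 3 / 4 * K ^ 2 := by positivity
  calc ‖z ^ 2 + 1‖⁻¹ * ‖f z - f (-Complex.I)‖ ≤ (3 / 4 * K ^ 2)⁻¹ * (2 * B) := by gcongr
    _ = _ := by field_simp; ring

/-- The value at `-i` of a function that is holomorphic in the lower half plane is the average of
its boundary values against the Cauchy distribution, up to the truncation error. -/
theorem norm_cauchy_average_sub_le {f : ℂ → E} (hf : Differentiable ℂ f) {B K : ℝ} (hK : 2 ≤ K)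
    (hB : ∀ z : ℂ, z.re ∈ Icc (-K) K → z.im ∈ Icc (-K) 0 → ‖f z‖ ≤ B) :
    ‖(∫ k in (-K)..K, (1 / (Real.pi * (1 + k ^ 2)) : ℝ) • f k) - f (-Complex.I)‖ ≤ 5 * B / K := by
  have hK0 : 0 < K := by linarith
  have hBI : ‖f (-Complex.I)‖ ≤ B := by
    refine hB _ ?_ ?_ <;> simp <;> linarith
  have hB0 : 0 ≤ B := (norm_nonneg _).trans hBI
  -- This is `(f z - f (-i)) / (z² + 1)` with the pole at `-i` removed by the divided difference, so
  -- its integral over the real segment can be moved to the other three sides of the rectangle.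
  set G : ℂ → E := fun z => (z - Complex.I)⁻¹ • dslope f (-Complex.I) z with hG
  have hGd : DifferentiableOn ℂ G {z | z.im < 1} := by
    intro z hz
    have h1 : z - Complex.I ≠ 0 := by
      intro h
      rw [sub_eq_zero] at h
      rw [h] at hz
      simp at hz
    have h2 : DifferentiableOn ℂ (dslope f (-Complex.I)) univ :=
      (Complex.differentiableOn_dslope Filter.univ_mem).2 hf.differentiableOn
    have h3 : DifferentiableAt ℂ (dslope f (-Complex.I)) z :=
      (h2 z (mem_univ z)).differentiableAt Filter.univ_mem
    have h4 : DifferentiableAt ℂ (fun z : ℂ => (z - Complex.I)⁻¹) z := by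
      fun_prop (disch := assumption)
    exact (h4.smul h3).differentiableWithinAt
  have hrect := Complex.integral_boundary_rect_eq_zero_of_differentiableOn G
    ((-K : ℝ) + (-K : ℝ) * Complex.I) ((K : ℝ) + (0 : ℝ) * Complex.I) (hGd.mono ?_)
  swap
  · intro z hz
    have h1 : z.im ∈ uIcc (-K) 0 := by
      have := (Complex.mem_reProdIm.1 hz).2
      simpa using this
    rw [uIcc_of_le (by linarith)] at h1
    show z.im < 1
    linarith [h1.2]
  simp only [Complex.add_re, Complex.add_im, Complex.mul_re, Complex.mul_im, Complex.ofReal_re,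
    Complex.ofReal_im, Complex.I_re, Complex.I_im, mul_zero, mul_one, zero_mul, add_zero,
    zero_add, sub_self, Complex.ofReal_zero] at hrect
  have b1 : ‖∫ x in (-K)..K, G (x + ((-K : ℝ) : ℂ) * Complex.I)‖ ≤
      8 * B / (3 * K ^ 2) * |K - -K| := by
    refine intervalIntegral.norm_integral_le_of_norm_le_const fun x hx => ?_
    rw [uIoc_of_le (by linarith)] at hx
    refine norm_contour_integrand_le hK ?_ (hB _ ?_ ?_) hBI
    · refine le_trans ?_ (Complex.abs_im_le_norm _)
      simp [abs_of_pos hK0]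
    · simpa using ⟨hx.1.le, hx.2⟩
    · simpa using hK0.le
  have b2 : ‖∫ y in (-K)..0, G (((K : ℝ) : ℂ) + y * Complex.I)‖ ≤
      8 * B / (3 * K ^ 2) * |0 - -K| := by
    refine intervalIntegral.norm_integral_le_of_norm_le_const fun x hx => ?_
    rw [uIoc_of_le (by linarith)] at hx
    refine norm_contour_integrand_le hK ?_ (hB _ ?_ ?_) hBI
    · refine le_trans ?_ (Complex.abs_re_le_norm _)
      simp [abs_of_pos hK0]
    · simp
      linarith
    · simpa using ⟨hx.1.le, hx.2⟩
  have b3 : ‖∫ y in (-K)..0, G (((-K : ℝ) : ℂ) + y * Complex.I)‖ ≤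
      8 * B / (3 * K ^ 2) * |0 - -K| := by
    refine intervalIntegral.norm_integral_le_of_norm_le_const fun x hx => ?_
    rw [uIoc_of_le (by linarith)] at hx
    refine norm_contour_integrand_le hK ?_ (hB _ ?_ ?_) hBI
    · refine le_trans ?_ (Complex.abs_re_le_norm _)
      simp [abs_of_pos hK0]
    · simp
      linarith
    · simpa using ⟨hx.1.le, hx.2⟩
  rw [show |K - -K| = 2 * K by rw [abs_of_pos] <;> linarith] at b1
  rw [show |0 - -K| = K by rw [abs_of_pos] <;> linarith] at b2 b3
  have hint : ‖∫ x in (-K)..K, G (x : ℂ)‖ ≤ 32 * B / (3 * K) := by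
    have e : (∫ x in (-K)..K, G (x : ℂ)) = (∫ x in (-K)..K, G (x + ((-K : ℝ) : ℂ) * Complex.I)) +
        Complex.I • (∫ y in (-K)..0, G (((K : ℝ) : ℂ) + y * Complex.I)) -
        Complex.I • ∫ y in (-K)..0, G (((-K : ℝ) : ℂ) + y * Complex.I) := by
      rw [← sub_eq_zero, ← neg_eq_zero, ← hrect]
      abel
    rw [e]
    refine (norm_sub_le _ _).trans ((add_le_add_left (norm_add_le _ _) _).trans ?_)
    rw [norm_smul, norm_smul, Complex.norm_I, one_mul, one_mul]
    calc _ ≤ 8 * B / (3 * K ^ 2) * (2 * K) + 8 * B / (3 * K ^ 2) * K + 8 * B / (3 * K ^ 2) * K := by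
          gcongr
      _ = _ := by field_simp; ring
  have hGx : ∀ x : ℝ, G x = (1 / (1 + x ^ 2) : ℝ) • (f x - f (-Complex.I)) := by
    intro x
    have hne : (x : ℂ) ≠ -Complex.I := by
      intro h
      have := congrArg Complex.im h
      simp at this
    rw [hG]
    simp only
    rw [dslope_of_ne _ hne, slope_def_module, smul_smul, ← mul_inv,
      show ((x : ℂ) - Complex.I) * (x - -Complex.I) = x ^ 2 + 1 by
        linear_combination -Complex.I_sq, ← Complex.coe_smul]
    congr 1
    push_cast
    rw [one_div, add_comm]
  have hcont : Continuous fun x : ℝ => (1 / (1 + x ^ 2) : ℝ) • f x := by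
    have h1 : Continuous fun x : ℝ => (1 / (1 + x ^ 2) : ℝ) :=
      continuous_const.div (by fun_prop) fun x => by positivity
    exact h1.smul (hf.continuous.comp Complex.continuous_ofReal)
  have hcont' : Continuous fun x : ℝ => (1 / (1 + x ^ 2) : ℝ) • f (-Complex.I) := by
    have h1 : Continuous fun x : ℝ => (1 / (1 + x ^ 2) : ℝ) :=
      continuous_const.div (by fun_prop) fun x => by positivity
    exact h1.smul continuous_const
  have e1 : (∫ x in (-K)..K, G (x : ℂ)) =
      (∫ x in (-K)..K, (1 / (1 + x ^ 2) : ℝ) • f x) - (2 * Real.arctan K) • f (-Complex.I) := by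
    simp only [hGx, smul_sub]
    rw [intervalIntegral.integral_sub (hcont.intervalIntegrable _ _)
      (hcont'.intervalIntegrable _ _), intervalIntegral.integral_smul_const,
      integral_one_div_one_add_sq, Real.arctan_neg]
    congr 2
    ring
  have e2 : (∫ k in (-K)..K, (1 / (Real.pi * (1 + k ^ 2)) : ℝ) • f k) =
      Real.pi⁻¹ • ∫ x in (-K)..K, (1 / (1 + x ^ 2) : ℝ) • f x := by
    rw [← intervalIntegral.integral_smul]
    congr 1
    funext x
    rw [smul_smul]
    congr 1
    rw [one_div, one_div, mul_inv]
  -- The Cauchy distribution has mass `2 arctan K / π` on `[-K, K]`, which misses one by `2 arctan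
  -- (1 / K) / π ≤ 2 / (π K)`.
  have hat : Real.arctan K = Real.pi / 2 - Real.arctan K⁻¹ := by
    rw [Real.arctan_inv_of_pos hK0]
    ring
  have hat1 : 0 ≤ Real.arctan K⁻¹ := Real.arctan_nonneg.2 (by positivity)
  have hat2 : Real.arctan K⁻¹ ≤ K⁻¹ := by
    have h3 := Real.lt_tan (x := Real.arctan K⁻¹)
    rcases hat1.eq_or_lt with h | h
    · rw [← h]; positivity
    · have := h3 h (Real.arctan_lt_pi_div_two _)
      rw [Real.tan_arctan] at this
      exact this.le
  have e3 : (∫ k in (-K)..K, (1 / (Real.pi * (1 + k ^ 2)) : ℝ) • f k) - f (-Complex.I) =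
      Real.pi⁻¹ • (∫ x in (-K)..K, G (x : ℂ)) -
        (Real.pi⁻¹ * (2 * Real.arctan K⁻¹)) • f (-Complex.I) := by
    rw [e2, e1, hat]
    have hp : Real.pi⁻¹ * (2 * (Real.pi / 2 - Real.arctan K⁻¹)) =
        1 - Real.pi⁻¹ * (2 * Real.arctan K⁻¹) := by
      field_simp
    rw [smul_sub, smul_smul, hp]
    module
  have hpi : Real.pi⁻¹ ≤ 1 / 3 := by
    rw [one_div]
    exact inv_anti₀ (by norm_num) Real.pi_gt_three.le
  have hpi0 : 0 ≤ Real.pi⁻¹ := inv_nonneg.2 Real.pi_pos.le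
  rw [e3]
  refine (norm_sub_le _ _).trans ?_
  rw [norm_smul, norm_smul, Real.norm_of_nonneg hpi0, Real.norm_of_nonneg (by positivity)]
  calc _ ≤ 1 / 3 * (32 * B / (3 * K)) + 1 / 3 * (2 * K⁻¹) * B := by gcongr
    _ = 38 / 9 * B / K := by field_simp; ring
    _ ≤ 5 * B / K := by gcongr; norm_num

end Contour

/-! ### The trapezoidal rule -/

section Quadrature

open LCHS

lemma gridM_eq (m : ℕ) : gridM m = ((2 ^ m - 1 : ℕ) : ℝ) := by
  rw [gridM, Nat.cast_sub Nat.one_le_two_pow]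
  push_cast
  ring

lemma one_le_gridM {m : ℕ} (hm : 0 < m) : 1 ≤ gridM m := by
  have : (2 : ℝ) ^ 1 ≤ 2 ^ m := pow_le_pow_right₀ (by norm_num) hm
  rw [gridM]
  linarith

lemma sum_endFactor_smul {E : Type*} [AddCommGroup E] [Module ℝ E] {m : ℕ} (hm : 0 < m)
    (g : ℕ → E) : ∑ j ∈ Finset.range (2 ^ m), endFactor m j • g j =
      ∑ j ∈ Finset.range (2 ^ m - 1), (g j + g (j + 1)) := by
  obtain ⟨n, hn⟩ : ∃ n, 2 ^ m = n + 2 := by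
    have : 2 ^ 1 ≤ 2 ^ m := Nat.pow_le_pow_right (by norm_num) hm
    exact ⟨2 ^ m - 2, by omega⟩
  -- The weight counts the cell to the right, absent at the last node, and the cell to the left,
  -- absent at the first; these nodes differ because there are at least two.
  have h1 : ∀ j ∈ Finset.range (2 ^ m), endFactor m j • g j =
      (g j - if j = n + 1 then g j else 0) + (g j - if j = 0 then g j else 0) := by
    intro j _
    unfold endFactor
    rw [hn]
    by_cases h0 : j = 0
    · subst h0
      simp
    · by_cases h2 : j = n + 1
      · subst h2
        simp
      · rw [if_neg (by omega), if_neg h2, if_neg h0, sub_zero, two_smul]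
  rw [Finset.sum_congr rfl h1, hn, Finset.sum_add_distrib, Finset.sum_sub_distrib,
    Finset.sum_sub_distrib, Finset.sum_ite_eq', Finset.sum_ite_eq']
  simp only [Finset.mem_range, Nat.lt_succ_self, if_true, Nat.zero_lt_succ]
  have e := Finset.sum_range_succ g (n + 1)
  have e' := Finset.sum_range_succ' g (n + 1)
  rw [show n + 2 - 1 = n + 1 from rfl, Finset.sum_add_distrib, e]
  rw [e] at e'
  have e'' : ∑ k ∈ Finset.range (n + 1), g (k + 1) =
      ∑ k ∈ Finset.range (n + 1), g k + g (n + 1) - g 0 := by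
    rw [e', add_sub_cancel_right]
  rw [e'']
  abel

/-- A first-order estimate from a Lipschitz bound on each cell. A better rate would gain only
constants, since the number of cells enters the costs through its logarithm. -/
theorem norm_trapezoid_sub_le {E : Type*} [NormedAddCommGroup E] [NormedSpace ℝ E]
    [CompleteSpace E] {f : ℝ → E} {a b Λ : ℝ} (hab : a ≤ b)
    (hf : ∀ x ∈ Icc a b, ∀ y ∈ Icc a b, ‖f x - f y‖ ≤ Λ * |x - y|) {m : ℕ} (hm : 0 < m) :
    ‖(∑ j ∈ Finset.range (2 ^ m), (endFactor m j * ((b - a) / (2 * gridM m))) •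
        f (a + j * ((b - a) / gridM m))) - ∫ x in a..b, f x‖ ≤
      (b - a) * (Λ * ((b - a) / gridM m)) := by
  set M : ℕ := 2 ^ m - 1 with hM
  have hM1 : (1 : ℝ) ≤ gridM m := one_le_gridM hm
  have hMM : gridM m = M := gridM_eq m
  set h : ℝ := (b - a) / gridM m with hh
  have hh0 : 0 ≤ h := div_nonneg (by linarith) (by linarith)
  have hMh : M * h = b - a := by
    rw [← hMM, hh]
    field_simp
  -- `Λ` is not assumed nonnegative: on a nontrivial interval the hypothesis forces it, and
  -- otherwise `h = 0`.
  have hΛ : 0 ≤ Λ * h := by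
    rcases hab.eq_or_lt with h1 | h1
    · have : h = 0 := by rw [hh, h1, sub_self, zero_div]
      rw [this, mul_zero]
    · have := (norm_nonneg _).trans (hf b (right_mem_Icc.2 hab) a (left_mem_Icc.2 hab))
      rw [abs_of_pos (by linarith)] at this
      exact mul_nonneg (nonneg_of_mul_nonneg_left this (by linarith)) hh0
  set x : ℕ → ℝ := fun j => a + j * h with hx
  have hxmem : ∀ j ≤ M, x j ∈ Icc a b := by
    intro j hj
    have h1 : (j : ℝ) * h ≤ M * h := by gcongr
    have h2 : 0 ≤ (j : ℝ) * h := by positivity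
    constructor <;> simp only [hx] <;> linarith
  have hcont : ContinuousOn f (Icc a b) := by
    rw [Metric.continuousOn_iff]
    intro x hx ε hε
    refine ⟨ε / (|Λ| + 1), by positivity, fun y hy hyx => ?_⟩
    rw [dist_eq_norm]
    rw [Real.dist_eq] at hyx
    calc ‖f y - f x‖ ≤ Λ * |y - x| := hf y hy x hx
      _ ≤ (|Λ| + 1) * |y - x| := by gcongr; linarith [le_abs_self Λ]
      _ < (|Λ| + 1) * (ε / (|Λ| + 1)) := by gcongr
      _ = ε := by field_simp
  have hstep : ∀ j, x (j + 1) - x j = h := by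
    intro j
    simp only [hx]
    push_cast
    ring
  have hsub : ∀ j < M, Icc (x j) (x (j + 1)) ⊆ Icc a b := fun j hj =>
    Icc_subset_Icc (hxmem j hj.le).1 (hxmem (j + 1) hj).2
  have hle : ∀ j, x j ≤ x (j + 1) := fun j => by linarith [hstep j]
  have hii : ∀ j < M, IntervalIntegrable f volume (x j) (x (j + 1)) := fun j hj =>
    ((hcont.mono (hsub j hj)).intervalIntegrable_of_Icc (hle j))
  have e1 : (∫ y in a..b, f y) = ∑ j ∈ Finset.range M, ∫ y in (x j)..(x (j + 1)), f y := by
    rw [intervalIntegral.sum_integral_adjacent_intervals hii]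
    simp only [hx, Nat.cast_zero, zero_mul, add_zero, hMh]
    congr 1
    ring
  have e2 : (∑ j ∈ Finset.range (2 ^ m), (endFactor m j * ((b - a) / (2 * gridM m))) •
      f (a + j * h)) = ∑ j ∈ Finset.range M, ((h / 2) • f (x j) + (h / 2) • f (x (j + 1))) := by
    rw [← sum_endFactor_smul hm (fun j => (h / 2) • f (x j))]
    refine Finset.sum_congr rfl fun j _ => ?_
    rw [smul_smul]
    congr 2
    rw [hh]
    field_simp
  rw [e1, e2, ← Finset.sum_sub_distrib]
  have hterm : ∀ j ∈ Finset.range M, ‖(h / 2) • f (x j) + (h / 2) • f (x (j + 1)) -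
      ∫ y in (x j)..(x (j + 1)), f y‖ ≤ h * (Λ * h) := by
    intro j hj
    have hj' := Finset.mem_range.1 hj
    have hΛ0 : ∀ d, 0 ≤ d → d ≤ h → Λ * d ≤ Λ * h := by
      intro d hd hdh
      rcases hd.eq_or_lt with rfl | hd'
      · simpa using hΛ
      · have : 0 ≤ Λ := nonneg_of_mul_nonneg_left hΛ (by linarith)
        gcongr
    have e3 : (h / 2) • f (x j) + (h / 2) • f (x (j + 1)) - ∫ y in (x j)..(x (j + 1)), f y =
        ∫ y in (x j)..(x (j + 1)), (((1 / 2 : ℝ) • f (x j) + (1 / 2 : ℝ) • f (x (j + 1))) - f y) := by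
      rw [intervalIntegral.integral_sub intervalIntegrable_const (hii j hj'),
        intervalIntegral.integral_const, hstep]
      module
    rw [e3]
    have hb := intervalIntegral.norm_integral_le_of_norm_le_const (a := x j) (b := x (j + 1))
      (f := fun y => ((1 / 2 : ℝ) • f (x j) + (1 / 2 : ℝ) • f (x (j + 1))) - f y)
      (C := Λ * h) ?_
    · rw [hstep, abs_of_nonneg hh0] at hb
      linarith
    · intro y hy
      rw [uIoc_of_le (hle j)] at hy
      have hy' := Ioc_subset_Icc_self hy
      have hyab := hsub j hj' hy'
      have n1 := hf (x j) (hxmem j hj'.le) y hyab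
      have n2 := hf (x (j + 1)) (hxmem (j + 1) hj') y hyab
      have m1 := hΛ0 |x j - y| (abs_nonneg _) (by
        rw [abs_sub_comm, abs_of_nonneg (by linarith [hy'.1])]
        linarith [hstep j, hy'.2])
      have m2 := hΛ0 |x (j + 1) - y| (abs_nonneg _) (by
        rw [abs_of_nonneg (by linarith [hy'.2])]
        linarith [hstep j, hy'.1])
      have e4 : ((1 / 2 : ℝ) • f (x j) + (1 / 2 : ℝ) • f (x (j + 1))) - f y =
          (1 / 2 : ℝ) • (f (x j) - f y) + (1 / 2 : ℝ) • (f (x (j + 1)) - f y) := by module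
      rw [e4]
      refine (norm_add_le _ _).trans ?_
      rw [norm_smul, norm_smul, Real.norm_of_nonneg (by norm_num)]
      linarith
  calc _ ≤ ∑ j ∈ Finset.range M, _ := norm_sum_le _ _
    _ ≤ ∑ j ∈ Finset.range M, h * (Λ * h) := Finset.sum_le_sum hterm
    _ = (b - a) * (Λ * h) := by
      rw [Finset.sum_const, Finset.card_range, nsmul_eq_mul, ← mul_assoc, hMh]

/-- Sums over the labels of a register are sums over the encoded numbers. -/
lemma sum_bits {E : Type*} [AddCommMonoid E] (m : ℕ) (f : ℕ → E) :
    ∑ x : Bits (Fin m), f (val x) = ∑ j ∈ Finset.range (2 ^ m), f j := by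
  rw [← Fin.sum_univ_eq_sum_range]
  exact Fintype.sum_equiv finFunctionFinEquiv _ _ fun x => rfl

end Quadrature

namespace LCHS

/-- A matrix as an operator on the Euclidean space. -/
abbrev opOf {N : ℕ} (M : Matrix (Fin N) (Fin N) ℂ) :
    EuclideanSpace ℂ (Fin N) →L[ℂ] EuclideanSpace ℂ (Fin N) :=
  Matrix.toEuclideanCLM (n := Fin N) (𝕜 := ℂ) M

lemma norm_opOf_le {N : ℕ} (M : Matrix (Fin N) (Fin N) ℂ) (x : EuclideanSpace ℂ (Fin N)) :
    ‖opOf M x‖ ≤ ‖M‖ * ‖x‖ := (opOf M).le_opNorm x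

lemma opOf_mul_apply {N : ℕ} (M M' : Matrix (Fin N) (Fin N) ℂ) (x : EuclideanSpace ℂ (Fin N)) :
    opOf (M * M') x = opOf M (opOf M' x) := by
  simp [opOf, map_mul]

/-- The action of matrices on vectors as a continuous bilinear map over `ℝ`. -/
def opBilin (N : ℕ) : Matrix (Fin N) (Fin N) ℂ →L[ℝ] EuclideanSpace ℂ (Fin N) →L[ℝ]
    EuclideanSpace ℂ (Fin N) :=
  LinearMap.mkContinuous₂
    (LinearMap.mk₂ ℝ (fun M x => opOf M x) (fun M M' x => by simp [opOf])
      (fun c M x => by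
        have : c • M = (c : ℂ) • M := by ext; simp
        rw [this, opOf, map_smul, smul_apply, Complex.coe_smul])
      (fun M x y => map_add _ _ _) (fun c M x => by
        have : c • x = (c : ℂ) • x := by ext; simp
        rw [this, map_smul, Complex.coe_smul])) 1
    (fun M x => by rw [one_mul]; exact norm_opOf_le M x)

lemma opBilin_apply {N : ℕ} (M : Matrix (Fin N) (Fin N) ℂ) (x : EuclideanSpace ℂ (Fin N)) :
    opBilin N M x = opOf M x := rfl

/-! ### Dissipative matrices -/

/-- The numerical range of `M` lies in the left half plane. -/
def Dissipative {N : ℕ} (M : Matrix (Fin N) (Fin N) ℂ) : Prop :=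
  ∀ x : EuclideanSpace ℂ (Fin N), (inner ℂ x (opOf M x)).re ≤ 0

lemma inner_opOf {N : ℕ} (M : Matrix (Fin N) (Fin N) ℂ) (x : EuclideanSpace ℂ (Fin N)) :
    inner ℂ x (opOf M x) = dotProduct (star x.ofLp) (M.mulVec x.ofLp) := by
  rw [EuclideanSpace.inner_eq_star_dotProduct, dotProduct_comm]
  rfl

/-- The derivative of `‖y‖²` is `2 Re ⟨y, G y⟩ ≤ 0`. -/
lemma norm_le_of_dissipative {N : ℕ} {G : ℝ → Matrix (Fin N) (Fin N) ℂ} {a b : ℝ} (hab : a ≤ b)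
    (hG : ∀ t ∈ Icc a b, Dissipative (G t)) {y : ℝ → EuclideanSpace ℂ (Fin N)}
    (hy : ∀ t ∈ Icc a b, HasDerivWithinAt y (opOf (G t) (y t)) (Icc a b) t) : ‖y b‖ ≤ ‖y a‖ := by
  have hd : ∀ t ∈ Icc a b, HasDerivWithinAt (fun t => ‖y t‖ ^ 2)
      (2 * (inner ℂ (y t) (opOf (G t) (y t))).re) (Icc a b) t := by
    intro t ht
    have h1 := Complex.reCLM.hasFDerivAt.comp_hasDerivWithinAt t
      ((hy t ht).inner ℂ (hy t ht))
    have h2 : (inner ℂ (opOf (G t) (y t)) (y t)).re = (inner ℂ (y t) (opOf (G t) (y t))).re := by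
      rw [← inner_conj_symm, Complex.conj_re]
    have e : Complex.reCLM (inner ℂ (y t) (opOf (G t) (y t)) + inner ℂ (opOf (G t) (y t)) (y t)) =
        2 * (inner ℂ (y t) (opOf (G t) (y t))).re := by
      rw [Complex.reCLM_apply, Complex.add_re, h2]
      ring
    rw [e] at h1
    refine h1.congr_of_eventuallyEq (Filter.Eventually.of_forall fun t => ?_) ?_ <;>
    exact (inner_self_eq_norm_sq (𝕜 := ℂ) _).symm
  have hanti : AntitoneOn (fun t => ‖y t‖ ^ 2) (Icc a b) := by
    refine antitoneOn_of_hasDerivWithinAt_nonpos (convex_Icc a b)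
      (fun t ht => (hd t ht).continuousWithinAt)
      (f' := fun t => 2 * (inner ℂ (y t) (opOf (G t) (y t))).re) ?_ ?_
    · intro t ht
      exact (hd t (interior_subset ht)).mono interior_subset
    · intro t ht
      have h1 := hG t (interior_subset ht) (y t)
      linarith
  have := hanti (left_mem_Icc.2 hab) (right_mem_Icc.2 hab) hab
  exact (pow_le_pow_iff_left₀ (norm_nonneg _) (norm_nonneg _) two_ne_zero).1 this

/-! ### Generators of the problem -/

namespace ODEData

variable {N : ℕ} (P : ODEData N)

/-- The generators `-i z L` and `-i H`. -/
def gen (z : ℂ) (b : Bool) (t : ℝ) : Matrix (Fin N) (Fin N) ℂ :=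
  if b then (-(Complex.I * z)) • P.L t else (-Complex.I) • P.H t

/-- This identity singles out `-i` as the point at which the averages are evaluated. -/
lemma gen_neg_I (t : ℝ) : P.gen (-Complex.I) true t + P.gen (-Complex.I) false t = -P.A t := by
  ext i j
  simp only [gen, L, H, if_true, Matrix.add_apply, Matrix.smul_apply, Matrix.sub_apply,
    Matrix.neg_apply, smul_eq_mul, Bool.false_eq_true, if_false]
  have : Complex.I ^ 2 = -1 := Complex.I_sq
  field_simp
  linear_combination (P.A t i j + (P.A t).conjTranspose i j) * this

lemma isHermitian_L (t : ℝ) : (P.L t).IsHermitian := by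
  unfold L
  rw [Matrix.IsHermitian, Matrix.conjTranspose_smul, Matrix.conjTranspose_add,
    Matrix.conjTranspose_conjTranspose, add_comm]
  congr 1
  norm_num [Complex.ext_iff]

lemma isHermitian_H (t : ℝ) : (P.H t).IsHermitian := by
  unfold H
  rw [Matrix.IsHermitian, Matrix.conjTranspose_smul, Matrix.conjTranspose_sub,
    Matrix.conjTranspose_conjTranspose, ← neg_sub (P.A t), smul_neg, ← neg_smul]
  congr 1
  simp

namespace Admissible

variable {P} {p : ℕ} (hP : P.Admissible p)
include hP

/-- In the real part `H` drops out because `⟨x, H x⟩` is real, while `-i z ⟨x, L x⟩` contributes `Im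
z ⟨x, L x⟩`. -/
lemma dissipative_gen {z : ℂ} (hz : z.im ≤ 0) {t : ℝ} (ht : t ∈ Icc 0 P.T) :
    Dissipative (P.gen z true t + P.gen z false t) := by
  intro x
  have hL := (hP.dissipative t ht).dotProduct_mulVec_nonneg x.ofLp
  have hH := (P.isHermitian_H t).im_star_dotProduct_mulVec_self x.ofLp
  have hH' : (inner ℂ x (opOf (P.H t) x)).im = 0 := by
    rw [inner_opOf]; exact hH
  have hL' : 0 ≤ inner ℂ x (opOf (P.L t) x) := by
    rw [inner_opOf]; exact hL
  have e : opOf (P.gen z true t + P.gen z false t) x =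
      (-(Complex.I * z)) • opOf (P.L t) x + (-Complex.I) • opOf (P.H t) x := by
    simp [gen, opOf]
  rw [e, inner_add_right, inner_smul_right, inner_smul_right]
  obtain ⟨h1, h2⟩ := Complex.nonneg_iff.1 hL'
  simp [hH', ← h2]
  exact mul_nonpos_of_nonpos_of_nonneg hz h1

lemma contDiffOn_L : ContDiffOn ℝ p P.L (Icc 0 P.T) := by
  have h1 : ContDiffOn ℝ p (fun t => (P.A t).conjTranspose) (Icc 0 P.T) :=
    (starL' ℝ : Matrix (Fin N) (Fin N) ℂ ≃L[ℝ] Matrix (Fin N) (Fin N) ℂ).contDiff.comp_contDiffOn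
      hP.smooth_A
  exact (hP.smooth_A.add h1).const_smul (1 / 2 : ℂ)

lemma contDiffOn_H : ContDiffOn ℝ p P.H (Icc 0 P.T) := by
  have h1 : ContDiffOn ℝ p (fun t => (P.A t).conjTranspose) (Icc 0 P.T) :=
    (starL' ℝ : Matrix (Fin N) (Fin N) ℂ ≃L[ℝ] Matrix (Fin N) (Fin N) ℂ).contDiff.comp_contDiffOn
      hP.smooth_A
  exact (hP.smooth_A.sub h1).const_smul (1 / (2 * Complex.I) : ℂ)

/-- Without this the supremum defining `Gam` could be the default value of `sSup` and would bound
nothing. -/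
lemma bddAbove_Gam {p' : ℕ} (hp : p' ≤ p) :
    BddAbove {x : ℝ | ∃ q ≤ p', ∃ τ ∈ Icc 0 P.T,
    x = (‖iteratedDerivWithin q P.H (Icc 0 P.T) τ‖ +
          ‖iteratedDerivWithin q P.L (Icc 0 P.T) τ‖) ^ (1 / ((q : ℝ) + 1))} := by
  have hud := uniqueDiffOn_Icc hP.T_pos
  have hq : ∀ q, ∃ B : ℝ, q ≤ p → ∀ τ ∈ Icc 0 P.T,
      (‖iteratedDerivWithin q P.H (Icc 0 P.T) τ‖ +
          ‖iteratedDerivWithin q P.L (Icc 0 P.T) τ‖) ^ (1 / ((q : ℝ) + 1)) ≤ B := by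
    intro q
    by_cases hqp : q ≤ p
    · have h1 := hP.contDiffOn_H.continuousOn_iteratedDerivWithin (m := q)
        (by exact_mod_cast hqp) hud
      have h2 := hP.contDiffOn_L.continuousOn_iteratedDerivWithin (m := q)
        (by exact_mod_cast hqp) hud
      have h3 := (h1.norm.add h2.norm).rpow_const (p := 1 / ((q : ℝ) + 1))
        (fun x _ => Or.inr (by positivity))
      obtain ⟨B, hB⟩ := isCompact_Icc.exists_bound_of_continuousOn h3
      exact ⟨B, fun _ τ hτ => (le_abs_self _).trans (hB τ hτ)⟩
    · exact ⟨0, fun h => absurd h hqp⟩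
  choose B hB using hq
  refine ⟨∑ q ∈ Finset.range (p + 1), |B q|, ?_⟩
  rintro x ⟨q, hqp, τ, hτ, rfl⟩
  refine ((hB q (hqp.trans hp) τ hτ).trans (le_abs_self _)).trans ?_
  exact Finset.single_le_sum (f := fun q => |B q|) (fun _ _ => abs_nonneg _)
    (Finset.mem_range.2 (by omega))

lemma norm_deriv_le_Gam {p' : ℕ} (hp : p' ≤ p) {q : ℕ} (hq : q ≤ p') {τ : ℝ}
    (hτ : τ ∈ Icc 0 P.T) :
    ‖iteratedDerivWithin q P.H (Icc 0 P.T) τ‖ + ‖iteratedDerivWithin q P.L (Icc 0 P.T) τ‖ ≤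
      P.Gam p' ^ (q + 1) := by
  set x := ‖iteratedDerivWithin q P.H (Icc 0 P.T) τ‖ + ‖iteratedDerivWithin q P.L (Icc 0 P.T) τ‖
  have hx : 0 ≤ x := by positivity
  have h1 : x ^ (1 / ((q : ℝ) + 1)) ≤ P.Gam p' := le_csSup (hP.bddAbove_Gam hp) ⟨q, hq, τ, hτ, rfl⟩
  calc x = (x ^ (1 / ((q : ℝ) + 1))) ^ (q + 1) := by
        rw [← Real.rpow_natCast, ← Real.rpow_mul hx]
        push_cast
        rw [one_div_mul_cancel (by positivity), Real.rpow_one]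
    _ ≤ _ := pow_le_pow_left₀ (by positivity) h1 _

lemma norm_le_Gam {p' : ℕ} (hp : p' ≤ p) {τ : ℝ} (hτ : τ ∈ Icc 0 P.T) :
    ‖P.H τ‖ + ‖P.L τ‖ ≤ P.Gam p' := by
  simpa using hP.norm_deriv_le_Gam hp (Nat.zero_le _) hτ

lemma Gam_nonneg {p' : ℕ} (hp : p' ≤ p) : 0 ≤ P.Gam p' :=
  le_trans (by positivity) (hP.norm_le_Gam hp (left_mem_Icc.2 hP.T_pos.le))

lemma Gam_mono {p' : ℕ} (hp : p' ≤ p) : P.Gam p' ≤ P.Gam p := by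
  refine csSup_le_csSup (hP.bddAbove_Gam le_rfl) ?_ ?_
  · exact ⟨_, 0, Nat.zero_le _, 0, left_mem_Icc.2 hP.T_pos.le, rfl⟩
  · rintro x ⟨q, hq, h⟩
    exact ⟨q, hq.trans hp, h⟩

lemma supNorm_L_le {p' : ℕ} (hp : p' ≤ p) : supNorm P.T P.L ≤ P.Gam p' := by
  refine csSup_le ((nonempty_Icc.2 hP.T_pos.le).image _) ?_
  rintro _ ⟨τ, hτ, rfl⟩
  have := hP.norm_le_Gam hp hτ
  have := norm_nonneg (P.H τ)
  simp only
  linarith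

lemma supNorm_H_le {p' : ℕ} (hp : p' ≤ p) : supNorm P.T P.H ≤ P.Gam p' := by
  refine csSup_le ((nonempty_Icc.2 hP.T_pos.le).image _) ?_
  rintro _ ⟨τ, hτ, rfl⟩
  have := hP.norm_le_Gam hp hτ
  have := norm_nonneg (P.L τ)
  simp only
  linarith

lemma norm_gen_le {p' : ℕ} (hp : p' ≤ p) {z : ℂ} {κ : ℝ} (hκ : 1 ≤ κ) (hz : ‖z‖ ≤ κ) {t : ℝ}
    (ht : t ∈ Icc 0 P.T) : ‖P.gen z true t + P.gen z false t‖ ≤ κ * P.Gam p' := by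
  have h1 := hP.norm_le_Gam hp ht
  calc _ ≤ ‖P.gen z true t‖ + ‖P.gen z false t‖ := norm_add_le _ _
    _ = ‖z‖ * ‖P.L t‖ + ‖P.H t‖ := by simp [gen, norm_smul]
    _ ≤ κ * ‖P.L t‖ + κ * ‖P.H t‖ := by
        gcongr
        exact le_mul_of_one_le_left (norm_nonneg _) hκ
    _ = κ * (‖P.H t‖ + ‖P.L t‖) := by ring
    _ ≤ _ := by gcongr

lemma contDiffOn_gen (z : ℂ) (b : Bool) : ContDiffOn ℝ p (P.gen z b) (Icc 0 P.T) := by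
  cases b
  · exact hP.contDiffOn_H.const_smul (-Complex.I)
  · exact hP.contDiffOn_L.const_smul (-(Complex.I * z))

/-- The scalar `z` enters only once, but `κ ≤ κ ^ (k + 1)`, so `κ Γ_p` can serve as the scale `μ` of
the local error estimate. -/
lemma norm_iteratedDeriv_gen_le {z : ℂ} {κ : ℝ} (hκ : 1 ≤ κ) (hz : ‖z‖ ≤ κ) (b : Bool) {k : ℕ}
    (hk : k ≤ p) {t : ℝ} (ht : t ∈ Icc 0 P.T) :
    ‖iteratedDerivWithin k (P.gen z b) (Icc 0 P.T) t‖ ≤ (κ * P.Gam p) ^ (k + 1) := by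
  have hud := uniqueDiffOn_Icc hP.T_pos
  have h1 := hP.norm_deriv_le_Gam le_rfl hk ht
  have hκ' : κ ≤ κ ^ (k + 1) := le_self_pow₀ hκ (Nat.succ_ne_zero k)
  have hΓ := pow_nonneg (hP.Gam_nonneg le_rfl) (k + 1)
  have hle : κ * P.Gam p ^ (k + 1) ≤ (κ * P.Gam p) ^ (k + 1) := by
    rw [mul_pow]
    gcongr
  refine le_trans ?_ hle
  have hkp : (k : WithTop ℕ∞) ≤ p := by exact_mod_cast hk
  cases b
  · have e : iteratedDerivWithin k (P.gen z false) (Icc 0 P.T) t =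
        (-Complex.I) • iteratedDerivWithin k P.H (Icc 0 P.T) t :=
      iteratedDerivWithin_const_smul ht hud (-Complex.I) ((hP.contDiffOn_H t ht).of_le hkp)
    rw [e, norm_smul, norm_neg, Complex.norm_I, one_mul]
    refine le_trans ?_ (le_mul_of_one_le_left hΓ hκ)
    linarith [norm_nonneg (iteratedDerivWithin k P.L (Icc 0 P.T) t)]
  · have e : iteratedDerivWithin k (P.gen z true) (Icc 0 P.T) t =
        (-(Complex.I * z)) • iteratedDerivWithin k P.L (Icc 0 P.T) t :=
      iteratedDerivWithin_const_smul ht hud (-(Complex.I * z)) ((hP.contDiffOn_L t ht).of_le hkp)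
    rw [e, norm_smul, norm_neg, norm_mul, Complex.norm_I, one_mul]
    have := norm_nonneg (iteratedDerivWithin k P.H (Icc 0 P.T) t)
    gcongr
    linarith

end Admissible

/-! ### Propagators -/

/-- `V` is a fundamental solution with generator `-i (z L + H)` on `[0, T]` and `W` its inverse. -/
structure Propagator (z : ℂ) (V W : ℝ → Matrix (Fin N) (Fin N) ℂ) : Prop where
  deriv : ∀ t ∈ Icc 0 P.T,
    HasDerivWithinAt V ((P.gen z true t + P.gen z false t) * V t) (Icc 0 P.T) t
  deriv_inv : ∀ t ∈ Icc 0 P.T,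
    HasDerivWithinAt W (-(W t * (P.gen z true t + P.gen z false t))) (Icc 0 P.T) t
  mul_inv : ∀ t, V t * W t = 1
  inv_mul : ∀ t, W t * V t = 1

variable {P} {p : ℕ}

lemma Admissible.exists_propagator (hP : P.Admissible p) (z : ℂ) :
    ∃ V W, P.Propagator z V W := by
  have hc : ContinuousOn (fun t => P.gen z true t + P.gen z false t) (Icc 0 P.T) :=
    (hP.contDiffOn_gen z true).continuousOn.add (hP.contDiffOn_gen z false).continuousOn
  have hT := hP.T_pos.le
  -- The generator is extended beyond `[0, T]` by its end values, which makes it continuous on the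
  -- whole line.
  obtain ⟨V, W, -, hV, hW, hVW, hWV⟩ := exists_fundamental_solution
    (G := IccExtend hT ((Icc 0 P.T).domRestrict fun t => P.gen z true t + P.gen z false t))
    (hc.domRestrict.Icc_extend')
  refine ⟨V, W, fun t ht => ?_, fun t ht => ?_, hVW, hWV⟩
  · have := hV t
    rw [IccExtend_of_mem hT _ ht] at this
    exact this.hasDerivWithinAt
  · have := hW t
    rw [IccExtend_of_mem hT _ ht] at this
    exact this.hasDerivWithinAt

/-- The curve `τ ↦ V τ W s x` starts at `x` and solves a dissipative equation. -/
lemma Propagator.norm_le_one {z : ℂ} {V W : ℝ → Matrix (Fin N) (Fin N) ℂ}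
    (h : P.Propagator z V W) (hP : P.Admissible p) (hz : z.im ≤ 0) {s t : ℝ} (hs : 0 ≤ s)
    (hst : s ≤ t) (ht : t ≤ P.T) : ‖V t * W s‖ ≤ 1 := by
  rw [Matrix.cstar_norm_def]
  refine ContinuousLinearMap.opNorm_le_bound _ zero_le_one fun x => ?_
  have hsub : Icc s t ⊆ Icc 0 P.T := Icc_subset_Icc hs ht
  have key := norm_le_of_dissipative hst (fun τ hτ => hP.dissipative_gen hz (hsub hτ))
    (y := fun τ => opOf (V τ * W s) x) (fun τ hτ => by
      have h1 := ((h.deriv τ (hsub hτ)).mono hsub).mul_const (W s)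
      have h2 := ((opBilin N).flip x).hasFDerivAt.comp_hasDerivWithinAt τ h1
      rw [← opOf_mul_apply, ← mul_assoc]
      exact h2)
  simp only [h.mul_inv] at key
  rw [one_mul]
  refine key.trans (le_of_eq ?_)
  simp [opOf]

/-- The propagator over `[s, t]` as a function of its final time. -/
lemma Propagator.hasDerivWithinAt_sub {z : ℂ} {V W : ℝ → Matrix (Fin N) (Fin N) ℂ}
    (h : P.Propagator z V W) (s : ℝ) {a b : ℝ} (ha : 0 ≤ a) (hb : b ≤ P.T) {x : ℝ}
    (hx : x ∈ Icc a b) : HasDerivWithinAt (fun x => V x * W s)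
      ((P.gen z true x + P.gen z false x) * (V x * W s)) (Icc a b) x := by
  have hsub : Icc a b ⊆ Icc 0 P.T := Icc_subset_Icc ha hb
  have := ((h.deriv x (hsub hx)).mono hsub).mul_const (W s)
  rwa [mul_assoc] at this

end ODEData

/-! ### Product formulas over several steps -/

/-- The product formula with `n` steps of length `h`, starting at time `s`. -/
def stepsProd {𝔸 : Type*} [NormedRing 𝔸] [NormedAlgebra ℝ 𝔸] [CompleteSpace 𝔸]
    (X : Bool → ℝ → 𝔸) (l : List Stage) (s h : ℝ) : ℕ → 𝔸
  | 0 => 1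
  | n + 1 => formulaStep X l (s + n * h) h * stepsProd X l s h n

/-- Local errors are transported by exact propagators, which are contractions, so there is no growth
exponential in `Γ_p T`. The only growth is that of the approximate products themselves, at most `(1
+ δ) ^ n`. -/
theorem exists_stepsProd_error (p : ℕ) (hp : 1 ≤ p) : ∃ C : ℝ, 0 ≤ C ∧ ∀ (N : ℕ) [NeZero N]
    (P : ODEData N), P.Admissible p → 0 < P.Gam p → ∀ (z : ℂ) (κ : ℝ), 1 ≤ κ → ‖z‖ ≤ κ →
    z.im ≤ 0 → ∀ V W, P.Propagator z V W → ∀ (s : ℝ), s ∈ Icc 0 P.T → ∀ (r : ℕ), 0 < r →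
    κ * P.Gam p * P.T ≤ r → ∀ δ : ℝ, C * (κ * P.Gam p * P.T / r) ^ (p + 1) ≤ δ → r * δ ≤ 1 →
    ‖stepsProd (P.gen z) (suzuki p) s ((P.T - s) / r) r - V P.T * W s‖ ≤ 2 * (r * δ) := by
  obtain ⟨C, hC0, hC⟩ := exists_step_error p hp
  refine ⟨C, hC0, fun N _ P hP hΓ z κ hκ hz hzi V W hVW s hs r hr hκr δ hδ hrδ => ?_⟩
  set h := (P.T - s) / r with hh
  have hr' : (0 : ℝ) < r := by exact_mod_cast hr
  have hh0 : 0 ≤ h := div_nonneg (by linarith [hs.2]) hr'.le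
  have hhT : h ≤ P.T / r := by
    rw [hh]
    gcongr
    linarith [hs.1]
  have hrh : s + r * h = P.T := by
    rw [hh]
    field_simp
    ring
  have hμ : 0 < κ * P.Gam p := by positivity
  have hμh : κ * P.Gam p * h ≤ κ * P.Gam p * P.T / r := by
    rw [mul_div_assoc]
    gcongr
  have hμh1 : κ * P.Gam p * h ≤ 1 := hμh.trans ((div_le_one hr').2 hκr)
  have hδ0 : 0 ≤ δ := by
    refine le_trans ?_ hδ
    have := hP.T_pos
    positivity
  have htime : ∀ n ≤ r, s + n * h ≤ P.T := by
    intro n hn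
    rw [← hrh]
    gcongr
  have hstep : ∀ n < r, ‖formulaStep (P.gen z) (suzuki p) (s + n * h) h -
      V (s + (n + 1 : ℕ) * h) * W (s + n * h)‖ ≤ δ := by
    intro n hn
    have h0 : 0 ≤ s + n * h := add_nonneg hs.1 (by positivity)
    have e : s + (n + 1 : ℕ) * h = s + n * h + h := by push_cast; ring
    have h1 : s + n * h + h ≤ P.T := by rw [← e]; exact htime (n + 1) hn
    have := hC N P.T (κ * P.Gam p) (P.gen z) hP.T_pos hμ (hP.contDiffOn_gen z)
      (fun b k hk t ht => hP.norm_iteratedDeriv_gen_le hκ hz b hk ht) (s + n * h) h h0 hh0 h1 hμh1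
      (fun x => V x * W (s + n * h)) (hVW.mul_inv _)
      (fun x hx => hVW.hasDerivWithinAt_sub _ h0 h1 hx)
    rw [e]
    refine this.trans (le_trans ?_ hδ)
    gcongr
  have hmain : ∀ n ≤ r, ‖stepsProd (P.gen z) (suzuki p) s h n - V (s + n * h) * W s‖ ≤
      (1 + δ) ^ n - 1 := by
    intro n
    induction n with
    | zero =>
      intro _
      simp [stepsProd, hVW.mul_inv]
    | succ n ih =>
      intro hn
      have ih' := ih (by omega)
      set S := stepsProd (P.gen z) (suzuki p) s h n
      set F := formulaStep (P.gen z) (suzuki p) (s + n * h) h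
      have h0 : 0 ≤ (n : ℝ) * h := by positivity
      have hU : ‖V (s + n * h) * W s‖ ≤ 1 :=
        hVW.norm_le_one hP hzi hs.1 (by linarith) (htime n (by omega))
      have hU' : ‖V (s + (n + 1 : ℕ) * h) * W (s + n * h)‖ ≤ 1 :=
        hVW.norm_le_one hP hzi (by linarith [hs.1]) (by push_cast; linarith) (htime (n + 1) hn)
      have e : F * S - V (s + (n + 1 : ℕ) * h) * W s =
          (F - V (s + (n + 1 : ℕ) * h) * W (s + n * h)) * S +
          (V (s + (n + 1 : ℕ) * h) * W (s + n * h)) * (S - V (s + n * h) * W s) := by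
        have : V (s + (n + 1 : ℕ) * h) * W (s + n * h) * (V (s + n * h) * W s) =
            V (s + (n + 1 : ℕ) * h) * W s := by
          rw [mul_assoc, ← mul_assoc (W (s + n * h)), hVW.inv_mul, one_mul]
        rw [mul_sub, this, sub_mul]
        abel
      have hS : ‖S‖ ≤ (1 + δ) ^ n := by
        have := norm_add_le (S - V (s + n * h) * W s) (V (s + n * h) * W s)
        rw [sub_add_cancel] at this
        linarith
      show ‖F * S - _‖ ≤ _
      rw [e]
      calc _ ≤ ‖F - V (s + (n + 1 : ℕ) * h) * W (s + n * h)‖ * ‖S‖ +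
            ‖V (s + (n + 1 : ℕ) * h) * W (s + n * h)‖ * ‖S - V (s + n * h) * W s‖ :=
            (norm_add_le _ _).trans (add_le_add (norm_mul_le _ _) (norm_mul_le _ _))
        _ ≤ δ * (1 + δ) ^ n + 1 * ((1 + δ) ^ n - 1) := by
            gcongr
            exact hstep n (by omega)
        _ = _ := by ring
  have := hmain r le_rfl
  rw [hrh] at this
  refine this.trans ?_
  have h1 : (1 + δ) ^ r ≤ Real.exp (r * δ) := by
    rw [mul_comm, Real.exp_mul, Real.rpow_natCast]
    exact pow_le_pow_left₀ (by linarith) (by linarith [Real.add_one_le_exp δ]) _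
  have h2 : Real.exp (r * δ) ≤ 1 + 2 * (r * δ) := by
    have hx0 : 0 ≤ r * δ := by positivity
    have := Real.abs_exp_sub_one_le (x := r * δ) (by rwa [abs_of_nonneg hx0])
    rw [abs_of_nonneg hx0] at this
    linarith [le_abs_self (Real.exp (r * δ) - 1)]
  linarith

/-! ### The product formula as a function of `z` -/

lemma norm_exp_le_one_of_skew {N : ℕ} [NeZero N] {Y : Matrix (Fin N) (Fin N) ℂ}
    (hY : Y ∈ skewAdjoint (Matrix (Fin N) (Fin N) ℂ)) : ‖exp Y‖ ≤ 1 := by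
  let _ : NormedAlgebra ℚ (Matrix (Fin N) (Fin N) ℂ) :=
    NormedAlgebra.restrictScalars ℚ ℝ (Matrix (Fin N) (Fin N) ℂ)
  exact (CStarRing.norm_of_mem_unitary (exp_mem_unitary_of_mem_skewAdjoint hY)).le

lemma norm_exp_smul_sub_le_of_skew {N : ℕ} [NeZero N] {Y : Matrix (Fin N) (Fin N) ℂ}
    (hY : Y ∈ skewAdjoint (Matrix (Fin N) (Fin N) ℂ)) (k k' : ℝ) :
    ‖exp (k • Y) - exp (k' • Y)‖ ≤ ‖Y‖ * |k - k'| := by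
  refine Convex.norm_image_sub_le_of_norm_hasDerivWithin_le (f := fun k : ℝ => exp (k • Y))
    (f' := fun k : ℝ => Y * exp (k • Y)) (s := univ)
    (fun x _ => (hasDerivAt_exp_smul_const' (𝕂 := ℝ) Y x).hasDerivWithinAt) (fun x _ => ?_)
    convex_univ (mem_univ _) (mem_univ _)
  refine (norm_mul_le _ _).trans (mul_le_of_le_one_right (norm_nonneg _) ?_)
  exact norm_exp_le_one_of_skew (skewAdjoint.smul_mem x hY)

lemma skew_of_isHermitian {N : ℕ} {G : Matrix (Fin N) (Fin N) ℂ} (hG : G.IsHermitian) (s : ℝ) :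
    (-(Complex.I * s)) • G ∈ skewAdjoint (Matrix (Fin N) (Fin N) ℂ) := by
  rw [skewAdjoint.mem_iff, Matrix.star_eq_conjTranspose, Matrix.conjTranspose_smul, hG.eq,
    ← neg_smul]
  congr 1
  simp

namespace ODEData

variable {N : ℕ} [NeZero N] (P : ODEData N)

/-- The product formula over `[s, T]` with `r` steps. -/
def approxProp (p r : ℕ) (s : ℝ) (z : ℂ) : Matrix (Fin N) (Fin N) ℂ :=
  stepsProd (P.gen z) (suzuki p) s ((P.T - s) / r) r

omit [NeZero N] in
lemma differentiable_formulaStep (l : List Stage) (t h : ℝ) :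
    Differentiable ℂ fun z => formulaStep (P.gen z) l t h := by
  induction l with
  | nil => exact differentiable_const _
  | cons a l ih =>
    simp only [formulaStep, List.map_cons, List.prod_cons] at ih ⊢
    refine Differentiable.mul ?_ ih
    have h1 : Differentiable ℂ (exp : Matrix (Fin N) (Fin N) ℂ → Matrix (Fin N) (Fin N) ℂ) :=
      fun x => (exp_analytic (𝕂 := ℂ) x).differentiableAt
    have h2 : Differentiable ℂ fun z => (a.α * h) • P.gen z a.b (t + a.β * h) := by
      rcases a with ⟨_ | _, α, β⟩
      · simp only [gen, Bool.false_eq_true, if_false]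
        fun_prop
      · simp only [gen, if_true]
        fun_prop
    exact h1.comp h2

-- Each factor is the exponential of an affine function of `z`. Being entire for a fixed number of
-- steps is what lets Cauchy's formula act on the product formula itself.
omit [NeZero N] in
lemma differentiable_approxProp (p r : ℕ) (s : ℝ) : Differentiable ℂ (P.approxProp p r s) := by
  unfold approxProp
  generalize (P.T - s) / r = h
  induction r with
  | zero => exact differentiable_const _
  | succ n ih => exact (P.differentiable_formulaStep _ _ _).mul ih

lemma stage_gen_real (k : ℝ) (a : Stage) (t h : ℝ) :
    (a.α * h) • P.gen k a.b (t + a.β * h) =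
      (-(Complex.I * (a.α * h * (if a.b then k else 1) : ℝ))) •
        (if a.b then P.L (t + a.β * h) else P.H (t + a.β * h)) := by
  rcases a with ⟨_ | _, α, β⟩
  · simp only [gen, Bool.false_eq_true, if_false, mul_one]
    rw [← Complex.coe_smul, smul_smul]
    congr 1
    ring
  · simp only [gen, if_true]
    rw [← Complex.coe_smul, smul_smul]
    congr 1
    push_cast
    ring

lemma stage_skew (k : ℝ) (a : Stage) (t h : ℝ) :
    (a.α * h) • P.gen k a.b (t + a.β * h) ∈ skewAdjoint (Matrix (Fin N) (Fin N) ℂ) := by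
  rw [stage_gen_real]
  refine skew_of_isHermitian ?_ _
  split_ifs
  · exact P.isHermitian_L _
  · exact P.isHermitian_H _

variable {P} {p : ℕ}

/-- For real arguments every factor is unitary, so the changes of the factors add without
amplification; only the `L` stages depend on `k`. -/
lemma Admissible.norm_formulaStep_real (hP : P.Admissible p) (hp : 1 ≤ p) (k k' : ℝ) {t h : ℝ}
    (ht : 0 ≤ t) (hh : 0 ≤ h) (hth : t + h ≤ P.T) :
    ‖formulaStep (P.gen k) (suzuki p) t h‖ ≤ 1 ∧
    ‖formulaStep (P.gen k) (suzuki p) t h - formulaStep (P.gen k') (suzuki p) t h‖ ≤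
      (suzuki p).length * (h * P.Gam 1 * |k - k'|) := by
  have hΓ := hP.Gam_nonneg hp
  have := norm_list_prod_sub_le (suzuki p)
    (fun a => exp ((a.α * h) • P.gen k a.b (t + a.β * h)))
    (fun a => exp ((a.α * h) • P.gen k' a.b (t + a.β * h))) (B := 1)
    (δ := h * P.Gam 1 * |k - k'|) le_rfl
    (fun a _ => norm_exp_le_one_of_skew (P.stage_skew k a t h))
    (fun a _ => norm_exp_le_one_of_skew (P.stage_skew k' a t h)) ?_
  · simp only [one_pow, mul_one] at this
    exact this
  · intro a ha
    obtain ⟨h1, h2⟩ := suzuki_bounds p a ha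
    have hτ : t + a.β * h ∈ Icc 0 P.T := by
      have e1 : 0 ≤ a.β * h := mul_nonneg h2.1 hh
      have e2 : a.β * h ≤ h := mul_le_of_le_one_left hh h2.2
      constructor <;> linarith
    rcases a with ⟨_ | _, α, β⟩
    · simp only [gen, Bool.false_eq_true, if_false, sub_self, norm_zero]
      positivity
    · have e : ∀ k : ℝ, (α * h) • P.gen k true (t + β * h) =
          k • ((-(Complex.I * (α * h : ℝ))) • P.L (t + β * h)) := by
        intro k
        simp only [gen, if_true]
        rw [← Complex.coe_smul, ← Complex.coe_smul, smul_smul, smul_smul]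
        congr 1
        push_cast
        ring
      simp only [e]
      refine (norm_exp_smul_sub_le_of_skew (skew_of_isHermitian (P.isHermitian_L _) _) k k').trans ?_
      gcongr
      rw [norm_smul, norm_neg, norm_mul, Complex.norm_I, one_mul, Complex.norm_real,
        Real.norm_eq_abs, abs_mul, abs_of_nonneg hh]
      have hL := hP.norm_le_Gam hp hτ
      have hH := norm_nonneg (P.H (t + β * h))
      have h1' : |α| ≤ 1 := h1
      calc |α| * h * ‖P.L (t + β * h)‖ ≤ 1 * h * P.Gam 1 := by
            gcongr
            simp only at hL
            linarith
        _ = h * P.Gam 1 := by ring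

/-- The step lengths add up to at most `T`, so the Lipschitz constant does not involve `r`. This
keeps the number of steps and `Γ_p` out of the size of the `k`-grid. -/
lemma Admissible.norm_approxProp_real (hP : P.Admissible p) (hp : 1 ≤ p) (r : ℕ) {s : ℝ}
    (hs : s ∈ Icc 0 P.T) (k k' : ℝ) :
    ‖P.approxProp p r s k‖ ≤ 1 ∧ ‖P.approxProp p r s k - P.approxProp p r s k'‖ ≤
      (suzuki p).length * (P.T * P.Gam 1) * |k - k'| := by
  have hΓ := hP.Gam_nonneg hp
  unfold approxProp
  set h := (P.T - s) / r with hh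
  have hh0 : 0 ≤ h := div_nonneg (by linarith [hs.2]) (by positivity)
  have hrh : (r : ℝ) * h ≤ P.T - s := by
    rcases Nat.eq_zero_or_pos r with rfl | hr
    · simpa using hs.2
    · have : (0 : ℝ) < r := by exact_mod_cast hr
      rw [hh]
      apply le_of_eq
      field_simp
  have key : ∀ n ≤ r, ‖stepsProd (P.gen k) (suzuki p) s h n‖ ≤ 1 ∧
      ‖stepsProd (P.gen k) (suzuki p) s h n - stepsProd (P.gen k') (suzuki p) s h n‖ ≤
        n * ((suzuki p).length * (h * P.Gam 1 * |k - k'|)) := by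
    intro n
    induction n with
    | zero => intro _; simp [stepsProd]
    | succ n ih =>
      intro hn
      obtain ⟨i1, i2⟩ := ih (by omega)
      have h0 : 0 ≤ (n : ℝ) * h := by positivity
      have h1 : s + n * h + h ≤ P.T := by
        have : ((n + 1 : ℕ) : ℝ) * h ≤ r * h := by gcongr
        push_cast at this
        linarith
      obtain ⟨j1, j2⟩ := hP.norm_formulaStep_real hp k k' (by linarith [hs.1]) hh0 h1
      obtain ⟨j1', -⟩ := hP.norm_formulaStep_real hp k' k (by linarith [hs.1]) hh0 h1
      simp only [stepsProd]
      constructor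
      · exact (norm_mul_le _ _).trans (mul_le_one₀ j1 (norm_nonneg _) i1)
      · set S := stepsProd (P.gen k) (suzuki p) s h n
        set S' := stepsProd (P.gen k') (suzuki p) s h n
        set F := formulaStep (P.gen k) (suzuki p) (s + n * h) h
        set F' := formulaStep (P.gen k') (suzuki p) (s + n * h) h
        have e : F * S - F' * S' = (F - F') * S + F' * (S - S') := by noncomm_ring
        rw [e]
        calc _ ≤ ‖F - F'‖ * ‖S‖ + ‖F'‖ * ‖S - S'‖ :=
              (norm_add_le _ _).trans (add_le_add (norm_mul_le _ _) (norm_mul_le _ _))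
          _ ≤ (suzuki p).length * (h * P.Gam 1 * |k - k'|) * 1 +
              1 * (n * ((suzuki p).length * (h * P.Gam 1 * |k - k'|))) := by gcongr
          _ = _ := by push_cast; ring
  obtain ⟨k1, k2⟩ := key r le_rfl
  refine ⟨k1, k2.trans ?_⟩
  have : (r : ℝ) * h ≤ P.T := by linarith [hs.1]
  calc (r : ℝ) * ((suzuki p).length * (h * P.Gam 1 * |k - k'|)) =
      (suzuki p).length * (r * h * P.Gam 1) * |k - k'| := by ring
    _ ≤ _ := by gcongr

/-- The number of steps of the product formula is large enough for the truncation parameter `K`: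
either the generators are negligible or the step size resolves them. -/
def StepsSuffice (P : ODEData N) (p : ℕ) (C K : ℝ) (r : ℕ) : Prop :=
  (r = 0 ∧ K * P.Gam p * P.T ≤ 1) ∨
    (1 < K * P.Gam p * P.T ∧ C * (K * P.Gam p * P.T) ^ (1 + 1 / (p : ℝ)) ≤ r)

end ODEData

open ODEData

/-- Boundedness of the product formula on the contour and accuracy at `z = -i`. -/
theorem exists_approxProp_bounds (p : ℕ) (hp : 1 ≤ p) : ∃ C : ℝ, 1 ≤ C ∧ ∀ (N : ℕ) [NeZero N]
    (P : ODEData N), P.Admissible p → ∀ (K : ℝ) (r : ℕ), 2 ≤ K → P.StepsSuffice p C K r →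
    ∀ s ∈ Icc 0 P.T,
      (∀ z : ℂ, z.re ∈ Icc (-K) K → z.im ∈ Icc (-K) 0 → ‖P.approxProp p r s z‖ ≤ 3) ∧
      ∀ V W, P.Propagator (-Complex.I) V W →
        ‖P.approxProp p r s (-Complex.I) - V P.T * W s‖ ≤ 2 / K := by
  obtain ⟨C, hC0, hC⟩ := exists_stepsProd_error p hp
  -- The entry `2` gives `2 x ≤ r`, so that a step resolves generators of scale `2 K Γ_p`; the other
  -- entry absorbs `C` and the powers of `2` coming from `|z| ≤ 2 K`.
  set D : ℝ := max 2 (C * 2 ^ (p + 1)) with hD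
  have hD2 : 2 ≤ D := le_max_left _ _
  refine ⟨D, by linarith, fun N _ P hP K r hK hr s hs => ?_⟩
  have hK0 : 0 < K := by linarith
  rcases hr with ⟨rfl, hKΓ⟩ | ⟨hKΓ, hr⟩
  · have e : ∀ z, P.approxProp p 0 s z = 1 := fun z => rfl
    refine ⟨fun z _ _ => by rw [e, norm_one]; norm_num, fun V W hVW => ?_⟩
    rw [e]
    -- the propagator stays close to the identity
    have hb := norm_image_sub_le_of_norm_deriv_le_segment'
      (f := fun t => V t * W s) (a := s) (b := P.T) (C := P.Gam p)
      (fun x hx => hVW.hasDerivWithinAt_sub s hs.1 le_rfl hx) (fun x hx => ?_) P.T ⟨hs.2, le_rfl⟩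
    · simp only [hVW.mul_inv] at hb
      rw [norm_sub_rev]
      refine hb.trans ?_
      rw [le_div_iff₀ hK0]
      have := hP.Gam_nonneg le_rfl
      calc P.Gam p * (P.T - s) * K ≤ P.Gam p * P.T * K := by gcongr; linarith [hs.1]
        _ = K * P.Gam p * P.T := by ring
        _ ≤ 2 := by linarith
    · have hx' : x ∈ Icc 0 P.T := ⟨hs.1.trans hx.1, hx.2.le⟩
      have h1 := hP.norm_gen_le le_rfl (z := -Complex.I) (κ := 1) le_rfl (by simp) hx'
      have h2 := hVW.norm_le_one hP (by simp) hs.1 hx.1 hx.2.le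
      rw [one_mul] at h1
      exact (norm_mul_le _ _).trans (by
        calc _ ≤ P.Gam p * 1 := by gcongr; exact hP.Gam_nonneg le_rfl
          _ = _ := mul_one _)
  · set x := K * P.Gam p * P.T with hx
    have hx0 : 0 < x := by linarith
    have hT := hP.T_pos
    have hΓ : 0 < P.Gam p := by
      refine lt_of_le_of_ne (hP.Gam_nonneg le_rfl) fun h => ?_
      rw [hx, ← h] at hKΓ
      norm_num at hKΓ
    have hp0 : (0 : ℝ) < p := by exact_mod_cast hp
    have hxr : x ≤ x ^ (1 + 1 / (p : ℝ)) := by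
      conv_lhs => rw [← Real.rpow_one x]
      exact Real.rpow_le_rpow_of_exponent_le hKΓ.le (by linarith [one_div_pos.2 hp0])
    have hr2 : 2 * x ≤ r := by
      calc 2 * x ≤ D * x ^ (1 + 1 / (p : ℝ)) := by gcongr
        _ ≤ r := hr
    have hr0' : (0 : ℝ) < r := by linarith
    have hr0 : 0 < r := by exact_mod_cast hr0'
    have hrp : x ^ (p + 1) * D ^ p ≤ (r : ℝ) ^ p := by
      have h1 : (D * x ^ (1 + 1 / (p : ℝ))) ^ p ≤ (r : ℝ) ^ p := pow_le_pow_left₀ (by positivity) hr p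
      rw [mul_pow, ← Real.rpow_natCast (x ^ (1 + 1 / (p : ℝ))), ← Real.rpow_mul hx0.le,
        show (1 + 1 / (p : ℝ)) * (p : ℝ) = ((p + 1 : ℕ) : ℝ) by push_cast; field_simp,
        Real.rpow_natCast] at h1
      linarith
    have hDp : C * 2 ^ (p + 1) ≤ D ^ p :=
      (le_max_right _ _).trans (le_self_pow₀ (by linarith) (by omega))
    -- An accumulated error of order one is all that the rectangle requires, which is why `r` of
    -- order `x ^ (1 + 1 / p)` suffices.
    have hmain : r * (C * (2 * x / r) ^ (p + 1)) ≤ 1 := by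
      have e : r * (C * (2 * x / r) ^ (p + 1)) = C * 2 ^ (p + 1) * x ^ (p + 1) / r ^ p := by
        rw [div_pow, mul_pow]
        field_simp
        ring
      rw [e, div_le_one (by positivity)]
      calc C * 2 ^ (p + 1) * x ^ (p + 1) ≤ D ^ p * x ^ (p + 1) := by gcongr
        _ ≤ _ := by linarith
    constructor
    · intro z hzr hzi
      obtain ⟨V, W, hVW⟩ := hP.exists_propagator z
      have hz : ‖z‖ ≤ 2 * K := by
        refine (Complex.norm_le_abs_re_add_abs_im z).trans ?_
        have h1 : |z.re| ≤ K := abs_le.2 hzr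
        have h2 : |z.im| ≤ K := abs_le.2 ⟨hzi.1, hzi.2.trans hK0.le⟩
        linarith
      have e1 : 2 * K * P.Gam p * P.T = 2 * x := by rw [hx]; ring
      have := hC N P hP hΓ z (2 * K) (by linarith) hz hzi.2 V W hVW s hs r hr0 (by rw [e1]; exact hr2)
        _ (by rw [e1]) hmain
      have h2 := hVW.norm_le_one hP hzi.2 hs.1 hs.2 le_rfl
      have h3 := norm_add_le (P.approxProp p r s z - V P.T * W s) (V P.T * W s)
      rw [sub_add_cancel] at h3
      have h4 : ‖P.approxProp p r s z - V P.T * W s‖ ≤ 2 * 1 := this.trans (by gcongr)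
      linarith
    · intro V W hVW
      have hyx : P.Gam p * P.T = x / K := by
        rw [hx]
        field_simp
      -- At `-i` the scale is `Γ_p` in place of `2 K Γ_p`. This would gain `K ^ (p + 1)`; one factor
      -- `K` is all that is kept.
      have hδ : C * (1 * P.Gam p * P.T / r) ^ (p + 1) ≤ C * (2 * x / r) ^ (p + 1) / K := by
        rw [one_mul, hyx, mul_div_assoc C]
        refine mul_le_mul_of_nonneg_left ?_ hC0
        have : (x / K / r) ^ (p + 1) = (x / r) ^ (p + 1) / K ^ (p + 1) := by
          rw [← div_pow]; congr 1; field_simp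
        rw [this]
        have h1 : K ≤ K ^ (p + 1) := le_self_pow₀ (by linarith) (by omega)
        have h2 : (x / r) ^ (p + 1) ≤ (2 * x / r) ^ (p + 1) := by
          gcongr
          linarith
        gcongr
      have hle : r * (C * (2 * x / r) ^ (p + 1) / K) ≤ 1 / K := by
        rw [← mul_div_assoc]
        gcongr
      have hK1 : 1 / K ≤ 1 := by
        rw [div_le_one hK0]; linarith
      have hxr1 : 1 * P.Gam p * P.T ≤ r := by
        rw [one_mul, hyx]
        have : x / K ≤ x := div_le_self hx0.le (by linarith)
        linarith
      have := hC N P hP hΓ (-Complex.I) 1 le_rfl (by simp) (by simp) V W hVW s hs r hr0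
        hxr1 _ hδ (hle.trans hK1)
      refine this.trans ?_
      calc 2 * (r * (C * (2 * x / r) ^ (p + 1) / K)) ≤ 2 * (1 / K) := by gcongr
        _ = 2 / K := by ring

/-! ### Quadrature for the Cauchy distribution -/

lemma abs_cauchy_sub_le (k k' : ℝ) :
    |1 / (Real.pi * (1 + k ^ 2)) - 1 / (Real.pi * (1 + k' ^ 2))| ≤ |k - k'| := by
  have hpi := Real.pi_gt_three
  have h1 : 0 < Real.pi * (1 + k ^ 2) := by positivity
  have h2 : 0 < Real.pi * (1 + k' ^ 2) := by positivity
  rw [div_sub_div _ _ h1.ne' h2.ne', abs_div, abs_of_pos (mul_pos h1 h2), div_le_iff₀ (mul_pos h1 h2)]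
  have e : 1 * (Real.pi * (1 + k' ^ 2)) - Real.pi * (1 + k ^ 2) * 1 =
      Real.pi * ((k' + k) * (k' - k)) := by ring
  rw [e, abs_mul, abs_mul, abs_of_pos Real.pi_pos, abs_sub_comm k' k]
  have h3 : |k' + k| ≤ (1 + k ^ 2) * (1 + k' ^ 2) := by
    rw [abs_le]
    constructor <;> nlinarith [sq_nonneg (k + 1), sq_nonneg (k - 1), sq_nonneg (k' + 1),
      sq_nonneg (k' - 1), mul_nonneg (sq_nonneg k) (sq_nonneg k')]
  have h4 : 1 ≤ Real.pi := by linarith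
  have h5 := abs_nonneg (k - k')
  calc Real.pi * (|k' + k| * |k - k'|) ≤
      Real.pi * (((1 + k ^ 2) * (1 + k' ^ 2)) * |k - k'|) := by gcongr
    _ ≤ Real.pi * (Real.pi * (((1 + k ^ 2) * (1 + k' ^ 2)) * |k - k'|)) := by
        refine mul_le_mul_of_nonneg_left ?_ Real.pi_pos.le
        exact le_mul_of_one_le_left (by positivity) h4
    _ = _ := by ring

lemma cauchy_le_one (k : ℝ) : |1 / (Real.pi * (1 + k ^ 2))| ≤ 1 := by
  have hpi := Real.pi_gt_three
  rw [abs_of_pos (by positivity), div_le_one (by positivity)]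
  nlinarith [sq_nonneg k, mul_nonneg (by linarith : (0 : ℝ) ≤ Real.pi) (sq_nonneg k)]

lemma cCoef_nonneg {K : ℝ} (hK : 0 ≤ K) {m : ℕ} (hm : 0 < m) (j : ℕ) : 0 ≤ cCoef K m j := by
  have := one_le_gridM hm
  have h : 0 ≤ endFactor m j := by unfold endFactor; split_ifs <;> norm_num
  unfold cCoef
  have := Real.pi_pos
  positivity

/-- The discretized average of a function that is holomorphic in the lower half plane. -/
theorem norm_sum_cCoef_sub_le {E : Type*} [NormedAddCommGroup E] [NormedSpace ℂ E]
    [CompleteSpace E] {f : ℂ → E} (hf : Differentiable ℂ f) {K Λ : ℝ} (hK : 2 ≤ K)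
    (hb : ∀ z : ℂ, z.re ∈ Icc (-K) K → z.im ∈ Icc (-K) 0 → ‖f z‖ ≤ 3)
    (hreal : ∀ k k' : ℝ, ‖f k‖ ≤ 1 ∧ ‖f k - f k'‖ ≤ Λ * |k - k'|) {m : ℕ} (hm : 0 < m) :
    ‖∑ x : Bits (Fin m), cCoef K m (val x) • f (kNode K m (val x)) - f (-Complex.I)‖ ≤
      15 / K + 4 * K ^ 2 * (1 + Λ) / gridM m := by
  have hM := one_le_gridM hm
  set g : ℝ → E := fun k => (1 / (Real.pi * (1 + k ^ 2)) : ℝ) • f k with hg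
  have hlip : ∀ k ∈ Icc (-K) K, ∀ k' ∈ Icc (-K) K, ‖g k - g k'‖ ≤ (1 + Λ) * |k - k'| := by
    intro k _ k' _
    have e : g k - g k' = (1 / (Real.pi * (1 + k ^ 2)) - 1 / (Real.pi * (1 + k' ^ 2)) : ℝ) • f k +
        (1 / (Real.pi * (1 + k' ^ 2)) : ℝ) • (f k - f k') := by
      simp only [hg]
      module
    rw [e]
    refine (norm_add_le _ _).trans ?_
    rw [norm_smul, norm_smul, Real.norm_eq_abs, Real.norm_eq_abs]
    obtain ⟨h1, h2⟩ := hreal k k'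
    have h3 := (norm_nonneg _).trans h2
    calc _ ≤ |k - k'| * 1 + 1 * (Λ * |k - k'|) :=
          add_le_add (mul_le_mul (abs_cauchy_sub_le k k') h1 (norm_nonneg _) (abs_nonneg _))
            (mul_le_mul (cauchy_le_one k') h2 (norm_nonneg _) zero_le_one)
      _ = _ := by ring
  have htrap := norm_trapezoid_sub_le (f := g) (a := -K) (b := K) (by linarith) hlip hm
  have hsum : ∑ x : Bits (Fin m), cCoef K m (val x) • f (kNode K m (val x)) =
      ∑ j ∈ Finset.range (2 ^ m), (endFactor m j * ((K - -K) / (2 * gridM m))) •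
        g (-K + j * ((K - -K) / gridM m)) := by
    rw [sum_bits m fun j => cCoef K m j • f (kNode K m j)]
    refine Finset.sum_congr rfl fun j _ => ?_
    have e : -K + j * ((K - -K) / gridM m) = kNode K m j := by
      unfold kNode
      field_simp
      ring
    rw [e, hg]
    simp only
    rw [smul_smul]
    congr 1
    unfold cCoef
    field_simp
    ring
  have hc := norm_cauchy_average_sub_le hf hK hb
  rw [hsum]
  set S := ∑ j ∈ Finset.range (2 ^ m), (endFactor m j * ((K - -K) / (2 * gridM m))) •
        g (-K + j * ((K - -K) / gridM m))
  have e : S - f (-Complex.I) = (S - ∫ k in (-K)..K, g k) + ((∫ k in (-K)..K, g k) - f (-Complex.I)) := by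
    abel
  rw [e]
  refine (norm_add_le _ _).trans ?_
  have e1 : (K - -K) * ((1 + Λ) * ((K - -K) / gridM m)) = 4 * K ^ 2 * (1 + Λ) / gridM m := by
    field_simp
    ring
  rw [e1] at htrap
  have e2 : 5 * 3 / K = 15 / K := by norm_num
  rw [e2] at hc
  linarith

/-! ### The linear combination of Hamiltonian simulations -/

namespace ODEData

variable {N : ℕ} [NeZero N] {P : ODEData N} {p : ℕ}

lemma Admissible.norm_le_bC2 (hP : P.Admissible p) {τ : ℝ} (hτ : τ ∈ Icc 0 P.T) :
    ‖P.b τ‖ + ‖iteratedDerivWithin 1 P.b (Icc 0 P.T) τ‖ ≤ P.bC2 := by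
  have hud := uniqueDiffOn_Icc hP.T_pos
  have hle : ∀ q ≤ 2, ‖iteratedDerivWithin q P.b (Icc 0 P.T) τ‖ ≤
      supNorm P.T (iteratedDerivWithin q P.b (Icc 0 P.T)) := by
    intro q hq
    have hc := hP.smooth_b.continuousOn_iteratedDerivWithin (m := q) (by exact_mod_cast hq) hud
    exact le_csSup (isCompact_Icc.image_of_continuousOn hc.norm).bddAbove ⟨τ, hτ, rfl⟩
  have h0 := hle 0 (by norm_num)
  have h1 := hle 1 (by norm_num)
  have h2 := (norm_nonneg _).trans (hle 2 le_rfl)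
  rw [bC2, Finset.sum_range_succ, Finset.sum_range_succ, Finset.sum_range_succ, Finset.sum_range_zero]
  simp only [iteratedDerivWithin_zero] at h0 ⊢
  linarith

lemma Admissible.bC2_nonneg (hP : P.Admissible p) : 0 ≤ P.bC2 :=
  le_trans (by positivity) (hP.norm_le_bC2 (left_mem_Icc.2 hP.T_pos.le))

lemma Admissible.hasDerivWithinAt_b (hP : P.Admissible p) {τ : ℝ} (hτ : τ ∈ Icc 0 P.T) :
    HasDerivWithinAt P.b (iteratedDerivWithin 1 P.b (Icc 0 P.T) τ) (Icc 0 P.T) τ := by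
  rw [iteratedDerivWithin_one]
  exact (hP.smooth_b.differentiableOn (by norm_num) τ hτ).hasDerivWithinAt

/-- **Duhamel's formula.** -/
theorem Admissible.duhamel (hP : P.Admissible p) {u : ℝ → EuclideanSpace ℂ (Fin N)}
    (hu : P.IsSolution u) {V W : ℝ → Matrix (Fin N) (Fin N) ℂ}
    (h : P.Propagator (-Complex.I) V W) :
    u P.T = opOf (V P.T * W 0) P.u₀ + ∫ s in (0 : ℝ)..P.T, opOf (V P.T * W s) (P.b s) := by
  have hT := hP.T_pos.le
  -- Transporting `u t` to the final time cancels the terms with `A` and leaves the source.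
  have hd : ∀ t ∈ Icc 0 P.T, HasDerivWithinAt (fun t => opOf (V P.T * W t) (u t))
      (opOf (V P.T * W t) (P.b t)) (Icc 0 P.T) t := by
    intro t ht
    have h1 := (h.deriv_inv t ht).const_mul (V P.T)
    have h2 := ((opBilin N).hasFDerivAt.comp_hasDerivWithinAt t h1).clm_apply (hu.deriv t ht)
    refine h2.congr_deriv ?_
    simp only [opBilin_apply, Function.comp_apply, P.gen_neg_I t, mul_neg, neg_neg, map_add,
      map_neg, ← mul_assoc, opOf_mul_apply _ (P.A t)]
    abel
  have hWc : ContinuousOn W (Icc 0 P.T) := fun t ht => (h.deriv_inv t ht).continuousWithinAt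
  have hint : ContinuousOn (fun s => opOf (V P.T * W s) (P.b s)) (Icc 0 P.T) := by
    have h1 : ContinuousOn (fun s => opBilin N (V P.T * W s)) (Icc 0 P.T) :=
      (opBilin N).continuous.comp_continuousOn (continuousOn_const.mul hWc)
    exact h1.clm_apply hP.smooth_b.continuousOn
  have := intervalIntegral.integral_eq_sub_of_hasDeriv_right_of_le hT
    (fun t ht => (hd t ht).continuousWithinAt)
    (fun t ht => ((hd t (Ioo_subset_Icc_self ht)).mono_of_mem_nhdsWithin
      (Icc_mem_nhdsGT_of_mem ⟨ht.1.le, ht.2⟩)))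
    ((hint.mono (by rw [uIcc_of_le hT])).intervalIntegrable)
  rw [this, hu.initial, h.mul_inv]
  simp [opOf]

/-- Duhamel's formula with contractive propagators. It yields `q ≥ 1`, on which the parameter
choices and the cost bounds rely. -/
theorem Admissible.norm_solution_le (hP : P.Admissible p) {u : ℝ → EuclideanSpace ℂ (Fin N)}
    (hu : P.IsSolution u) : ‖u P.T‖ ≤ ‖P.u₀‖ + P.bL1 := by
  obtain ⟨V, W, h⟩ := hP.exists_propagator (-Complex.I)
  have hT := hP.T_pos.le
  have hb : ∀ s ∈ Icc 0 P.T, ∀ x, ‖opOf (V P.T * W s) x‖ ≤ ‖x‖ := fun s hs x => by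
    refine (norm_opOf_le _ _).trans (mul_le_of_le_one_left (norm_nonneg _) ?_)
    exact h.norm_le_one hP (by simp) hs.1 hs.2 le_rfl
  rw [hP.duhamel hu h]
  refine (norm_add_le _ _).trans (add_le_add (hb 0 (left_mem_Icc.2 hT) _) ?_)
  refine intervalIntegral.norm_integral_le_of_norm_le hT ?_ ?_
  · exact Filter.Eventually.of_forall fun s hs => hb s (Ioc_subset_Icc_self hs) _
  · exact (hP.smooth_b.continuousOn.norm.mono (by rw [uIcc_of_le hT])).intervalIntegrable

variable (P)

/-- The weights of the trapezoidal rule on `[0, T]`. -/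
def tWeight (mt j' : ℕ) : ℝ := endFactor mt j' * P.T / (2 * gridM mt)

/-- The linear combination of product formulas applied to the initial state and to the source. -/
def lchsVector (p r : ℕ) (K : ℝ) (m mt : ℕ) : EuclideanSpace ℂ (Fin N) :=
  (∑ x : Bits (Fin m), cCoef K m (val x) • opOf (P.approxProp p r 0 (kNode K m (val x))) P.u₀) +
  ∑ x' : Bits (Fin mt), ∑ x : Bits (Fin m), (P.tWeight mt (val x') * cCoef K m (val x)) •
    opOf (P.approxProp p r (tNode P.T mt (val x')) (kNode K m (val x))) (P.b (tNode P.T mt (val x')))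

variable {P}

omit [NeZero N] in
lemma Admissible.tNode_mem (hP : P.Admissible p) {mt : ℕ} (hmt : 0 < mt) (x : Bits (Fin mt)) :
    tNode P.T mt (val x) ∈ Icc 0 P.T := by
  have hT := hP.T_pos
  have hM := one_le_gridM hmt
  have hx : (val x : ℝ) ≤ gridM mt := by
    rw [gridM_eq]
    have : val x < 2 ^ mt := (finFunctionFinEquiv x).2
    exact_mod_cast Nat.le_sub_one_of_lt this
  unfold tNode
  constructor
  · positivity
  · rw [div_le_iff₀ (by linarith), mul_comm P.T]
    gcongr

lemma Admissible.tWeight_nonneg (hP : P.Admissible p) {mt : ℕ} (hmt : 0 < mt) (j : ℕ) :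
    0 ≤ P.tWeight mt j := by
  have := one_le_gridM hmt
  have := hP.T_pos
  have h : 0 ≤ endFactor mt j := by unfold endFactor; split_ifs <;> norm_num
  unfold tWeight
  positivity

lemma Admissible.norm_time_quadrature_le (hP : P.Admissible p) {E : Type*} [NormedAddCommGroup E]
    [NormedSpace ℝ E] [CompleteSpace E] {mt : ℕ} (hmt : 0 < mt) {f : ℝ → E} {Λ : ℝ}
    (hf : ∀ x ∈ Icc 0 P.T, ∀ y ∈ Icc 0 P.T, ‖f x - f y‖ ≤ Λ * |x - y|) :
    ‖∑ x' : Bits (Fin mt), P.tWeight mt (val x') • f (tNode P.T mt (val x')) -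
      ∫ s in (0 : ℝ)..P.T, f s‖ ≤ P.T ^ 2 * Λ / gridM mt := by
  have hM := one_le_gridM hmt
  have := norm_trapezoid_sub_le hP.T_pos.le hf hmt
  rw [sum_bits mt fun j => P.tWeight mt j • f (tNode P.T mt j)]
  have e : ∀ j ∈ Finset.range (2 ^ mt), P.tWeight mt j • f (tNode P.T mt j) =
      (endFactor mt j * ((P.T - 0) / (2 * gridM mt))) • f (0 + j * ((P.T - 0) / gridM mt)) := by
    intro j _
    unfold tWeight tNode
    congr 1
    · ring
    · congr 1; ring
  rw [Finset.sum_congr rfl e]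
  refine this.trans (le_of_eq ?_)
  rw [sub_zero]
  field_simp

/-- Discretization error of the `L¹` norm of the source. -/
lemma Admissible.abs_sum_norm_b_sub_le (hP : P.Admissible p) {mt : ℕ} (hmt : 0 < mt) :
    |∑ x' : Bits (Fin mt), P.tWeight mt (val x') * ‖P.b (tNode P.T mt (val x'))‖ - P.bL1| ≤
      P.T ^ 2 * P.bC2 / gridM mt := by
  refine hP.norm_time_quadrature_le hmt (f := fun s => ‖P.b s‖) fun x hx y hy => ?_
  refine (abs_norm_sub_norm_le _ _).trans ?_
  refine Convex.norm_image_sub_le_of_norm_hasDerivWithin_le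
    (fun t ht => hP.hasDerivWithinAt_b ht) (fun t ht => ?_) (convex_Icc _ _) hy hx
  have := hP.norm_le_bC2 ht
  linarith [norm_nonneg (P.b t)]

end ODEData

/-- `C` is a constant for the accuracy of the linear combination of product formulas of order
`p`: the discretized `k`-integral contributes the relative error `e₁`, the discretized time integral
the error `e₂`. -/
def LCHSErrorConstant (p : ℕ) (C : ℝ) : Prop := ∀ (N : ℕ) [NeZero N]
    (P : ODEData N) (u : ℝ → EuclideanSpace ℂ (Fin N)), P.Admissible p → P.IsSolution u →
    ∀ (K : ℝ) (r m mt : ℕ), 2 ≤ K → P.StepsSuffice p C K r → 0 < m → 0 < mt →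
    ∀ e₁ e₂ : ℝ, C / K + C * K ^ 2 * (1 + P.T * P.Gam 1) / gridM m ≤ e₁ →
      P.T ^ 2 * ((1 + P.Gam 1) * P.bC2) / gridM mt ≤ e₂ →
      |∑ x : Bits (Fin m), cCoef K m (val x) - 1| ≤ e₁ ∧
      |∑ x' : Bits (Fin mt), P.tWeight mt (val x') * ‖P.b (tNode P.T mt (val x'))‖ - P.bL1| ≤ e₂ ∧
      ‖P.lchsVector p r K m mt - u P.T‖ ≤ e₁ * (‖P.u₀‖ + P.bL1 + e₂) + e₂

/-- The error of the fully discretized linear combination of Hamiltonian simulations. -/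
theorem exists_lchsVector_error (p : ℕ) (hp : 1 ≤ p) :
    ∃ C : ℝ, 1 ≤ C ∧ LCHSErrorConstant p C := by
  obtain ⟨C₀, hC₀, hC⟩ := exists_approxProp_bounds p hp
  set n := (suzuki p).length with hn
  -- `17 = 15 + 2` collects the truncation error and the error of the product formula at `-i`; the
  -- rest dominates the quadrature error with Lipschitz constant `1 + n T Γ_1`.
  refine ⟨max C₀ (17 + 4 * (1 + n)), hC₀.trans (le_max_left _ _), ?_⟩
  intro N _ P u hP hu K r m mt hK hr hm hmt e₁ e₂ he₁ he₂
  set C := max C₀ (17 + 4 * (1 + (n : ℝ))) with hCdef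
  have hK0 : 0 < K := by linarith
  have hM := one_le_gridM hm
  have hMt := one_le_gridM hmt
  have hT := hP.T_pos
  have hΓ := hP.Gam_nonneg hp
  have hB := hP.bC2_nonneg
  have hr' : P.StepsSuffice p C₀ K r := by
    rcases hr with h | ⟨h1, h2⟩
    · exact Or.inl h
    · refine Or.inr ⟨h1, le_trans ?_ h2⟩
      have : 0 ≤ K * P.Gam p * P.T := by linarith
      gcongr
      exact le_max_left _ _
  have hC17 : 17 + 4 * (1 + (n : ℝ)) ≤ C := le_max_right _ _
  have hn0 : (0 : ℝ) ≤ n := Nat.cast_nonneg _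
  have hTΓ : 0 ≤ P.T * P.Gam 1 := by positivity
  have hquad : 4 * K ^ 2 * (1 + n * (P.T * P.Gam 1)) / gridM m ≤
      C * K ^ 2 * (1 + P.T * P.Gam 1) / gridM m := by
    have : 4 * (1 + n * (P.T * P.Gam 1)) ≤ C * (1 + P.T * P.Gam 1) := by nlinarith
    have h2 : 4 * K ^ 2 * (1 + n * (P.T * P.Gam 1)) ≤ C * K ^ 2 * (1 + P.T * P.Gam 1) := by
      nlinarith [sq_nonneg K]
    gcongr
  have h17 : 17 / K ≤ C / K := by
    gcongr
    linarith
  have hk1 : 15 / K + 2 / K = 17 / K := by ring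
  have h2K : 0 < 2 / K := by positivity
  obtain ⟨V, W, hVW⟩ := hP.exists_propagator (-Complex.I)
  -- The estimate for the discretized average, applied to the constant function one.
  have hcsum : |∑ x : Bits (Fin m), cCoef K m (val x) - 1| ≤ e₁ := by
    have := norm_sum_cCoef_sub_le (f := fun _ => (1 : ℂ)) (differentiable_const _) (Λ := 0) hK
      (fun _ _ _ => by norm_num) (fun _ _ => by simp) hm
    have e : ∑ x : Bits (Fin m), cCoef K m (val x) • (1 : ℂ) - 1 =
        ((∑ x : Bits (Fin m), cCoef K m (val x) - 1 : ℝ) : ℂ) := by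
      push_cast
      simp [Complex.real_smul]
    rw [e, Complex.norm_real, Real.norm_eq_abs] at this
    refine this.trans (le_trans ?_ he₁)
    have h3 : 4 * K ^ 2 * (1 + 0) / gridM m ≤ 4 * K ^ 2 * (1 + n * (P.T * P.Gam 1)) / gridM m := by
      gcongr
      positivity
    linarith
  have hb1 : P.T ^ 2 * P.bC2 / gridM mt ≤ e₂ := by
    refine le_trans ?_ he₂
    gcongr
    exact le_mul_of_one_le_left hB (by linarith)
  have hbsum := (hP.abs_sum_norm_b_sub_le hmt).trans hb1
  refine ⟨hcsum, hbsum, ?_⟩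
  -- the averages of the product formulas approximate the propagator
  have hprop : ∀ s ∈ Icc 0 P.T, ‖∑ x : Bits (Fin m), cCoef K m (val x) •
      P.approxProp p r s (kNode K m (val x)) - V P.T * W s‖ ≤ e₁ := by
    intro s hs
    obtain ⟨h1, h2⟩ := hC N P hP K r hK hr' s hs
    have h3 := norm_sum_cCoef_sub_le (P.differentiable_approxProp p r s) hK h1
      (fun k k' => hP.norm_approxProp_real hp r hs k k') hm
    have h4 := h2 V W hVW
    set S := ∑ x : Bits (Fin m), cCoef K m (val x) • P.approxProp p r s (kNode K m (val x))
    have e : S - V P.T * W s = (S - P.approxProp p r s (-Complex.I)) +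
        (P.approxProp p r s (-Complex.I) - V P.T * W s) := by abel
    rw [e]
    refine (norm_add_le _ _).trans (le_trans ?_ he₁)
    linarith
  have happly : ∀ s ∈ Icc 0 P.T, ∀ y, ‖∑ x : Bits (Fin m), cCoef K m (val x) •
      opOf (P.approxProp p r s (kNode K m (val x))) y - opOf (V P.T * W s) y‖ ≤ e₁ * ‖y‖ := by
    intro s hs y
    have e : ∑ x : Bits (Fin m), cCoef K m (val x) •
      opOf (P.approxProp p r s (kNode K m (val x))) y - opOf (V P.T * W s) y =
        opOf (∑ x : Bits (Fin m), cCoef K m (val x) •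
          P.approxProp p r s (kNode K m (val x)) - V P.T * W s) y := by
      simp only [← opBilin_apply, map_sub, map_sum, map_smul, sub_apply,
        sum_apply, smul_apply]
    rw [e]
    exact (norm_opOf_le _ _).trans (by gcongr; exact hprop s hs)
  set F : ℝ → EuclideanSpace ℂ (Fin N) := fun s => opOf (V P.T * W s) (P.b s) with hF
  -- The derivative of the Duhamel integrand is `U (b' - G b)` with a contraction `U` and `‖G‖ ≤
  -- Γ_1`.
  have hFlip : ∀ x ∈ Icc 0 P.T, ∀ y ∈ Icc 0 P.T, ‖F x - F y‖ ≤ ((1 + P.Gam 1) * P.bC2) * |x - y| := by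
    intro x hx y hy
    have hd : ∀ t ∈ Icc 0 P.T, HasDerivWithinAt F
        (-opOf (V P.T * W t) (opOf (P.gen (-Complex.I) true t + P.gen (-Complex.I) false t) (P.b t)) +
          opOf (V P.T * W t) (iteratedDerivWithin 1 P.b (Icc 0 P.T) t)) (Icc 0 P.T) t := by
      intro t ht
      have h1 := (hVW.deriv_inv t ht).const_mul (V P.T)
      have h2 := ((opBilin N).hasFDerivAt.comp_hasDerivWithinAt t h1).clm_apply
        (hP.hasDerivWithinAt_b ht)
      refine h2.congr_deriv ?_
      simp only [opBilin_apply]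
      rw [mul_neg, ← mul_assoc, opOf, map_neg, neg_apply, ← opOf, opOf_mul_apply]
      rfl
    refine Convex.norm_image_sub_le_of_norm_hasDerivWithin_le hd (fun t ht => ?_) (convex_Icc _ _)
      hy hx
    have hU := hVW.norm_le_one hP (by simp) ht.1 ht.2 le_rfl
    have hU' : ∀ x, ‖opOf (V P.T * W t) x‖ ≤ ‖x‖ := fun x =>
      (norm_opOf_le _ _).trans (mul_le_of_le_one_left (norm_nonneg _) hU)
    have hG := hP.norm_gen_le hp (z := -Complex.I) (κ := 1) le_rfl (by simp) ht
    rw [one_mul] at hG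
    have hbt := hP.norm_le_bC2 ht
    have n0 := norm_nonneg (P.b t)
    have n1 := norm_nonneg (iteratedDerivWithin 1 P.b (Icc 0 P.T) t)
    calc _ ≤ ‖opOf (P.gen (-Complex.I) true t + P.gen (-Complex.I) false t) (P.b t)‖ +
          ‖iteratedDerivWithin 1 P.b (Icc 0 P.T) t‖ := by
          refine (norm_add_le _ _).trans ?_
          rw [norm_neg]
          exact add_le_add (hU' _) (hU' _)
      _ ≤ P.Gam 1 * ‖P.b t‖ + ‖iteratedDerivWithin 1 P.b (Icc 0 P.T) t‖ := by
          gcongr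
          exact (norm_opOf_le _ _).trans (by gcongr)
      _ ≤ _ := by nlinarith
  have hquadT := (hP.norm_time_quadrature_le hmt hFlip).trans he₂
  have he₁0 : 0 ≤ e₁ := (abs_nonneg _).trans hcsum
  rw [hP.duhamel hu hVW, lchsVector]
  have e2 : ∀ x' : Bits (Fin mt), ∑ x : Bits (Fin m), (P.tWeight mt (val x') * cCoef K m (val x)) •
      opOf (P.approxProp p r (tNode P.T mt (val x')) (kNode K m (val x)))
        (P.b (tNode P.T mt (val x'))) = P.tWeight mt (val x') • ∑ x : Bits (Fin m),
          cCoef K m (val x) • opOf (P.approxProp p r (tNode P.T mt (val x')) (kNode K m (val x)))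
        (P.b (tNode P.T mt (val x'))) := by
    intro x'
    rw [Finset.smul_sum]
    exact Finset.sum_congr rfl fun x _ => mul_smul _ _ _
  simp only [e2]
  set S₀ := ∑ x : Bits (Fin m), cCoef K m (val x) • opOf (P.approxProp p r 0 (kNode K m (val x))) P.u₀
  set S : Bits (Fin mt) → EuclideanSpace ℂ (Fin N) := fun x' => ∑ x : Bits (Fin m),
          cCoef K m (val x) • opOf (P.approxProp p r (tNode P.T mt (val x')) (kNode K m (val x)))
        (P.b (tNode P.T mt (val x'))) with hS
  have h0 : ‖S₀ - opOf (V P.T * W 0) P.u₀‖ ≤ e₁ * ‖P.u₀‖ :=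
    happly 0 (left_mem_Icc.2 hT.le) _
  have h1 : ‖∑ x' : Bits (Fin mt), P.tWeight mt (val x') • S x' -
      ∑ x' : Bits (Fin mt), P.tWeight mt (val x') • F (tNode P.T mt (val x'))‖ ≤
      e₁ * (P.bL1 + e₂) := by
    rw [← Finset.sum_sub_distrib]
    calc _ ≤ ∑ x' : Bits (Fin mt), ‖P.tWeight mt (val x') • S x' -
          P.tWeight mt (val x') • F (tNode P.T mt (val x'))‖ := norm_sum_le _ _
      _ ≤ ∑ x' : Bits (Fin mt), e₁ * (P.tWeight mt (val x') * ‖P.b (tNode P.T mt (val x'))‖) := by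
          refine Finset.sum_le_sum fun x' _ => ?_
          have hw := hP.tWeight_nonneg hmt (val x')
          rw [← smul_sub, norm_smul, Real.norm_of_nonneg hw]
          calc _ ≤ P.tWeight mt (val x') * (e₁ * ‖P.b (tNode P.T mt (val x'))‖) := by
                gcongr
                exact happly _ (hP.tNode_mem hmt x') _
            _ = _ := by ring
      _ = e₁ * ∑ x' : Bits (Fin mt), P.tWeight mt (val x') * ‖P.b (tNode P.T mt (val x'))‖ := by
          rw [Finset.mul_sum]
      _ ≤ e₁ * (P.bL1 + e₂) := by
          gcongr
          have := (abs_le.1 hbsum).2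
          linarith
  have e3 : S₀ + ∑ x' : Bits (Fin mt), P.tWeight mt (val x') • S x' -
      (opOf (V P.T * W 0) P.u₀ + ∫ s in (0 : ℝ)..P.T, F s) =
      (S₀ - opOf (V P.T * W 0) P.u₀) + (∑ x' : Bits (Fin mt), P.tWeight mt (val x') • S x' -
        ∑ x' : Bits (Fin mt), P.tWeight mt (val x') • F (tNode P.T mt (val x'))) +
      (∑ x' : Bits (Fin mt), P.tWeight mt (val x') • F (tNode P.T mt (val x')) -
        ∫ s in (0 : ℝ)..P.T, F s) := by abel
  rw [e3]
  refine norm_add₃_le.trans ?_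
  linarith

/-! ### Operators on qubit registers -/

section Embed

variable {w N : ℕ} {κ : Type} [Fintype κ] [DecidableEq κ] (e : κ ↪ Fin w)
  {ctrl : Fin w → Option (Fin 2)}

/-- The values `a` of the ancilla qubits meet the control conditions. -/
def Meets (ctrl : Fin w → Option (Fin 2)) (a : Bits (Fin w)) : Prop :=
  ∀ i v, ctrl i = some v → a i = v

lemma meets_iff_of_agree (hd : ∀ i ∈ range e, ctrl i = none) {a b : Bits (Fin w)}
    (h : ∀ i, i ∉ range e → a i = b i) : Meets ctrl a ↔ Meets ctrl b := by
  have key : ∀ i v, ctrl i = some v → a i = b i := fun i v hi =>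
    h i fun hr => by simp [hd i hr] at hi
  exact ⟨fun H i v hi => (key i v hi).symm.trans (H i v hi),
    fun H i v hi => (key i v hi).trans (H i v hi)⟩

lemma meets_extend (hd : ∀ i ∈ range e, ctrl i = none) (z : Bits κ) (a : Bits (Fin w)) :
    Meets ctrl (Function.extend e z a) ↔ Meets ctrl a :=
  meets_iff_of_agree e hd fun i hi => Function.extend_apply' _ _ _ (by simpa using hi)

/-- Only columns that agree with `a` off the register contribute, and these are the labels
`Function.extend e y a`; the row becomes a sum over the values of the register alone. -/
lemma embed_mulVec_of_meets (V : Matrix (Bits κ × Fin N) (Bits κ × Fin N) ℂ)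
    (ψ : Idx w N → ℂ) {a : Bits (Fin w)} (h : Meets ctrl a) (n : Fin N) :
    (embed e ctrl V *ᵥ ψ) (a, n) =
      ∑ y : Bits κ × Fin N, V (a ∘ e, n) y * ψ (Function.extend e y.1 a, y.2) := by
  classical
  unfold Meets at h
  rw [Matrix.mulVec, dotProduct]
  symm
  refine Fintype.sum_of_injective
    (fun y : Bits κ × Fin N => ((Function.extend e y.1 a, y.2) : Idx w N)) ?_ _ _ ?_ ?_
  · rintro ⟨y, n⟩ ⟨y', n'⟩ hy
    simp only [Prod.mk.injEq] at hy ⊢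
    refine ⟨?_, hy.2⟩
    rw [← Function.extend_comp e.injective y a, hy.1, Function.extend_comp e.injective]
  · rintro ⟨b, n'⟩ hb
    simp only [embed, Matrix.of_apply, if_pos h]
    rw [if_neg, zero_mul]
    intro hab
    refine hb ⟨(b ∘ e, n'), ?_⟩
    simp only [Prod.mk.injEq, and_true]
    funext i
    by_cases hi : i ∈ range e
    · obtain ⟨k, rfl⟩ := hi
      rw [e.injective.extend_apply]
      rfl
    · rw [Function.extend_apply' _ _ _ (by simpa using hi), hab i hi]
  · rintro ⟨y, n'⟩
    simp only [embed, Matrix.of_apply, if_pos h]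
    rw [if_pos, Function.extend_comp e.injective]
    intro i hi
    rw [Function.extend_apply' _ _ _ (by simpa using hi)]

lemma embed_mulVec_of_not_meets (V : Matrix (Bits κ × Fin N) (Bits κ × Fin N) ℂ)
    (ψ : Idx w N → ℂ) {a : Bits (Fin w)} (h : ¬Meets ctrl a) (n : Fin N) :
    (embed e ctrl V *ᵥ ψ) (a, n) = ψ (a, n) := by
  classical
  unfold Meets at h
  simp only [Matrix.mulVec, dotProduct, embed, Matrix.of_apply, if_neg h, ite_mul, one_mul,
    zero_mul]
  simp

/-- The controls avoid the register, so rewriting the register does not change whether they are met.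
-/
lemma embed_mul (hd : ∀ i ∈ range e, ctrl i = none)
    (V W : Matrix (Bits κ × Fin N) (Bits κ × Fin N) ℂ) :
    embed e ctrl (V * W) = embed e ctrl V * embed e ctrl W := by
  refine Matrix.mulVec_injective (funext fun ψ => funext fun ⟨a, n⟩ => ?_)
  rw [← Matrix.mulVec_mulVec]
  by_cases h : Meets ctrl a
  · rw [embed_mulVec_of_meets e _ _ h, embed_mulVec_of_meets e _ _ h]
    have h' : ∀ z, Meets ctrl (Function.extend e z a) := fun z => (meets_extend e hd z a).2 h
    have h2 : ∀ y : Bits κ × Fin N,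
        (embed e ctrl W *ᵥ ψ) (Function.extend e y.1 a, y.2) =
          ∑ z : Bits κ × Fin N, W y z * ψ (Function.extend e z.1 a, z.2) := by
      intro y
      rw [embed_mulVec_of_meets e _ _ (h' y.1)]
      refine Finset.sum_congr rfl fun z _ => ?_
      rw [Function.extend_comp e.injective]
      congr 3
      funext i
      by_cases hi : i ∈ range e
      · obtain ⟨k, rfl⟩ := hi
        rw [e.injective.extend_apply, e.injective.extend_apply]
      · rw [Function.extend_apply' _ _ _ (by simpa using hi),
          Function.extend_apply' _ _ _ (by simpa using hi),
          Function.extend_apply' _ _ _ (by simpa using hi)]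
    simp only [h2, Matrix.mul_apply, Finset.sum_mul, Finset.mul_sum]
    rw [Finset.sum_comm]
    simp only [mul_assoc]
  · rw [embed_mulVec_of_not_meets e _ _ h, embed_mulVec_of_not_meets e _ _ h,
      embed_mulVec_of_not_meets e _ _ h]

lemma extend_comp_self (a : Bits (Fin w)) : Function.extend e (a ∘ e) a = a := by
  funext i
  by_cases hi : i ∈ range e
  · obtain ⟨k, rfl⟩ := hi
    rw [e.injective.extend_apply]
    rfl
  · rw [Function.extend_apply' _ _ _ (by simpa using hi)]

lemma embed_one : embed (N := N) e ctrl 1 = 1 := by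
  refine Matrix.mulVec_injective (funext fun ψ => funext fun ⟨a, n⟩ => ?_)
  rw [Matrix.one_mulVec]
  by_cases h : Meets ctrl a
  · rw [embed_mulVec_of_meets e _ _ h]
    simp [Matrix.one_apply, extend_comp_self]
  · rw [embed_mulVec_of_not_meets e _ _ h]

lemma embed_conjTranspose (hd : ∀ i ∈ range e, ctrl i = none)
    (V : Matrix (Bits κ × Fin N) (Bits κ × Fin N) ℂ) :
    (embed e ctrl V)ᴴ = embed e ctrl Vᴴ := by
  classical
  ext x y
  rw [Matrix.conjTranspose_apply]
  simp only [embed, Matrix.of_apply]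
  by_cases hxy : ∀ i, i ∉ range e → x.1 i = y.1 i
  · have hyx : ∀ i, i ∉ range e → y.1 i = x.1 i := fun i hi => (hxy i hi).symm
    have := meets_iff_of_agree e hd hxy
    unfold Meets at this
    by_cases h : ∀ i v, ctrl i = some v → x.1 i = v
    · rw [if_pos h, if_pos (this.1 h), if_pos hxy, if_pos hyx, Matrix.conjTranspose_apply]
    · rw [if_neg h, if_neg (fun h' => h (this.2 h'))]
      by_cases he : x = y
      · simp [he]
      · simp [he, Ne.symm he]
  · have hyx : ¬∀ i, i ∉ range e → y.1 i = x.1 i := fun h => hxy fun i hi => (h i hi).symm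
    have hne : x ≠ y := fun h => hxy fun i _ => by rw [h]
    rw [if_neg hxy, if_neg hyx, if_neg hne, if_neg hne.symm]
    simp

lemma embed_isometry (hd : ∀ i ∈ range e, ctrl i = none)
    {V : Matrix (Bits κ × Fin N) (Bits κ × Fin N) ℂ} (hV : Vᴴ * V = 1) :
    (embed e ctrl V)ᴴ * embed e ctrl V = 1 := by
  rw [embed_conjTranspose e hd, ← embed_mul e hd, hV, embed_one]

lemma onSystem_mul (V W : Matrix (Fin N) (Fin N) ℂ) : onSystem V * onSystem W = onSystem (V * W) := by
  ext x y
  simp [onSystem, Matrix.mul_apply, Fintype.sum_prod_type]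

lemma onSystem_one : onSystem (1 : Matrix (Fin N) (Fin N) ℂ) = 1 := by
  ext x y
  simp [onSystem, Matrix.one_apply, Prod.ext_iff, Subsingleton.elim x.1 y.1]

lemma onSystem_conjTranspose (V : Matrix (Fin N) (Fin N) ℂ) : (onSystem V)ᴴ = onSystem Vᴴ := rfl

lemma onQubits_mul (V W : Matrix (Bits κ) (Bits κ) ℂ) :
    onQubits (N := N) V * onQubits W = onQubits (V * W) := by
  ext x y
  simp only [onQubits, Matrix.mul_apply, Fintype.sum_prod_type, Matrix.of_apply]
  by_cases h : x.2 = y.2 <;> simp [h]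

lemma onQubits_one : onQubits (N := N) (1 : Matrix (Bits κ) (Bits κ) ℂ) = 1 := by
  ext x y
  simp only [onQubits, Matrix.one_apply, Prod.ext_iff, Matrix.of_apply]
  by_cases h : x.2 = y.2 <;> by_cases h' : x.1 = y.1 <;> simp [h, h']

lemma onQubits_conjTranspose (V : Matrix (Bits κ) (Bits κ) ℂ) :
    (onQubits (N := N) V)ᴴ = onQubits Vᴴ := by
  ext x y
  simp only [onQubits, Matrix.conjTranspose_apply, Matrix.of_apply]
  by_cases h : x.2 = y.2
  · simp [h]
  · simp [h, Ne.symm h]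

lemma onSystem_isometry {V : Matrix (Fin N) (Fin N) ℂ} (hV : Vᴴ * V = 1) :
    (onSystem V)ᴴ * onSystem V = 1 := by
  rw [onSystem_conjTranspose, onSystem_mul, hV, onSystem_one]

lemma onQubits_isometry {V : Matrix (Bits κ) (Bits κ) ℂ} (hV : Vᴴ * V = 1) :
    (onQubits (N := N) V)ᴴ * onQubits V = 1 := by
  rw [onQubits_conjTranspose, onQubits_mul, hV, onQubits_one]

lemma unitary_isometry {ι : Type*} [Fintype ι] [DecidableEq ι] (V : Matrix.unitaryGroup ι ℂ) :
    V.1ᴴ * V.1 = 1 := Matrix.mem_unitaryGroup_iff'.1 V.2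

lemma orInv_isometry {ι : Type*} [Fintype ι] [DecidableEq ι] (inv : Bool)
    (V : Matrix.unitaryGroup ι ℂ) : (orInv inv V)ᴴ * orInv inv V = 1 := by
  cases inv
  · exact Matrix.mem_unitaryGroup_iff'.1 V.2
  · simp only [orInv, if_true, Matrix.conjTranspose_conjTranspose]
    exact Matrix.mem_unitaryGroup_iff.1 V.2

lemma orInv_conjTranspose {ι : Type*} [Fintype ι] [DecidableEq ι] (inv : Bool)
    (V : Matrix.unitaryGroup ι ℂ) : (orInv inv V)ᴴ = orInv (!inv) V := by
  cases inv <;> simp [orInv]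

/-- A one-qubit unitary as an operator on the bit strings of a single qubit. -/
abbrev oneBit (U : Matrix (Fin 2) (Fin 2) ℂ) : Matrix (Bits Unit) (Bits Unit) ℂ :=
  Matrix.of fun x y => U (x ()) (y ())

lemma oneBit_eq (U : Matrix (Fin 2) (Fin 2) ℂ) :
    oneBit U = U.submatrix (Equiv.funUnique Unit (Fin 2)) (Equiv.funUnique Unit (Fin 2)) := rfl

lemma oneBit_isometry {U : Matrix (Fin 2) (Fin 2) ℂ} (hU : Uᴴ * U = 1) :
    (oneBit U)ᴴ * oneBit U = 1 := by
  rw [oneBit_eq, Matrix.conjTranspose_submatrix, Matrix.submatrix_mul_equiv, hU]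
  exact Matrix.submatrix_one_equiv _

end Embed

/-! ### Gates and their inverses -/

section Gates

variable {m mt w N : ℕ} [NeZero N] (O : Oracles m mt N)

/-- The inverse of a query, provided that the inverse of an evolution is the evolution backwards
in time. -/
def Query.inverse : Query m mt w → Query m mt w
  | .prep inv => .prep !inv
  | .src e inv => .src e !inv
  | .coef e inv => .coef e !inv
  | .coefB e inv => .coefB e !inv
  | .simL s τ => .simL (-s) τ
  | .simH s τ => .simH (-s) τ
  | .simLT e s τ₀ τ₁ => .simLT e (-s) τ₀ τ₁
  | .simHT e s τ₀ τ₁ => .simHT e (-s) τ₀ τ₁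

lemma Query.inverse_wires (o : Query m mt w) : o.inverse.wires = o.wires := by
  cases o <;> rfl

/-- The inverse gate. -/
def Gate.inverse : Gate m mt w → Gate m mt w
  | .oneQubit i U => .oneQubit i U⁻¹
  | .reflect S sys => .reflect S sys
  | .query o ctrl disj => .query o.inverse ctrl (o.inverse_wires ▸ disj)

/-- The evolution oracles queried satisfy `O(-s) = O(s)†`. -/
def Query.Reversible : Query m mt w → Prop
  | .simL s τ => (O.simL (-s) τ).1 = (O.simL s τ).1ᴴ
  | .simH s τ => (O.simH (-s) τ).1 = (O.simH s τ).1ᴴ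
  | .simLT _ s τ₀ τ₁ => (O.simLT (-s) τ₀ τ₁).1 = (O.simLT s τ₀ τ₁).1ᴴ
  | .simHT _ s τ₀ τ₁ => (O.simHT (-s) τ₀ τ₁).1 = (O.simHT s τ₀ τ₁).1ᴴ
  | _ => True

/-- The matrix of the inverse gate is the adjoint matrix. -/
def Gate.Reversible : Gate m mt w → Prop
  | .query o _ _ => o.Reversible O
  | _ => True

/-- Evolution queries carry no inverse flag: their adjoint is the evolution with negated time, which
is legitimate only where the oracle is reversible. -/
lemma Gate.inverse_matrix {g : Gate m mt w} (hg : g.Reversible O) :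
    g.inverse.matrix O = (g.matrix O)ᴴ := by
  classical
  rcases g with ⟨i, U⟩ | ⟨S, sys⟩ | ⟨o, ctrl, hd⟩
  · simp only [Gate.inverse, Gate.matrix]
    rw [embed_conjTranspose _ (by simp), onQubits_conjTranspose, Matrix.UnitaryGroup.inv_val]
    rfl
  · simp only [Gate.inverse, Gate.matrix]
    rw [Matrix.diagonal_conjTranspose]
    congr 1
    funext x
    simp only [Pi.star_apply, apply_ite star, star_neg, star_one]
  · have hn : ∀ i ∈ range (noWires w), ctrl i = none := by simp [noWires]
    cases o <;> simp only [Gate.inverse, Gate.matrix, Query.inverse, Query.matrix]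
    case prep => rw [embed_conjTranspose _ hn, onSystem_conjTranspose, orInv_conjTranspose]
    case src => rw [embed_conjTranspose _ hd, orInv_conjTranspose]
    case coef => rw [embed_conjTranspose _ hd, onQubits_conjTranspose, orInv_conjTranspose]
    case coefB => rw [embed_conjTranspose _ hd, onQubits_conjTranspose, orInv_conjTranspose]
    case simL s τ =>
      rw [embed_conjTranspose _ hn, onSystem_conjTranspose,
        show (O.simL (-s) τ).1 = (O.simL s τ).1ᴴ from hg]
    case simH s τ =>
      rw [embed_conjTranspose _ hn, onSystem_conjTranspose,
        show (O.simH (-s) τ).1 = (O.simH s τ).1ᴴ from hg]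
    case simLT e s τ₀ τ₁ =>
      rw [embed_conjTranspose _ hd, show (O.simLT (-s) τ₀ τ₁).1 = (O.simLT s τ₀ τ₁).1ᴴ from hg]
    case simHT e s τ₀ τ₁ =>
      rw [embed_conjTranspose _ hd, show (O.simHT (-s) τ₀ τ₁).1 = (O.simHT s τ₀ τ₁).1ᴴ from hg]

lemma Gate.isometry (g : Gate m mt w) : (g.matrix O)ᴴ * g.matrix O = 1 := by
  classical
  rcases g with ⟨i, U⟩ | ⟨S, sys⟩ | ⟨o, ctrl, hd⟩
  · exact embed_isometry _ (by simp) (onQubits_isometry (oneBit_isometry (unitary_isometry U)))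
  · simp only [Gate.matrix]
    rw [Matrix.diagonal_conjTranspose, Matrix.diagonal_mul_diagonal, ← Matrix.diagonal_one]
    congr 1
    funext x
    simp only [Pi.star_apply, apply_ite star, star_neg, star_one]
    split_ifs <;> norm_num
  · have hn : ∀ i ∈ range (noWires w), ctrl i = none := by simp [noWires]
    cases o <;> simp only [Gate.matrix, Query.matrix]
    case prep => exact embed_isometry _ hn (onSystem_isometry (orInv_isometry _ _))
    case src => exact embed_isometry _ hd (orInv_isometry _ _)
    case coef => exact embed_isometry _ hd (onQubits_isometry (orInv_isometry _ _))
    case coefB => exact embed_isometry _ hd (onQubits_isometry (orInv_isometry _ _))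
    case simL => exact embed_isometry _ hn (onSystem_isometry (unitary_isometry _))
    case simH => exact embed_isometry _ hn (onSystem_isometry (unitary_isometry _))
    case simLT => exact embed_isometry _ hd (unitary_isometry _)
    case simHT => exact embed_isometry _ hd (unitary_isometry _)

/-- The operator of a list of gates in the order of their application. -/
def gatesMatrix (l : List (Gate m mt w)) : Matrix (Idx w N) (Idx w N) ℂ :=
  l.foldl (fun U g => g.matrix O * U) 1

lemma foldl_gates (l : List (Gate m mt w)) (U : Matrix (Idx w N) (Idx w N) ℂ) :
    l.foldl (fun U g => g.matrix O * U) U = gatesMatrix O l * U := by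
  induction l generalizing U with
  | nil => simp [gatesMatrix]
  | cons g l ih =>
    rw [gatesMatrix, List.foldl_cons, List.foldl_cons, ih, ih, mul_one, mul_assoc]

lemma gatesMatrix_nil : gatesMatrix O ([] : List (Gate m mt w)) = 1 := rfl

lemma gatesMatrix_append (l l' : List (Gate m mt w)) :
    gatesMatrix O (l ++ l') = gatesMatrix O l' * gatesMatrix O l := by
  rw [gatesMatrix, List.foldl_append, foldl_gates O l']
  rfl

lemma gatesMatrix_singleton (g : Gate m mt w) : gatesMatrix O [g] = g.matrix O := by
  simp [gatesMatrix]

lemma gatesMatrix_cons (g : Gate m mt w) (l : List (Gate m mt w)) :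
    gatesMatrix O (g :: l) = gatesMatrix O l * g.matrix O := by
  rw [← List.singleton_append, gatesMatrix_append, gatesMatrix_singleton]

lemma gatesMatrix_isometry (l : List (Gate m mt w)) :
    (gatesMatrix O l)ᴴ * gatesMatrix O l = 1 := by
  induction l with
  | nil => simp [gatesMatrix]
  | cons g l ih =>
    rw [gatesMatrix_cons, Matrix.conjTranspose_mul, mul_assoc, ← mul_assoc _ _ (g.matrix O), ih,
      one_mul, g.isometry O]

/-- The gates of the inverse circuit. -/
def inverseGates (l : List (Gate m mt w)) : List (Gate m mt w) := (l.map Gate.inverse).reverse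

lemma gatesMatrix_inverseGates {l : List (Gate m mt w)} (hl : ∀ g ∈ l, g.Reversible O) :
    gatesMatrix O (inverseGates l) = (gatesMatrix O l)ᴴ := by
  induction l with
  | nil => simp [gatesMatrix, inverseGates]
  | cons g l ih =>
    rw [inverseGates, List.map_cons, List.reverse_cons, gatesMatrix_append, gatesMatrix_singleton,
      gatesMatrix_cons, Matrix.conjTranspose_mul,
      Gate.inverse_matrix O (hl g List.mem_cons_self), ← inverseGates,
      ih fun g hg => hl g (List.mem_cons_of_mem _ hg)]

end Gates

/-! ### Amplitude amplification -/

section Amplification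

variable {m mt w N : ℕ} [NeZero N] (O : Oracles m mt N)

/-- One round of amplitude amplification. The one-qubit gate `-I` fixes the sign. -/
def amplifyRound (i : Fin w) (l : List (Gate m mt w)) : List (Gate m mt w) :=
  .reflect Finset.univ false :: (inverseGates l ++ (.reflect Finset.univ true ::
    (l ++ [.oneQubit i (-1)])))

/-- The circuit `l` followed by `n` rounds of amplitude amplification. -/
def amplified (i : Fin w) (l : List (Gate m mt w)) : ℕ → List (Gate m mt w)
  | 0 => l
  | n + 1 => amplified i l n ++ amplifyRound i l

/-- The unnormalized state of the system register if all ancilla qubits are `0`. -/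
def zeroBlock (l : List (Gate m mt w)) : EuclideanSpace ℂ (Fin N) :=
  WithLp.toLp 2 fun n => gatesMatrix O l (0, n) (0, 0)

lemma neg_gate_matrix (i : Fin w) :
    (Gate.oneQubit i (-1) : Gate m mt w).matrix O = -1 := by
  have h : (onQubits (oneBit (-1)) :
      Matrix (Bits Unit × Fin N) (Bits Unit × Fin N) ℂ) = -1 := by
    rw [← onQubits_one]
    ext x y
    have hxy : x.1 () = y.1 () ↔ x.1 = y.1 :=
      ⟨fun h => funext fun _ => h, fun h => by rw [h]⟩
    by_cases h : x.2 = y.2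
    · by_cases h' : x.1 = y.1
      · simp [onQubits, h, h', Matrix.neg_apply, Matrix.one_apply]
      · have h'' : x.1 () ≠ y.1 () := fun hh => h' (hxy.1 hh)
        simp [onQubits, h, h', h'', Matrix.neg_apply, Matrix.one_apply]
    · simp [onQubits, h]
  refine Matrix.mulVec_injective (funext fun ψ => funext fun ⟨a, n⟩ => ?_)
  show (embed (wire i) (fun _ => none) (onQubits (oneBit (-1))) *ᵥ ψ) (a, n) = _
  rw [h, embed_mulVec_of_meets _ _ _ (fun _ _ h => by simp at h), Matrix.neg_mulVec,
    Matrix.one_mulVec]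
  simp [Matrix.one_apply, Matrix.neg_apply, extend_comp_self]

/-- The part of a state where all ancilla qubits are `0`. -/
def flagged (ψ : Idx w N → ℂ) : Idx w N → ℂ := fun x => if x.1 = 0 then ψ x else 0

lemma reflect_ancilla_mulVec (ψ : Idx w N → ℂ) :
    (Gate.reflect Finset.univ false : Gate m mt w).matrix O *ᵥ ψ = ψ - (2 : ℂ) • flagged ψ := by
  funext x
  simp only [Gate.matrix, Matrix.mulVec_diagonal, Pi.sub_apply, Pi.smul_apply, flagged, smul_eq_mul]
  have : (∀ i ∈ (Finset.univ : Finset (Fin w)), x.1 i = 0) ↔ x.1 = 0 :=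
    ⟨fun h => funext fun i => h i (Finset.mem_univ i), fun h i _ => by rw [h]; rfl⟩
  by_cases h : x.1 = 0
  · simp [h]
    ring
  · have h' : ¬∀ i, x.1 i = 0 := fun hh => h (funext hh)
    simp [h, h']

lemma reflect_all_mulVec (ψ : Idx w N → ℂ) :
    (Gate.reflect Finset.univ true : Gate m mt w).matrix O *ᵥ ψ =
      ψ - (2 * ψ (0, 0)) • Pi.single (0, 0) 1 := by
  funext x
  simp only [Gate.matrix, Matrix.mulVec_diagonal, Pi.sub_apply, Pi.smul_apply, smul_eq_mul]
  by_cases h : x = (0, 0)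
  · subst h
    simp
    ring
  · have h' : ¬((∀ i, x.1 i = 0) ∧ x.2 = 0) := fun hh => h (Prod.ext (funext hh.1) hh.2)
    simp [h, h']

lemma sum_normSq_zeroBlock (l : List (Gate m mt w)) (ψ : Idx w N → ℂ)
    (hψ : ψ = gatesMatrix O l *ᵥ Pi.single (0, 0) 1) :
    star ψ ⬝ᵥ ψ = 1 ∧ star ψ ⬝ᵥ flagged ψ = ((‖zeroBlock O l‖ ^ 2 : ℝ) : ℂ) ∧
      ‖zeroBlock O l‖ ≤ 1 := by
  have h1 : star ψ ⬝ᵥ ψ = 1 := by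
    rw [hψ, Matrix.star_mulVec, ← Matrix.dotProduct_mulVec, Matrix.mulVec_mulVec,
      gatesMatrix_isometry, Matrix.one_mulVec]
    simp
  have hz : ∀ n, zeroBlock O l n = ψ (0, n) := by
    intro n
    rw [hψ, Matrix.mulVec_single_one]
    rfl
  have h1' : ∑ x, ‖ψ x‖ ^ 2 = 1 := by
    have : star ψ ⬝ᵥ ψ = ((∑ x, ‖ψ x‖ ^ 2 : ℝ) : ℂ) := by
      rw [dotProduct]
      push_cast
      refine Finset.sum_congr rfl fun x _ => ?_
      rw [Pi.star_apply, ← starRingEnd_apply, Complex.conj_mul']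
    rw [h1] at this
    exact_mod_cast this.symm
  have h2 : star ψ ⬝ᵥ flagged ψ = ((‖zeroBlock O l‖ ^ 2 : ℝ) : ℂ) := by
    rw [EuclideanSpace.norm_sq_eq, dotProduct, Fintype.sum_prod_type]
    rw [Finset.sum_eq_single (0 : Bits (Fin w)) (fun a _ ha => by simp [flagged, ha]) (by simp)]
    push_cast
    refine Finset.sum_congr rfl fun x _ => ?_
    rw [Pi.star_apply, ← starRingEnd_apply, flagged, if_pos rfl, Complex.conj_mul', hz]
  refine ⟨h1, h2, ?_⟩
  rw [← sq_le_one_iff₀ (norm_nonneg _), EuclideanSpace.norm_sq_eq, ← h1', Fintype.sum_prod_type]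
  simp only [hz]
  exact Finset.single_le_sum (f := fun a : Bits (Fin w) => ∑ n, ‖ψ (a, n)‖ ^ 2)
    (fun a _ => Finset.sum_nonneg fun n _ => by positivity) (Finset.mem_univ 0)

/-- With `Π` the projection onto the flagged part, the round is `-M (1 - 2 |0⟩⟨0|) Mᴴ (1 - 2 Π) = (2
|ψ⟩⟨ψ| - 1) (1 - 2 Π)`. -/
lemma amplifyRound_mulVec (i : Fin w) {l : List (Gate m mt w)} (hl : ∀ g ∈ l, g.Reversible O)
    (φ ψ : Idx w N → ℂ) (hψ : ψ = gatesMatrix O l *ᵥ Pi.single (0, 0) 1) :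
    gatesMatrix O (amplifyRound i l) *ᵥ φ =
      (2 : ℂ) • flagged φ - φ + (2 * (star ψ ⬝ᵥ (φ - (2 : ℂ) • flagged φ))) • ψ := by
  set M := gatesMatrix O l with hM
  have hMM : M * Mᴴ = 1 := mul_eq_one_comm.1 (gatesMatrix_isometry O l)
  rw [amplifyRound, gatesMatrix_cons, gatesMatrix_append, gatesMatrix_cons, gatesMatrix_append,
    gatesMatrix_singleton, neg_gate_matrix, gatesMatrix_inverseGates O hl, ← hM]
  simp only [← Matrix.mulVec_mulVec]
  rw [reflect_ancilla_mulVec, reflect_all_mulVec, Matrix.neg_mulVec, Matrix.one_mulVec]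
  set χ := φ - (2 : ℂ) • flagged φ with hχ
  have h0 : (Mᴴ *ᵥ χ) (0, 0) = star ψ ⬝ᵥ χ := by
    rw [hψ, Matrix.star_mulVec, ← Matrix.dotProduct_mulVec]
    have : star (Pi.single (0, 0) 1 : Idx w N → ℂ) = Pi.single (0, 0) 1 := by
      rw [← Pi.single_star, star_one]
    rw [this, single_dotProduct, one_mul]
  rw [Matrix.mulVec_sub, Matrix.mulVec_smul, ← hψ, Matrix.mulVec_mulVec, hMM, Matrix.one_mulVec, h0,
    hχ]
  abel

/-- **Amplitude amplification** with `n` rounds. -/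
theorem norm_smul_zeroBlock_amplified (i : Fin w) {l : List (Gate m mt w)}
    (hl : ∀ g ∈ l, g.Reversible O) (n : ℕ) :
    ‖zeroBlock O l‖ • zeroBlock O (amplified i l n) =
      Real.sin ((2 * n + 1) * Real.arcsin ‖zeroBlock O l‖) • zeroBlock O l := by
  set ψ : Idx w N → ℂ := gatesMatrix O l *ᵥ Pi.single (0, 0) 1 with hψ
  obtain ⟨h1, h2, h3⟩ := sum_normSq_zeroBlock O l ψ hψ
  set σ := ‖zeroBlock O l‖ with hσ
  set θ := Real.arcsin σ with hθ
  have hsin : Real.sin θ = σ := Real.sin_arcsin (by linarith [norm_nonneg (zeroBlock O l)]) h3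
  have hsc := Real.sin_sq_add_cos_sq θ
  -- The state stays in the plane of the flagged part of `ψ` and its complement and rotates by `2 θ`
  -- per round. The relations for `a` and `b` are kept free of divisions, so `σ = 0` and `cos θ = 0`
  -- need no separate treatment.
  have key : ∃ a b : ℝ, σ * a = Real.sin ((2 * n + 1) * θ) ∧
      Real.cos θ * b = Real.cos ((2 * n + 1) * θ) ∧
      gatesMatrix O (amplified i l n) *ᵥ Pi.single (0, 0) 1 =
        (a : ℂ) • flagged ψ + (b : ℂ) • (ψ - flagged ψ) := by
    induction n with
    | zero =>
      refine ⟨1, 1, by simp [hsin], by simp, ?_⟩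
      simp only [amplified, ← hψ, Complex.ofReal_one, one_smul]
      abel
    | succ n ih =>
      obtain ⟨a, b, ha, hb, hab⟩ := ih
      set φ := (n : ℝ) with hφ
      have e : (2 * ((n + 1 : ℕ) : ℝ) + 1) * θ = (2 * n + 1) * θ + 2 * θ := by push_cast; ring
      refine ⟨a * (1 - 2 * σ ^ 2) + 2 * b * Real.cos θ ^ 2,
        b * (2 * Real.cos θ ^ 2 - 1) - 2 * a * σ ^ 2, ?_, ?_, ?_⟩
      · rw [e, Real.sin_add, ← ha, ← hb, Real.cos_two_mul', Real.sin_two_mul, hsin]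
        rw [hsin] at hsc
        have : Real.cos θ ^ 2 = 1 - σ ^ 2 := by linarith
        rw [show Real.cos θ * b * (2 * σ * Real.cos θ) = 2 * σ * b * Real.cos θ ^ 2 by ring, this]
        ring
      · rw [e, Real.cos_add, ← ha, ← hb, Real.cos_two_mul, Real.sin_two_mul, hsin]
        ring
      · rw [amplified, gatesMatrix_append, ← Matrix.mulVec_mulVec, hab,
          amplifyRound_mulVec O i hl _ ψ hψ]
        have hf : flagged ((a : ℂ) • flagged ψ + (b : ℂ) • (ψ - flagged ψ)) =
            (a : ℂ) • flagged ψ := by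
          funext x
          by_cases hx : x.1 = 0 <;> simp [flagged, hx]
        rw [hf]
        have hd : star ψ ⬝ᵥ ((a : ℂ) • flagged ψ + (b : ℂ) • (ψ - flagged ψ) -
            (2 : ℂ) • (a : ℂ) • flagged ψ) = ((b * Real.cos θ ^ 2 - a * σ ^ 2 : ℝ) : ℂ) := by
          rw [hsin] at hsc
          have : Real.cos θ ^ 2 = 1 - σ ^ 2 := by linarith
          simp only [dotProduct_sub, dotProduct_add, dotProduct_smul, h1, h2, smul_eq_mul, this]
          push_cast
          ring
        rw [hd]
        rw [hsin] at hsc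
        have : Real.cos θ ^ 2 = 1 - σ ^ 2 := by linarith
        rw [this]
        push_cast
        module
  obtain ⟨a, b, ha, _, hab⟩ := key
  ext k
  have hz : zeroBlock O (amplified i l n) k = a * zeroBlock O l k := by
    have e1 : zeroBlock O (amplified i l n) k =
        (gatesMatrix O (amplified i l n) *ᵥ Pi.single (0, 0) 1) (0, k) := by
      rw [Matrix.mulVec_single_one]
      rfl
    have e2 : zeroBlock O l k = ψ (0, k) := by
      rw [hψ, Matrix.mulVec_single_one]
      rfl
    rw [e1, e2, hab]
    simp [flagged]
  simp only [PiLp.smul_apply, Complex.real_smul]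
  rw [hz, ← ha]
  push_cast
  ring

end Amplification

/-! ### The layout of the ancilla qubits -/

section Layout

variable {m mt w : ℕ} (lay : Unit ⊕ (Fin mt ⊕ Fin m) ≃ Fin w)

/-- The qubit that selects between the homogeneous and the inhomogeneous part. -/
def flagWire : Fin w := lay (.inl ())

/-- The registers of both grids. -/
def gridRegs : (Fin mt ⊕ Fin m) ↪ Fin w :=
  ⟨fun i => lay (.inr i), lay.injective.comp Sum.inr_injective⟩

/-- The register of the time grid. -/
def timeReg : Fin mt ↪ Fin w :=
  ⟨fun i => lay (.inr (.inl i)), (gridRegs lay).injective.comp Sum.inl_injective⟩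

/-- The register of the `k`-grid. -/
def nodeReg : Fin m ↪ Fin w :=
  ⟨fun i => lay (.inr (.inr i)), (gridRegs lay).injective.comp Sum.inr_injective⟩

/-- The label of the ancilla qubits with the given values of the registers. -/
def anc (f : Fin 2) (y : Bits (Fin mt)) (x : Bits (Fin m)) : Bits (Fin w) :=
  Sum.elim (fun _ => f) (Sum.elim y x) ∘ lay.symm

/-- Labels of the ancilla qubits are triples of labels of the registers. -/
def ancEquiv : (Fin 2 × Bits (Fin mt) × Bits (Fin m)) ≃ Bits (Fin w) where
  toFun q := anc lay q.1 q.2.1 q.2.2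
  invFun a := (a (lay (.inl ())), fun i => a (lay (.inr (.inl i))), fun i => a (lay (.inr (.inr i))))
  left_inv q := by simp [anc]
  right_inv a := by
    funext i
    obtain ⟨j, rfl⟩ := lay.surjective i
    rcases j with _ | _ | _ <;> simp [anc]

variable (f : Fin 2) (y : Bits (Fin mt)) (x : Bits (Fin m))

@[simp] lemma anc_inl (u : Unit) : anc lay f y x (lay (.inl u)) = f := by simp [anc]

@[simp] lemma anc_inr_inl (i : Fin mt) : anc lay f y x (lay (.inr (.inl i))) = y i := by
  simp [anc]

@[simp] lemma anc_inr_inr (i : Fin m) : anc lay f y x (lay (.inr (.inr i))) = x i := by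
  simp [anc]

lemma anc_flagWire : anc lay f y x (flagWire lay) = f := anc_inl lay f y x ()

lemma anc_comp_timeReg : anc lay f y x ∘ timeReg lay = y := funext fun i => anc_inr_inl lay f y x i

lemma anc_comp_nodeReg : anc lay f y x ∘ nodeReg lay = x := funext fun i => anc_inr_inr lay f y x i

lemma anc_comp_gridRegs : anc lay f y x ∘ gridRegs lay = Sum.elim y x := by
  funext i
  rcases i with i | i
  · exact anc_inr_inl lay f y x i
  · exact anc_inr_inr lay f y x i

lemma anc_comp_wire : anc lay f y x ∘ wire (flagWire lay) = fun _ => f :=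
  funext fun _ => anc_inl lay f y x ()

lemma anc_zero : anc lay 0 0 0 = 0 := by
  funext i
  obtain ⟨j, rfl⟩ := lay.surjective i
  rcases j with _ | _ | _ <;> simp

lemma anc_inj {f' : Fin 2} {y' : Bits (Fin mt)} {x' : Bits (Fin m)} :
    anc lay f y x = anc lay f' y' x' ↔ f = f' ∧ y = y' ∧ x = x' :=
  ((ancEquiv lay).injective.eq_iff (a := (f, y, x)) (b := (f', y', x'))).trans (by simp)

lemma extend_eq_of {κ : Type} (e : κ ↪ Fin w) {z : Bits κ} {a b : Bits (Fin w)}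
    (h₁ : b ∘ e = z) (h₂ : ∀ i, i ∉ range e → b i = a i) : Function.extend e z a = b := by
  funext i
  by_cases hi : i ∈ range e
  · obtain ⟨k, rfl⟩ := hi
    rw [e.injective.extend_apply, ← h₁]
    rfl
  · rw [Function.extend_apply' _ _ _ (by simpa using hi), h₂ i hi]

lemma extend_timeReg (z : Bits (Fin mt)) :
    Function.extend (timeReg lay) z (anc lay f y x) = anc lay f z x := by
  refine extend_eq_of _ (anc_comp_timeReg lay f z x) fun i hi => ?_
  obtain ⟨j, rfl⟩ := lay.surjective i
  rcases j with _ | j | _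
  · simp
  · exact absurd ⟨j, rfl⟩ hi
  · simp

lemma extend_nodeReg (z : Bits (Fin m)) :
    Function.extend (nodeReg lay) z (anc lay f y x) = anc lay f y z := by
  refine extend_eq_of _ (anc_comp_nodeReg lay f y z) fun i hi => ?_
  obtain ⟨j, rfl⟩ := lay.surjective i
  rcases j with _ | _ | j
  · simp
  · simp
  · exact absurd ⟨j, rfl⟩ hi

lemma extend_gridRegs (z : Bits (Fin mt ⊕ Fin m)) :
    Function.extend (gridRegs lay) z (anc lay f y x) =
      anc lay f (z ∘ Sum.inl) (z ∘ Sum.inr) := by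
  refine extend_eq_of _ ?_ fun i hi => ?_
  · rw [anc_comp_gridRegs, Sum.elim_comp_inl_inr]
  obtain ⟨j, rfl⟩ := lay.surjective i
  rcases j with _ | j
  · simp
  · exact absurd ⟨j, rfl⟩ hi

lemma extend_wire (z : Bits Unit) :
    Function.extend (wire (flagWire lay)) z (anc lay f y x) = anc lay (z ()) y x := by
  refine extend_eq_of _ (anc_comp_wire lay (z ()) y x) fun i hi => ?_
  obtain ⟨j, rfl⟩ := lay.surjective i
  rcases j with _ | _ | _
  · exact absurd ⟨(), rfl⟩ hi
  · simp
  · simp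

lemma extend_noWires (z : Bits Empty) (a : Bits (Fin w)) :
    Function.extend (noWires w) z a = a :=
  extend_eq_of _ (funext fun i => i.elim) fun _ _ => rfl

/-- Control by the value of one qubit. -/
def onWire (i : Fin w) (v : Fin 2) : Fin w → Option (Fin 2) := fun j => if j = i then some v else none

lemma meets_onWire (i : Fin w) (v : Fin 2) (a : Bits (Fin w)) : Meets (onWire i v) a ↔ a i = v := by
  constructor
  · intro h
    exact h i v (by simp [onWire])
  · intro h j u hj
    by_cases hji : j = i
    · subst hji
      simp only [onWire, if_true, Option.some.injEq] at hj
      rw [h, hj]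
    · simp [onWire, hji] at hj

lemma meets_none (a : Bits (Fin w)) : Meets (fun _ => none) a := fun _ _ h => by simp at h

lemma onWire_flag_gridRegs (v : Fin 2) : ∀ i ∈ range (gridRegs lay), onWire (flagWire lay) v i = none := by
  rintro _ ⟨k, rfl⟩
  exact if_neg fun h => by simpa using lay.injective h

lemma onWire_flag_timeReg (v : Fin 2) : ∀ i ∈ range (timeReg lay), onWire (flagWire lay) v i = none := by
  rintro _ ⟨k, rfl⟩
  exact if_neg fun h => by simpa using lay.injective h

lemma onWire_flag_nodeReg (v : Fin 2) : ∀ i ∈ range (nodeReg lay), onWire (flagWire lay) v i = none := by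
  rintro _ ⟨k, rfl⟩
  exact if_neg fun h => by simpa using lay.injective h

lemma onWire_node_timeReg (l : Fin m) (v : Fin 2) :
    ∀ i ∈ range (timeReg lay), onWire (nodeReg lay l) v i = none := by
  rintro _ ⟨k, rfl⟩
  exact if_neg fun h => by simpa using lay.injective h

end Layout

/-! ### Block diagonal operators -/

section BlockMat

variable {w N : ℕ}

/-- The operator that acts on the system register by `V a` if the ancilla qubits are in state
`a`. -/
def blockMat (V : Bits (Fin w) → Matrix (Fin N) (Fin N) ℂ) : Matrix (Idx w N) (Idx w N) ℂ :=
  (Matrix.blockDiagonal V).submatrix (Equiv.prodComm _ _) (Equiv.prodComm _ _)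

lemma blockMat_mul (V W : Bits (Fin w) → Matrix (Fin N) (Fin N) ℂ) :
    blockMat V * blockMat W = blockMat fun a => V a * W a := by
  rw [blockMat, blockMat, Matrix.submatrix_mul_equiv, ← Matrix.blockDiagonal_mul]
  rfl

lemma blockMat_one : blockMat (fun _ : Bits (Fin w) => (1 : Matrix (Fin N) (Fin N) ℂ)) = 1 := by
  have := Matrix.blockDiagonal_one (o := Bits (Fin w)) (m := Fin N) (α := ℂ)
  rw [blockMat, ← Matrix.submatrix_one_equiv (Equiv.prodComm (Bits (Fin w)) (Fin N)), ← this]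
  rfl

lemma blockMat_mulVec (V : Bits (Fin w) → Matrix (Fin N) (Fin N) ℂ) (ψ : Idx w N → ℂ)
    (a : Bits (Fin w)) (n : Fin N) :
    (blockMat V *ᵥ ψ) (a, n) = (V a *ᵥ fun n' => ψ (a, n')) n := by
  simp [blockMat, Matrix.mulVec, dotProduct, Fintype.sum_prod_type, Matrix.blockDiagonal_apply]

/-- Gates applied first stand rightmost in the operator product, hence the reversal. -/
lemma gatesMatrix_flatMap_block {m mt : ℕ} [NeZero N] (O : Oracles m mt N) {ι : Type*}
    (l : List ι) (g : ι → List (Gate m mt w)) (V : ι → Bits (Fin w) → Matrix (Fin N) (Fin N) ℂ)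
    (h : ∀ i ∈ l, gatesMatrix O (g i) = blockMat (V i)) :
    gatesMatrix O (l.flatMap g) = blockMat fun a => (l.reverse.map fun i => V i a).prod := by
  induction l with
  | nil => simp [gatesMatrix_nil, blockMat_one]
  | cons i l ih =>
    rw [List.flatMap_cons, gatesMatrix_append, ih fun j hj => h j (List.mem_cons_of_mem _ hj),
      h i List.mem_cons_self, blockMat_mul]
    simp

end BlockMat

/-! ### The evolution oracles -/

section Evolution

variable {N : ℕ}

lemma evol_add (G : Matrix (Fin N) (Fin N) ℂ) (s s' : ℝ) : evol G (s + s') = evol G s * evol G s' := by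
  unfold evol
  rw [← Matrix.exp_add_of_commute _ _ (((Commute.refl G).smul_left _).smul_right _), ← add_smul]
  congr 2
  push_cast
  ring

lemma evol_zero (G : Matrix (Fin N) (Fin N) ℂ) : evol G 0 = 1 := by
  simp [evol]

lemma evol_neg {G : Matrix (Fin N) (Fin N) ℂ} (hG : G.IsHermitian) (s : ℝ) :
    evol G (-s) = (evol G s)ᴴ := by
  unfold evol
  rw [← Matrix.exp_conjTranspose, Matrix.conjTranspose_smul, hG.eq]
  congr 2
  simp

lemma evolT_neg {mt : ℕ} {G : ℝ → Matrix (Fin N) (Fin N) ℂ} (hG : ∀ t, (G t).IsHermitian)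
    (s τ₀ τ₁ : ℝ) : evolT mt G (-s) τ₀ τ₁ = (evolT mt G s τ₀ τ₁)ᴴ := by
  ext x y
  simp only [evolT, Matrix.conjTranspose_apply, Matrix.of_apply]
  by_cases h : x.1 = y.1
  · rw [if_pos h, if_pos h.symm, neg_mul, evol_neg (hG _), Matrix.conjTranspose_apply, h]
  · rw [if_neg h, if_neg (Ne.symm h), star_zero]

-- Treating an unmet control as an evolution for time zero lets controlled and uncontrolled queries
-- with the same generator be combined by adding their times.
open Classical in
lemma embed_evolT {w mt : ℕ} (e : Fin mt ↪ Fin w) (ctrl : Fin w → Option (Fin 2))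
    (G : ℝ → Matrix (Fin N) (Fin N) ℂ) (s τ₀ τ₁ : ℝ) :
    embed e ctrl (evolT mt G s τ₀ τ₁) = blockMat fun a =>
      evol (G (oracleTime mt τ₀ τ₁ (val (a ∘ e))))
        (if Meets ctrl a then s * (gridM mt - val (a ∘ e)) else 0) := by
  refine Matrix.mulVec_injective (funext fun ψ => funext fun ⟨a, n⟩ => ?_)
  rw [blockMat_mulVec]
  by_cases h : Meets ctrl a
  · rw [embed_mulVec_of_meets e _ _ h, if_pos h]
    simp [evolT, Fintype.sum_prod_type, Matrix.mulVec, dotProduct, extend_comp_self]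
  · rw [embed_mulVec_of_not_meets e _ _ h, if_neg h, evol_zero, Matrix.one_mulVec]

end Evolution

/-! ### The circuit for the linear combination of Hamiltonian simulations -/

section Circuits

variable {m mt w : ℕ} (lay : Unit ⊕ (Fin mt ⊕ Fin m) ≃ Fin w)

/-- The real rotation by the angle `θ`. -/
def rotation (θ : ℝ) : Matrix.unitaryGroup (Fin 2) ℂ :=
  ⟨!![(Real.cos θ : ℂ), -(Real.sin θ : ℂ); (Real.sin θ : ℂ), (Real.cos θ : ℂ)], by
    have h : (Real.sin θ : ℂ) * Real.sin θ + Real.cos θ * Real.cos θ = 1 := by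
      rw [← sq, ← sq]
      exact_mod_cast Real.sin_sq_add_cos_sq θ
    generalize Real.cos θ = c at h ⊢
    generalize Real.sin θ = s at h ⊢
    rw [Matrix.mem_unitaryGroup_iff, Matrix.star_eq_conjTranspose]
    ext i j
    fin_cases i <;> fin_cases j <;> simp [Matrix.mul_apply, Fin.sum_univ_two]
    · linear_combination h
    · ring
    · ring
    · linear_combination h⟩

/-- The amplitudes of the linear combination. -/
def coefGates (θ : ℝ) : List (Gate m mt w) :=
  [.oneQubit (flagWire lay) (rotation θ),
    .query (.coef (nodeReg lay) false) (onWire (flagWire lay) 0) (onWire_flag_nodeReg lay 0),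
    .query (.coefB (gridRegs lay) false) (onWire (flagWire lay) 1) (onWire_flag_gridRegs lay 1)]

/-- Preparation of the initial state and of the source. -/
def loadGates : List (Gate m mt w) :=
  [.query (.prep false) (onWire (flagWire lay) 0) (by simp [Query.wires]),
    .query (.src (timeReg lay) false) (onWire (flagWire lay) 1) (onWire_flag_timeReg lay 1)]

/-- The query to the coherent evolution oracle of `L` with weight `c` in the stage `a` of the
step `ℓ` out of `r`. -/
def evolGateL (T : ℝ) (r ℓ : ℕ) (a : Stage) (c : ℝ) (ctrl : Fin w → Option (Fin 2))
    (hd : ∀ i ∈ range (timeReg lay), ctrl i = none) : Gate m mt w :=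
  .query (.simLT (timeReg lay) (a.α * T / (r * gridM mt) * c) (T / gridM mt)
    ((ℓ + a.β) * T / (r * gridM mt))) ctrl hd

/-- The query to the coherent evolution oracle of `H` in the stage `a` of the step `ℓ` out of
`r`. -/
def evolGateH (T : ℝ) (r ℓ : ℕ) (a : Stage) : Gate m mt w :=
  .query (.simHT (timeReg lay) (a.α * T / (r * gridM mt)) (T / gridM mt)
    ((ℓ + a.β) * T / (r * gridM mt))) (fun _ => none) fun _ _ => rfl

/-- One stage of the product formula. The factor `k_j = -K + 2 j K / M` of `L` is assembled from
the binary digits of `j`. -/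
def stageGates (T K : ℝ) (r ℓ : ℕ) (a : Stage) : List (Gate m mt w) :=
  if a.b then
    evolGateL lay T r ℓ a (-K) (fun _ => none) (fun _ _ => rfl) ::
      (List.finRange m).map fun l : Fin m => evolGateL lay T r ℓ a (2 ^ ((l : ℕ) + 1) * K / gridM m)
        (onWire (nodeReg lay l) 1) (onWire_node_timeReg lay l 1)
  else [evolGateH lay T r ℓ a]

/-- The product formula with `r` steps. -/
def selectGates (p : ℕ) (T K : ℝ) (r : ℕ) : List (Gate m mt w) :=
  (List.range r).flatMap fun ℓ => (suzuki p).reverse.flatMap (stageGates lay T K r ℓ)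

/-- The block encoding of the linear combination of Hamiltonian simulations. -/
def lchsGates (p : ℕ) (T K : ℝ) (r : ℕ) (θ : ℝ) : List (Gate m mt w) :=
  coefGates lay θ ++ (loadGates lay ++ (selectGates lay p T K r ++
    inverseGates (coefGates lay θ)))

end Circuits

/-! ### The product formula circuit -/

section Select

variable {m mt w N : ℕ} [NeZero N] (lay : Unit ⊕ (Fin mt ⊕ Fin m) ≃ Fin w) {O : Oracles m mt N}
  {P : ODEData N} {p r : ℕ} {K : ℝ}

/-- The length `(T - s_{j'}) / r` of a step and all sampling times are affine in `j'`. One coherent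
query therefore serves all starting times `s_{j'}` at once. -/
lemma oracleTime_eq (T : ℝ) (hmt : 0 < mt) (ℓ : ℕ) (hr : 0 < r) (β : ℝ) (j : ℕ) :
    oracleTime mt (T / gridM mt) ((ℓ + β) * T / (r * gridM mt)) j =
      tNode T mt j + ℓ * ((T - tNode T mt j) / r) + β * ((T - tNode T mt j) / r) := by
  have hM := one_le_gridM hmt
  have : (r : ℝ) ≠ 0 := by positivity
  have : gridM mt ≠ 0 := by positivity
  unfold oracleTime tNode
  field_simp
  ring

lemma ODEData.Admissible.oracleTime_mem (hP : P.Admissible p) (hmt : 0 < mt) {ℓ : ℕ} (hℓ : ℓ < r)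
    {β : ℝ} (hβ : β ∈ Icc (0 : ℝ) 1) (x : Bits (Fin mt)) :
    oracleTime mt (P.T / gridM mt) ((ℓ + β) * P.T / (r * gridM mt)) (val x) ∈ Icc 0 P.T := by
  rw [oracleTime_eq _ hmt _ (by omega)]
  obtain ⟨h0, h1⟩ := hP.tNode_mem hmt x
  set s := tNode P.T mt (val x)
  have hr : (0 : ℝ) < r := by exact_mod_cast (by omega : 0 < r)
  have hh : 0 ≤ (P.T - s) / r := div_nonneg (by linarith) hr.le
  have hrh : r * ((P.T - s) / r) = P.T - s := by field_simp
  have hℓ' : (ℓ : ℝ) + 1 ≤ r := by exact_mod_cast hℓ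
  set h := (P.T - s) / r
  have := mul_nonneg (Nat.cast_nonneg (α := ℝ) ℓ) hh
  have := mul_nonneg hβ.1 hh
  have : β * h ≤ 1 * h := mul_le_mul_of_nonneg_right hβ.2 hh
  have : (ℓ + 1) * h ≤ r * h := mul_le_mul_of_nonneg_right hℓ' hh
  constructor <;> linarith

/-- The number of steps is so large that the evolution oracles are used in their range. -/
def StepsInRange (P : ODEData N) (p : ℕ) (K : ℝ) (r : ℕ) : Prop :=
  r ≠ 0 → 2 * K * P.Gam p * P.T ≤ r

/-- The factor `M_t` cancels, and what remains is at most `2 K Γ_p T / r`. -/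
lemma query_in_range (hP : P.Admissible p) (hK : 1 ≤ K) (hmt : 0 < mt) (hr0 : 0 < r)
    (hr : StepsInRange P p K r) {α c S : ℝ} (hα : |α| ≤ 1) (hc : |c| ≤ 2 * K) (hS0 : 0 ≤ S)
    (hS : S ≤ P.Gam p) : |α * P.T / (r * gridM mt) * c| * gridM mt * S ≤ 1 := by
  have hM := one_le_gridM hmt
  have hr' : (0 : ℝ) < r := by exact_mod_cast hr0
  have hT := hP.T_pos
  have hr2 := hr hr0.ne'
  have e : |α * P.T / (r * gridM mt) * c| * gridM mt * S = (|α| * |c| * S * P.T) / r := by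
    rw [abs_mul, abs_div, abs_mul, abs_of_pos hT, abs_of_pos (by positivity : 0 < r * gridM mt)]
    field_simp
  rw [e, div_le_one hr']
  refine le_trans ?_ hr2
  have : |α| * |c| ≤ 1 * (2 * K) := mul_le_mul hα hc (abs_nonneg _) zero_le_one
  rw [one_mul] at this
  gcongr

lemma supNorm_nonneg {E : Type*} [NormedAddCommGroup E] (T : ℝ) (f : ℝ → E) : 0 ≤ supNorm T f :=
  Real.sSup_nonneg (by rintro _ ⟨τ, _, rfl⟩; exact norm_nonneg _)

/-- Only `|σ|` is prescribed, so that the statement covers the query together with its inverse. -/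
lemma Oracles.Implements.simLT_stage (hO : O.Implements P K) (hP : P.Admissible p) (hK : 1 ≤ K)
    (hmt : 0 < mt) (hr : StepsInRange P p K r) {ℓ : ℕ} (hℓ : ℓ < r) {a : Stage}
    (ha : |a.α| ≤ 1 ∧ a.β ∈ Icc (0 : ℝ) 1) {c : ℝ} (hc : |c| ≤ 2 * K) {σ : ℝ}
    (hσ : |σ| = |a.α * P.T / (r * gridM mt) * c|) :
    (O.simLT σ (P.T / gridM mt) ((ℓ + a.β) * P.T / (r * gridM mt))).1 =
      evolT mt P.L σ (P.T / gridM mt) ((ℓ + a.β) * P.T / (r * gridM mt)) :=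
  hO.simLT _ _ _ (hP.oracleTime_mem hmt hℓ ha.2) (by
    rw [hσ]
    exact query_in_range hP hK hmt (by omega) hr ha.1 hc (supNorm_nonneg _ _)
      (hP.supNorm_L_le le_rfl))

lemma Oracles.Implements.simHT_stage (hO : O.Implements P K) (hP : P.Admissible p) (hK : 1 ≤ K)
    (hmt : 0 < mt) (hr : StepsInRange P p K r) {ℓ : ℕ} (hℓ : ℓ < r) {a : Stage}
    (ha : |a.α| ≤ 1 ∧ a.β ∈ Icc (0 : ℝ) 1) {σ : ℝ} (hσ : |σ| = |a.α * P.T / (r * gridM mt)|) :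
    (O.simHT σ (P.T / gridM mt) ((ℓ + a.β) * P.T / (r * gridM mt))).1 =
      evolT mt P.H σ (P.T / gridM mt) ((ℓ + a.β) * P.T / (r * gridM mt)) :=
  hO.simHT _ _ _ (hP.oracleTime_mem hmt hℓ ha.2) (by
    have := query_in_range hP hK hmt (by omega) hr ha.1 (c := 1) (by rw [abs_one]; linarith)
      (supNorm_nonneg P.T P.H) (hP.supNorm_H_le le_rfl)
    rwa [mul_one, ← hσ] at this)

lemma abs_bit_weight_le (hK : 0 ≤ K) (l : Fin m) : |2 ^ ((l : ℕ) + 1) * K / gridM m| ≤ 2 * K := by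
  have hm : 0 < m := l.pos
  have hM := one_le_gridM hm
  rw [abs_of_nonneg (by positivity), div_le_iff₀ (by positivity)]
  have h1 : (2 : ℝ) ^ ((l : ℕ) + 1) ≤ 2 ^ m := pow_le_pow_right₀ (by norm_num) l.2
  have h2 : (2 : ℝ) ^ m ≤ 2 * gridM m := by unfold gridM at hM ⊢; linarith
  nlinarith

lemma evolGateL_matrix (hO : O.Implements P K) (hP : P.Admissible p) (hK : 1 ≤ K)
    (hmt : 0 < mt) (hr : StepsInRange P p K r) {ℓ : ℕ} (hℓ : ℓ < r) {a : Stage}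
    (ha : |a.α| ≤ 1 ∧ a.β ∈ Icc (0 : ℝ) 1) {c : ℝ} (hc : |c| ≤ 2 * K)
    (ctrl : Fin w → Option (Fin 2)) (hd : ∀ i ∈ range (timeReg lay), ctrl i = none) :
    (evolGateL lay P.T r ℓ a c ctrl hd).matrix O =
      embed (timeReg lay) ctrl (evolT mt P.L (a.α * P.T / (r * gridM mt) * c) (P.T / gridM mt)
        ((ℓ + a.β) * P.T / (r * gridM mt))) := by
  rw [← hO.simLT_stage hP hK hmt hr hℓ ha hc rfl]
  rfl

lemma evolGateL_reversible (hO : O.Implements P K) (hP : P.Admissible p) (hK : 1 ≤ K)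
    (hmt : 0 < mt) (hr : StepsInRange P p K r) {ℓ : ℕ} (hℓ : ℓ < r) {a : Stage}
    (ha : |a.α| ≤ 1 ∧ a.β ∈ Icc (0 : ℝ) 1) {c : ℝ} (hc : |c| ≤ 2 * K)
    (ctrl : Fin w → Option (Fin 2)) (hd : ∀ i ∈ range (timeReg lay), ctrl i = none) :
    (evolGateL lay P.T r ℓ a c ctrl hd).Reversible O := by
  show (O.simLT _ _ _).1 = (O.simLT _ _ _).1ᴴ
  rw [hO.simLT_stage hP hK hmt hr hℓ ha hc rfl, hO.simLT_stage hP hK hmt hr hℓ ha hc (abs_neg _),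
    evolT_neg P.isHermitian_L]

lemma evolGateH_matrix (hO : O.Implements P K) (hP : P.Admissible p) (hK : 1 ≤ K)
    (hmt : 0 < mt) (hr : StepsInRange P p K r) {ℓ : ℕ} (hℓ : ℓ < r) {a : Stage}
    (ha : |a.α| ≤ 1 ∧ a.β ∈ Icc (0 : ℝ) 1) :
    (evolGateH lay P.T r ℓ a).matrix O =
      embed (timeReg lay) (fun _ => none) (evolT mt P.H (a.α * P.T / (r * gridM mt))
        (P.T / gridM mt) ((ℓ + a.β) * P.T / (r * gridM mt))) := by
  rw [← hO.simHT_stage hP hK hmt hr hℓ ha rfl]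
  rfl

lemma evolGateH_reversible (hO : O.Implements P K) (hP : P.Admissible p) (hK : 1 ≤ K)
    (hmt : 0 < mt) (hr : StepsInRange P p K r) {ℓ : ℕ} (hℓ : ℓ < r) {a : Stage}
    (ha : |a.α| ≤ 1 ∧ a.β ∈ Icc (0 : ℝ) 1) :
    (evolGateH lay P.T r ℓ a).Reversible O := by
  show (O.simHT _ _ _).1 = (O.simHT _ _ _).1ᴴ
  rw [hO.simHT_stage hP hK hmt hr hℓ ha rfl, hO.simHT_stage hP hK hmt hr hℓ ha (abs_neg _),
    evolT_neg P.isHermitian_H]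

lemma gatesMatrix_evol_map {ι : Type*} (l : List ι) (g : ι → Gate m mt w)
    (G : Bits (Fin w) → Matrix (Fin N) (Fin N) ℂ) (c : ι → Bits (Fin w) → ℝ)
    (h : ∀ i ∈ l, (g i).matrix O = blockMat fun a => evol (G a) (c i a)) :
    gatesMatrix O (l.map g) = blockMat fun a => evol (G a) ((l.map fun i => c i a).sum) := by
  induction l with
  | nil => simp [gatesMatrix_nil, evol_zero, blockMat_one]
  | cons i l ih =>
    rw [List.map_cons, gatesMatrix_cons, ih fun j hj => h j (List.mem_cons_of_mem _ hj),
      h i List.mem_cons_self, blockMat_mul]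
    congr 1
    funext a
    rw [← evol_add, List.map_cons, List.sum_cons, add_comm]

/-- Since `k_j` is affine in `j` and `j` is the sum of its binary digits, selecting `k_j` takes one
uncontrolled evolution and `m` evolutions controlled by a single qubit each. -/
lemma kNode_eq_sum_bits (K : ℝ) (x : Bits (Fin m)) :
    kNode K m (val x) = -K + ∑ l : Fin m, if x l = 1 then 2 ^ ((l : ℕ) + 1) * K / gridM m else 0 := by
  have h : (val x : ℝ) = ∑ l : Fin m, ((x l : ℕ) : ℝ) * 2 ^ (l : ℕ) := by
    rw [val, finFunctionFinEquiv_apply]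
    push_cast
    rfl
  rw [kNode, h]
  congr 1
  rw [Finset.mul_sum, Finset.sum_mul, Finset.sum_div]
  refine Finset.sum_congr rfl fun l _ => ?_
  rcases (by omega : x l = 0 ∨ x l = 1) with hx | hx
  · simp [hx]
  · simp only [hx, if_true, Fin.val_one, Nat.cast_one, pow_succ]
    ring

/-- In a stage for `L` all evolutions have the same generator at the same sampling time, so `-K` and
the selected digit weights add up to `k_j`. -/
lemma gatesMatrix_stageGates (hO : O.Implements P K) (hP : P.Admissible p) (hK : 1 ≤ K)
    (hmt : 0 < mt) (hr : StepsInRange P p K r) {ℓ : ℕ} (hℓ : ℓ < r) {a : Stage}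
    (ha : |a.α| ≤ 1 ∧ a.β ∈ Icc (0 : ℝ) 1) :
    gatesMatrix O (stageGates lay P.T K r ℓ a) = blockMat fun z =>
      exp ((a.α * ((P.T - tNode P.T mt (val (z ∘ timeReg lay))) / r)) •
        P.gen (kNode K m (val (z ∘ nodeReg lay))) a.b
          (tNode P.T mt (val (z ∘ timeReg lay)) +
            ℓ * ((P.T - tNode P.T mt (val (z ∘ timeReg lay))) / r) +
            a.β * ((P.T - tNode P.T mt (val (z ∘ timeReg lay))) / r))) := by
  classical
  have hM := one_le_gridM hmt
  have hr0 : (r : ℝ) ≠ 0 := by exact_mod_cast (by omega : r ≠ 0)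
  have hM0 : gridM mt ≠ 0 := by positivity
  have hK0 : 0 ≤ K := by linarith
  have hs : ∀ j : ℕ, a.α * P.T / (r * gridM mt) * (gridM mt - j) =
      a.α * ((P.T - tNode P.T mt j) / r) := by
    intro j
    unfold tNode
    field_simp
  simp only [P.stage_gen_real]
  cases hb : a.b
  · rw [stageGates, if_neg (by simp [hb]), gatesMatrix_singleton,
      evolGateH_matrix lay hO hP hK hmt hr hℓ ha, embed_evolT]
    congr 1
    funext z
    rw [if_pos (meets_none z), oracleTime_eq _ hmt _ (by omega), hs]
    simp [evol]
  · rw [stageGates, if_pos hb, gatesMatrix_cons,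
      evolGateL_matrix lay hO hP hK hmt hr hℓ ha (by rw [abs_neg, abs_of_nonneg hK0]; linarith),
      embed_evolT, gatesMatrix_evol_map (O := O) (List.finRange m) _ _ _ fun l _ => by
        rw [evolGateL_matrix lay hO hP hK hmt hr hℓ ha (abs_bit_weight_le hK0 l), embed_evolT],
      blockMat_mul]
    congr 1
    funext z
    rw [← evol_add, if_pos (meets_none z), oracleTime_eq _ hmt _ (by omega), ← Fin.sum_univ_def,
      kNode_eq_sum_bits]
    simp only [meets_onWire, if_true, evol]
    congr 4
    have e : ∀ c : ℝ, a.α * P.T / (r * gridM mt) * c * (gridM mt - val (z ∘ timeReg lay)) =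
        a.α * ((P.T - tNode P.T mt (val (z ∘ timeReg lay))) / r) * c := by
      intro c
      rw [← hs]
      ring
    simp only [e]
    rw [mul_add, Finset.mul_sum, add_comm]
    congr 1
    congr 1
    refine Finset.sum_congr rfl fun l _ => ?_
    rw [mul_ite, mul_zero]
    rfl

theorem gatesMatrix_selectGates (hO : O.Implements P K) (hP : P.Admissible p) (hK : 1 ≤ K)
    (hmt : 0 < mt) (hr : StepsInRange P p K r) :
    gatesMatrix O (selectGates lay p P.T K r) = blockMat fun z =>
      P.approxProp p r (tNode P.T mt (val (z ∘ timeReg lay)))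
        (kNode K m (val (z ∘ nodeReg lay))) := by
  rw [selectGates, gatesMatrix_flatMap_block O _ _ _ fun ℓ hℓ =>
    gatesMatrix_flatMap_block O _ _ _ fun a ha =>
      gatesMatrix_stageGates lay hO hP hK hmt hr (List.mem_range.1 hℓ)
        (suzuki_bounds p a (List.mem_reverse.1 ha))]
  congr 1
  funext z
  simp only [List.reverse_reverse]
  unfold ODEData.approxProp
  set s := tNode P.T mt (val (z ∘ timeReg lay))
  set h := (P.T - s) / r
  generalize r = r'
  induction r' with
  | zero => rfl
  | succ n ih =>
    rw [List.range_succ, List.reverse_append, List.map_append, List.prod_append, ih, stepsProd]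
    simp [formulaStep]

lemma lchsGates_reversible (hO : O.Implements P K) (hP : P.Admissible p) (hK : 1 ≤ K)
    (hmt : 0 < mt) (hr : StepsInRange P p K r) (θ : ℝ) :
    ∀ g ∈ lchsGates lay p P.T K r θ, g.Reversible O := by
  have hK0 : 0 ≤ K := by linarith
  intro g hg
  simp only [lchsGates, List.mem_append] at hg
  rcases hg with hg | hg | hg | hg
  · simp only [coefGates, List.mem_cons, List.not_mem_nil, or_false] at hg
    rcases hg with rfl | rfl | rfl <;> trivial
  · simp only [loadGates, List.mem_cons, List.not_mem_nil, or_false] at hg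
    rcases hg with rfl | rfl <;> trivial
  · simp only [selectGates, List.mem_flatMap, List.mem_range, List.mem_reverse] at hg
    obtain ⟨ℓ, hℓ, a, ha, hg⟩ := hg
    have ha' := suzuki_bounds p a ha
    unfold stageGates at hg
    split_ifs at hg
    · rcases List.mem_cons.1 hg with rfl | hg
      · exact evolGateL_reversible lay hO hP hK hmt hr hℓ ha'
          (by rw [abs_neg, abs_of_nonneg hK0]; linarith) _ _
      · obtain ⟨l, _, rfl⟩ := List.mem_map.1 hg
        exact evolGateL_reversible lay hO hP hK hmt hr hℓ ha' (abs_bit_weight_le hK0 l) _ _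
    · rw [List.mem_singleton] at hg
      subst hg
      exact evolGateH_reversible lay hO hP hK hmt hr hℓ ha'
  · simp only [inverseGates, coefGates, List.map_cons, List.map_nil, List.mem_reverse,
      List.mem_cons, List.not_mem_nil, or_false] at hg
    rcases hg with rfl | rfl | rfl <;> trivial

end Select

/-! ### The block encoding -/

section BlockEncoding

variable {m mt w N : ℕ} [NeZero N] (lay : Unit ⊕ (Fin mt ⊕ Fin m) ≃ Fin w) (O : Oracles m mt N)
  {P : ODEData N} {p r : ℕ} {K : ℝ}

/-- The amplitudes of the ancilla qubits after `coefGates`. -/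
def coefAmp (θ : ℝ) (f : Fin 2) (y : Bits (Fin mt)) (x : Bits (Fin m)) : ℂ :=
  if f = 0 then (if y = 0 then Real.cos θ * O.coef.1 x 0 else 0)
  else Real.sin θ * O.coefB.1 (Sum.elim y x) 0

/-- A general `n` is needed because the final inverse of `coefGates` is evaluated as an inner
product with this vector. -/
lemma coefGates_mulVec (θ : ℝ) (n : Fin N) (f : Fin 2) (y : Bits (Fin mt)) (x : Bits (Fin m))
    (n' : Fin N) : (gatesMatrix O (coefGates lay θ) *ᵥ Pi.single (0, n) 1) (anc lay f y x, n') =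
      if n' = n then coefAmp O θ f y x else 0 := by
  set e : Idx w N → ℂ := Pi.single (0, n) 1 with he
  have hes : ∀ f y x n', e (anc lay f y x, n') = if f = 0 ∧ y = 0 ∧ x = 0 ∧ n' = n then 1 else 0 := by
    intro f y x n'
    rw [he, Pi.single_apply, ← anc_zero lay]
    simp only [Prod.mk.injEq, anc_inj, and_assoc]
  rw [coefGates, gatesMatrix_cons, gatesMatrix_cons, gatesMatrix_singleton,
    ← Matrix.mulVec_mulVec, ← Matrix.mulVec_mulVec]
  set ψ₁ := (Gate.oneQubit (flagWire lay) (rotation θ) : Gate m mt w).matrix O *ᵥ e with hψ₁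
  have h₁ : ∀ f y x n', ψ₁ (anc lay f y x, n') =
      if y = 0 ∧ x = 0 ∧ n' = n then (rotation θ).1 f 0 else 0 := by
    intro f y x n'
    show (embed (wire (flagWire lay)) (fun _ => none) (onQubits (oneBit _)) *ᵥ e) _ = _
    rw [embed_mulVec_of_meets _ _ _ (meets_none _), Fintype.sum_prod_type]
    simp only [extend_wire, hes, onQubits, Matrix.of_apply, anc_comp_wire, mul_ite,
      mul_one, mul_zero]
    rw [Finset.sum_eq_single (fun _ => 0)]
    · by_cases h : y = 0 ∧ x = 0 ∧ n' = n
      · obtain ⟨rfl, rfl, rfl⟩ := h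
        simp
      · rw [if_neg h]
        refine Finset.sum_eq_zero fun k _ => ?_
        by_cases hk : n' = k
        · subst hk
          simp [h]
        · simp [hk]
    · intro z _ hz
      have : z () ≠ 0 := fun h => hz (funext fun _ => h)
      simp [this]
    · simp
  set ψ₂ := (Gate.query (.coef (nodeReg lay) false) (onWire (flagWire lay) 0)
    (onWire_flag_nodeReg lay 0) : Gate m mt w).matrix O *ᵥ ψ₁ with hψ₂
  have h₂ : ∀ f y x n', ψ₂ (anc lay f y x, n') =
      if f = 0 then (if n' = n ∧ y = 0 then (rotation θ).1 0 0 * O.coef.1 x 0 else 0)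
      else (if y = 0 ∧ x = 0 ∧ n' = n then (rotation θ).1 f 0 else 0) := by
    intro f y x n'
    show (embed (nodeReg lay) (onWire (flagWire lay) 0) (onQubits (orInv false O.coef)) *ᵥ ψ₁) _ = _
    by_cases hf : f = 0
    · rw [embed_mulVec_of_meets _ _ _ (by rw [meets_onWire, anc_flagWire, hf]), if_pos hf,
        Fintype.sum_prod_type]
      simp only [extend_nodeReg, h₁, onQubits, Matrix.of_apply, anc_comp_nodeReg]
      rw [Finset.sum_eq_single 0]
      · rw [Finset.sum_eq_single n]
        · by_cases hn : n' = n <;> by_cases hy : y = 0 <;> simp [hn, hy, hf, orInv, mul_comm]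
        · intro k _ hk
          simp [hk]
        · simp
      · intro z _ hz
        simp [hz]
      · simp
    · rw [embed_mulVec_of_not_meets _ _ _ (by rwa [meets_onWire, anc_flagWire]), if_neg hf, h₁]
  show (embed (gridRegs lay) (onWire (flagWire lay) 1) (onQubits (orInv false O.coefB)) *ᵥ ψ₂) _ = _
  rcases (by omega : f = 0 ∨ f = 1) with hf | hf
  · rw [embed_mulVec_of_not_meets _ _ _ (by rw [meets_onWire, anc_flagWire, hf]; decide), h₂,
      if_pos hf, coefAmp, if_pos hf]
    by_cases hn : n' = n <;> by_cases hy : y = 0 <;> simp [hn, hy, rotation]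
  · have hf0 : f ≠ 0 := by rw [hf]; decide
    rw [embed_mulVec_of_meets _ _ _ (by rw [meets_onWire, anc_flagWire, hf]),
      Fintype.sum_prod_type]
    simp only [extend_gridRegs, h₂, onQubits, Matrix.of_apply, anc_comp_gridRegs, if_neg hf0,
      coefAmp]
    rw [Finset.sum_eq_single 0]
    · rw [Finset.sum_eq_single n]
      · by_cases hn : n' = n <;> simp [hn, hf, orInv, rotation, mul_comm, Pi.zero_comp]
      · intro k _ hk
        simp [hk]
      · simp
    · intro z _ hz
      have : ¬(z ∘ Sum.inl = 0 ∧ z ∘ Sum.inr = 0) := fun h => hz (funext fun i => by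
        rcases i with i | i
        · exact congrFun h.1 i
        · exact congrFun h.2 i)
      refine Finset.sum_eq_zero fun k _ => ?_
      rw [if_neg (c := _ ∧ _ ∧ _) fun h => this ⟨h.1, h.2.1⟩, mul_zero]
    · simp

lemma loadGates_mulVec (θ : ℝ) (f : Fin 2) (y : Bits (Fin mt)) (x : Bits (Fin m))
    (n : Fin N) : (gatesMatrix O (loadGates lay) *ᵥ
      (gatesMatrix O (coefGates lay θ) *ᵥ Pi.single (0, 0) 1)) (anc lay f y x, n) =
      if f = 0 then coefAmp O θ 0 y x * O.prep.1 n 0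
      else ∑ z : Bits (Fin mt), O.src.1 (y, n) (z, 0) * coefAmp O θ 1 z x := by
  set ψ := gatesMatrix O (coefGates lay θ) *ᵥ Pi.single (0, 0) 1
  rw [loadGates, gatesMatrix_cons, gatesMatrix_singleton, ← Matrix.mulVec_mulVec]
  show (embed (timeReg lay) (onWire (flagWire lay) 1) (orInv false O.src) *ᵥ
    (embed (noWires w) (onWire (flagWire lay) 0) (onSystem (orInv false O.prep)) *ᵥ ψ)) _ = _
  rcases (by omega : f = 0 ∨ f = 1) with rfl | rfl
  · rw [embed_mulVec_of_not_meets _ _ _ (by rw [meets_onWire, anc_flagWire]; decide),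
      embed_mulVec_of_meets _ _ _ (by rw [meets_onWire, anc_flagWire]), if_pos rfl,
      Fintype.sum_prod_type]
    simp only [extend_noWires, ψ, coefGates_mulVec, onSystem, Matrix.of_apply]
    simp [orInv, mul_comm]
  · rw [embed_mulVec_of_meets _ _ _ (by rw [meets_onWire, anc_flagWire]), if_neg (by decide),
      Fintype.sum_prod_type]
    refine Finset.sum_congr rfl fun z _ => ?_
    simp only [extend_timeReg, anc_comp_timeReg]
    have : ∀ k, (embed (noWires w) (onWire (flagWire lay) 0) (onSystem (orInv false O.prep)) *ᵥ ψ)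
        (anc lay 1 z x, k) = if k = 0 then coefAmp O θ 1 z x else 0 := fun k => by
      rw [embed_mulVec_of_not_meets _ _ _ (by rw [meets_onWire, anc_flagWire]; decide)]
      exact coefGates_mulVec lay O θ 0 1 z x k
    simp only [this]
    simp [orInv]

variable {O}

/-- The amplitudes for the inhomogeneous part. -/
lemma coefAmp_one (hO : O.Implements P K) (hP : P.Admissible p) (hK : 0 < K) (hm : 0 < m)
    (hmt : 0 < mt)
    {S β θ : ℝ} (hS : S = ∑ x : Bits (Fin m), cCoef K m (val x)) (hS0 : 0 < S)
    (hβ : β = ∑ y : Bits (Fin mt), P.tWeight mt (val y) * ‖P.b (tNode P.T mt (val y))‖)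
    (hsin : Real.sin θ = √(β / (‖P.u₀‖ + β)))
    (y : Bits (Fin mt)) (x : Bits (Fin m)) :
    coefAmp O θ 1 y x = (√(cCoefB P K m mt (val x) (val y) / (S * (‖P.u₀‖ + β))) : ℝ) := by
  have hterm : ∀ y : Bits (Fin mt), 0 ≤ P.tWeight mt (val y) * ‖P.b (tNode P.T mt (val y))‖ :=
    fun y => mul_nonneg (hP.tWeight_nonneg hmt _) (norm_nonneg _)
  have hβ0 : 0 ≤ β := hβ ▸ Finset.sum_nonneg fun y _ => hterm y
  have hB : ∀ j j', cCoefB P K m mt j j' =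
      cCoef K m j * (P.tWeight mt j' * ‖P.b (tNode P.T mt j')‖) := by
    intro j j'
    unfold cCoefB ODEData.tWeight
    ring
  have hsum : ∑ y' : Bits (Fin mt), ∑ y : Bits (Fin m), cCoefB P K m mt (val y) (val y') = S * β := by
    simp only [hB]
    rw [hS, hβ, Finset.sum_comm, Finset.sum_mul_sum]
  have hc := hO.coefB y x
  rw [hsum] at hc
  have hB0 : 0 ≤ cCoefB P K m mt (val x) (val y) := by
    rw [hB]
    exact mul_nonneg (cCoef_nonneg hK.le hm _) (hterm y)
  rw [coefAmp, if_neg (by decide), hsin]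
  -- For `β = 0` the oracle `coefB` is unconstrained, but then `sin θ = 0` and all the coefficients
  -- vanish.
  rcases hβ0.eq_or_lt with h0 | h0
  · have hy : P.tWeight mt (val y) * ‖P.b (tNode P.T mt (val y))‖ = 0 := by
      have := (Finset.sum_eq_zero_iff_of_nonneg fun y _ => hterm y).1 (hβ.symm.trans h0.symm)
      exact this y (Finset.mem_univ y)
    rw [hB, hy, ← h0]
    simp
  · have hSβ : (√(S * β) : ℂ) ≠ 0 := by
      exact_mod_cast (Real.sqrt_pos.2 (mul_pos hS0 h0)).ne'
    have e : √(cCoefB P K m mt (val x) (val y) / (S * (‖P.u₀‖ + β))) * √(S * β) =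
        √(β / (‖P.u₀‖ + β)) * √(cCoefB P K m mt (val x) (val y)) := by
      rw [← Real.sqrt_mul (by positivity), ← Real.sqrt_mul (by positivity)]
      congr 1
      field_simp
    refine mul_right_cancel₀ hSβ ?_
    rw [mul_assoc, mul_comm (O.coefB.1 _ _), hc]
    exact_mod_cast e.symm

/-- The amplitudes for the homogeneous part. -/
lemma coefAmp_zero (hO : O.Implements P K) {S β θ : ℝ} (hS : S = ∑ x : Bits (Fin m), cCoef K m (val x)) (hS0 : 0 < S)
    (hpos : 0 < ‖P.u₀‖ + β) (hcos : Real.cos θ = √(‖P.u₀‖ / (‖P.u₀‖ + β)))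
    (y : Bits (Fin mt)) (x : Bits (Fin m)) :
    coefAmp O θ 0 y x =
      if y = 0 then ((√(‖P.u₀‖ * cCoef K m (val x) / (S * (‖P.u₀‖ + β))) : ℝ) : ℂ) else 0 := by
  rw [coefAmp, if_pos rfl]
  by_cases hy : y = 0
  · rw [if_pos hy, if_pos hy, hcos]
    have hc := hO.coef x
    rw [← hS] at hc
    have hS' : (√S : ℂ) ≠ 0 := by exact_mod_cast (Real.sqrt_pos.2 hS0).ne'
    have e : √(‖P.u₀‖ * cCoef K m (val x) / (S * (‖P.u₀‖ + β))) * √S =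
        √(‖P.u₀‖ / (‖P.u₀‖ + β)) * √(cCoef K m (val x)) := by
      rw [← Real.sqrt_mul' _ hS0.le, ← Real.sqrt_mul (by positivity)]
      congr 1
      field_simp
    refine mul_right_cancel₀ hS' ?_
    rw [mul_assoc, mul_comm (O.coef.1 _ _), hc]
    exact_mod_cast e.symm
  · rw [if_neg hy, if_neg hy]

/-- The circuit encodes the linear combination of product formulas. -/
theorem zeroBlock_lchsGates (hO : O.Implements P K) (hP : P.Admissible p) (hK : 1 ≤ K)
    (hm : 0 < m) (hmt : 0 < mt) (hr : StepsInRange P p K r) {S β θ : ℝ}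
    (hS : S = ∑ x : Bits (Fin m), cCoef K m (val x)) (hS0 : 0 < S)
    (hβ : β = ∑ y : Bits (Fin mt), P.tWeight mt (val y) * ‖P.b (tNode P.T mt (val y))‖)
    (hpos : 0 < ‖P.u₀‖ + β) (hcos : Real.cos θ = √(‖P.u₀‖ / (‖P.u₀‖ + β)))
    (hsin : Real.sin θ = √(β / (‖P.u₀‖ + β))) :
    zeroBlock O (lchsGates lay p P.T K r θ) =
      (S * (‖P.u₀‖ + β))⁻¹ • P.lchsVector p r K m mt := by
  have hK0 : 0 < K := by linarith
  have hβ0 : 0 ≤ β := hβ ▸ Finset.sum_nonneg fun y _ =>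
    mul_nonneg (hP.tWeight_nonneg hmt _) (norm_nonneg _)
  set Λ := S * (‖P.u₀‖ + β) with hΛ
  have hΛ0 : 0 < Λ := mul_pos hS0 hpos
  have hrev : ∀ g ∈ coefGates lay θ, g.Reversible O := fun g hg =>
    lchsGates_reversible lay hO hP hK hmt hr θ g (List.mem_append_left _ hg)
  set V : Bits (Fin mt) → Bits (Fin m) → Matrix (Fin N) (Fin N) ℂ := fun y x =>
    P.approxProp p r (tNode P.T mt (val y)) (kNode K m (val x)) with hV
  set φ : Fin 2 → Bits (Fin mt) → Bits (Fin m) → Fin N → ℂ := fun f y x n =>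
    if f = 0 then coefAmp O θ 0 y x * O.prep.1 n 0
      else ∑ z : Bits (Fin mt), O.src.1 (y, n) (z, 0) * coefAmp O θ 1 z x with hφ
  -- The inverse of `coefGates` turns the entry at `(0, n)` into an inner product with the prepared
  -- amplitudes. Each amplitude thus occurs twice, which squares the square roots away.
  have hG : ∀ n, zeroBlock O (lchsGates lay p P.T K r θ) n =
      ∑ f, ∑ y, ∑ x, (V y x *ᵥ (star (coefAmp O θ f y x) • φ f y x)) n := by
    intro n
    have e1 : zeroBlock O (lchsGates lay p P.T K r θ) n =
        (star (gatesMatrix O (coefGates lay θ) *ᵥ Pi.single (0, n) 1)) ⬝ᵥ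
          (gatesMatrix O (selectGates lay p P.T K r) *ᵥ (gatesMatrix O (loadGates lay) *ᵥ
            (gatesMatrix O (coefGates lay θ) *ᵥ Pi.single (0, 0) 1))) := by
      rw [Matrix.star_mulVec, ← Matrix.dotProduct_mulVec, ← Pi.single_star, star_one,
        single_dotProduct, one_mul, Matrix.mulVec_mulVec, Matrix.mulVec_mulVec,
        Matrix.mulVec_mulVec, Matrix.mulVec_single_one, ← gatesMatrix_inverseGates O hrev,
        lchsGates, zeroBlock]
      simp only [gatesMatrix_append, Matrix.mul_assoc]
      rfl
    rw [e1, gatesMatrix_selectGates lay hO hP hK hmt hr, dotProduct, Fintype.sum_prod_type,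
      ← (ancEquiv lay).sum_comp]
    simp only [Fintype.sum_prod_type]
    refine Finset.sum_congr rfl fun f _ => Finset.sum_congr rfl fun y _ =>
      Finset.sum_congr rfl fun x _ => ?_
    show ∑ n', star ((gatesMatrix O (coefGates lay θ) *ᵥ Pi.single (0, n) 1) (anc lay f y x, n')) *
      (blockMat _ *ᵥ _) (anc lay f y x, n') = _
    simp only [coefGates_mulVec, blockMat_mulVec, anc_comp_timeReg, anc_comp_nodeReg,
      loadGates_mulVec]
    rw [Finset.sum_eq_single n (fun k _ hk => by simp [hk]) (by simp), if_pos rfl,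
      Matrix.mulVec_smul]
    rfl
  have h0 : ∀ y x, star (coefAmp O θ 0 y x) • φ 0 y x =
      if y = 0 then ((cCoef K m (val x) / Λ : ℝ) : ℂ) • (P.u₀ : Fin N → ℂ) else 0 := by
    intro y x
    funext n
    have hc := cCoef_nonneg hK0.le hm (val x)
    simp only [hφ, if_true, Pi.smul_apply, smul_eq_mul,
      coefAmp_zero hO hS hS0 hpos hcos]
    by_cases hy : y = 0
    · simp only [if_pos hy, Pi.smul_apply, smul_eq_mul, Complex.star_def, Complex.conj_ofReal]
      rw [← hΛ, ← mul_assoc, ← Complex.ofReal_mul, Real.mul_self_sqrt (by positivity),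
        ← hO.prep n]
      push_cast
      ring
    · simp [hy]
  have h1 : ∀ y x, star (coefAmp O θ 1 y x) • φ 1 y x =
      ((P.tWeight mt (val y) * cCoef K m (val x) / Λ : ℝ) : ℂ) •
        (P.b (tNode P.T mt (val y)) : Fin N → ℂ) := by
    intro y x
    funext n
    have hc := cCoef_nonneg hK0.le hm (val x)
    have ht := hP.tWeight_nonneg hmt (val y)
    have hB : ∀ y : Bits (Fin mt), cCoefB P K m mt (val x) (val y) / Λ =
        (P.tWeight mt (val y) * cCoef K m (val x) / Λ) * ‖P.b (tNode P.T mt (val y))‖ := by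
      intro y
      unfold cCoefB ODEData.tWeight
      ring
    -- Off the diagonal the oracle entry vanishes unless the source is zero at the node; in that
    -- case the oracle is arbitrary, but the amplitude is zero.
    have hsrc : ∀ z : Bits (Fin mt), O.src.1 (y, n) (z, 0) * coefAmp O θ 1 z x =
        if y = z then O.src.1 (y, n) (y, 0) * coefAmp O θ 1 y x else 0 := by
      intro z
      by_cases hyz : y = z
      · rw [if_pos hyz, hyz]
      · rw [if_neg hyz, coefAmp_one hO hP hK0 hm hmt hS hS0 hβ hsin, hB]
        by_cases hb : ‖P.b (tNode P.T mt (val z))‖ = 0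
        · simp [hb]
        · have := hO.src z y n
          rw [if_neg hyz, mul_eq_zero] at this
          rw [this.resolve_left (by exact_mod_cast hb), zero_mul]
    simp only [hφ, if_neg (one_ne_zero : (1 : Fin 2) ≠ 0), Pi.smul_apply, smul_eq_mul]
    rw [Finset.sum_congr rfl fun z _ => hsrc z, Finset.sum_ite_eq, if_pos (Finset.mem_univ _), ← mul_assoc, mul_comm (star _), mul_assoc,
      coefAmp_one hO hP hK0 hm hmt hS hS0 hβ hsin, hB, Complex.star_def, Complex.conj_ofReal,
      ← Complex.ofReal_mul, Real.mul_self_sqrt (by positivity)]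
    have := hO.src y y n
    rw [if_pos rfl] at this
    rw [← this]
    push_cast
    ring
  ext n
  rw [hG n, Fin.sum_univ_two]
  simp only [h0, h1]
  rw [Finset.sum_eq_single (0 : Bits (Fin mt)) (fun y _ hy => by simp [hy]) (by simp)]
  simp only [if_true, Matrix.mulVec_smul, Pi.smul_apply, smul_eq_mul, ODEData.lchsVector]
  -- The homogeneous part leaves the time register at zero, which encodes the starting time `0` for
  -- the common product formula.
  have hz : tNode P.T mt (val (0 : Bits (Fin mt))) = 0 := by
    have : val (0 : Bits (Fin mt)) = 0 := by
      rw [val, finFunctionFinEquiv_apply]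
      simp
    simp [tNode, this]
  simp only [PiLp.smul_apply, PiLp.add_apply, WithLp.ofLp_sum, WithLp.ofLp_smul, Finset.sum_apply,
    Pi.smul_apply, Matrix.ofLp_toEuclideanCLM, hV, hz, Complex.real_smul, mul_add, Finset.mul_sum]
  push_cast
  congr 1
  · refine Finset.sum_congr rfl fun x _ => ?_
    ring
  · refine Finset.sum_congr rfl fun y _ => Finset.sum_congr rfl fun x _ => ?_
    ring

end BlockEncoding

/-! ### Elementary estimates -/

section Elementary

lemma amplification_rounds_le (x : ℝ) : 2 * (⌊(1 / x - 1) / 2⌋₊ : ℝ) + 1 ≤ max 1 (1 / x) := by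
  rcases le_or_gt 0 ((1 / x - 1) / 2) with h | h
  · have := Nat.floor_le h
    exact le_max_of_le_right (by linarith)
  · rw [Nat.floor_of_nonpos h.le]
    simp

/-- Amplitude amplification with an approximately known amplitude `σ ≈ x`. -/
lemma amplified_sin_ge {x σ : ℝ} (hx : 0 < x) (hσ : σ ≤ 1) (h : |σ - x| ≤ x / 15) :
    1 / 6 ≤ Real.sin ((2 * (⌊(1 / x - 1) / 2⌋₊ : ℝ) + 1) * Real.arcsin σ) := by
  set n := ⌊(1 / x - 1) / 2⌋₊ with hn
  obtain ⟨h1, h2⟩ := abs_le.1 h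
  have hσ0 : 0 < σ := by linarith
  have hpi := Real.pi_gt_three
  have hpi' := Real.pi_lt_d2
  have hθ0 := Real.arcsin_nonneg.2 hσ0.le
  have hθ1 := Real.arcsin_le_pi_div_two σ
  set θ := Real.arcsin σ with hθ
  have hsin : Real.sin θ = σ := Real.sin_arcsin (by linarith) hσ
  have hθσ : σ ≤ θ := hsin ▸ Real.sin_le hθ0
  have hθσ' : θ ≤ Real.pi / 2 * σ := by
    have := Real.mul_le_sin hθ0 hθ1
    rw [hsin, div_mul_eq_mul_div, div_le_iff₀ Real.pi_pos] at this
    linarith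
  have hfl := Nat.lt_floor_add_one ((1 / x - 1) / 2)
  rw [← hn] at hfl
  have hn0 : (0 : ℝ) ≤ n := Nat.cast_nonneg n
  have hxx : 1 / x * x = 1 := by field_simp
  have hx' : 0 < 1 / x := by positivity
  set φ := (2 * (n : ℝ) + 1) * θ with hφ
  -- The product of `1 / (3 x)` and the lower bound `14 x / 15` for `θ`; the first is a bound for `2
  -- n + 1`, which is at least `1` and exceeds `1 / x - 2`.
  have hlow : 14 / 45 ≤ φ := by
    have h3 : 1 / (3 * x) ≤ 2 * n + 1 := by
      rw [show 1 / (3 * x) = 1 / x / 3 by field_simp]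
      rcases le_total (1 / x) 3 with h | h <;> linarith
    calc (14 / 45 : ℝ) = 1 / (3 * x) * (14 / 15 * x) := by field_simp; norm_num
      _ ≤ (2 * n + 1) * θ := mul_le_mul h3 (by linarith) (by positivity) (by positivity)
  -- `θ ≤ (π / 2) σ` with `σ ≤ 16 x / 15`, so a slight overshoot beyond `π / 2` is allowed for;
  -- without any round `φ = θ ≤ π / 2`.
  have hup : φ ≤ 8 / 15 * Real.pi := by
    rcases Nat.eq_zero_or_pos n with h0 | h0
    · have : φ = θ := by rw [hφ, h0]; simp
      rw [this]
      linarith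
    · have h4 : 2 * (n : ℝ) + 1 ≤ 1 / x := by
        have h5 : (1 : ℝ) ≤ n := by exact_mod_cast h0
        rcases le_or_gt 0 ((1 / x - 1) / 2) with h | h
        · have := Nat.floor_le h
          rw [← hn] at this
          linarith
        · rw [hn, Nat.floor_of_nonpos h.le] at h0
          exact absurd h0 (lt_irrefl 0)
      calc φ ≤ 1 / x * (Real.pi / 2 * (16 / 15 * x)) := by
            refine mul_le_mul h4 (hθσ'.trans ?_) hθ0 hx'.le
            gcongr
            linarith
        _ = 8 / 15 * Real.pi * (1 / x * x) := by ring
        _ = 8 / 15 * Real.pi := by rw [hxx, mul_one]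
  rcases le_total φ (Real.pi / 2) with h | h
  · refine le_trans ?_ (Real.mul_le_sin (by linarith) h)
    rw [div_mul_eq_mul_div, le_div_iff₀ Real.pi_pos]
    linarith
  · rw [← Real.sin_pi_sub]
    refine le_trans ?_ (Real.mul_le_sin (x := Real.pi - φ) (by linarith) (by linarith))
    rw [div_mul_eq_mul_div, le_div_iff₀ Real.pi_pos]
    linarith

lemma norm_ket_sub_ket_le {N : ℕ} {v u : EuclideanSpace ℂ (Fin N)} (hv : v ≠ 0) (hu : u ≠ 0) :
    ‖ket v - ket u‖ ≤ 2 * ‖v - u‖ / ‖u‖ := by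
  have hv' : (‖v‖ : ℂ) ≠ 0 := by exact_mod_cast norm_ne_zero_iff.2 hv
  have hu' : (‖u‖ : ℂ) ≠ 0 := by exact_mod_cast norm_ne_zero_iff.2 hu
  have hvp := norm_pos_iff.2 hv
  have hup := norm_pos_iff.2 hu
  have e : ket v - ket u = (‖u‖ : ℂ)⁻¹ • (v - u) +
      ((((‖u‖ - ‖v‖) / (‖v‖ * ‖u‖) : ℝ)) : ℂ) • v := by
    have : (‖v‖ : ℂ)⁻¹ = (‖u‖ : ℂ)⁻¹ + ((((‖u‖ - ‖v‖) / (‖v‖ * ‖u‖) : ℝ)) : ℂ) := by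
      push_cast
      field_simp
      ring
    unfold ket
    rw [this]
    module
  rw [e]
  refine (norm_add_le _ _).trans ?_
  rw [norm_smul, norm_smul, norm_inv, Complex.norm_real, Complex.norm_real, norm_norm,
    Real.norm_eq_abs, abs_div, abs_of_pos (mul_pos hvp hup)]
  have h1 : |‖u‖ - ‖v‖| ≤ ‖v - u‖ := by
    rw [norm_sub_rev]
    exact abs_norm_sub_norm_le u v
  calc _ ≤ ‖u‖⁻¹ * ‖v - u‖ + ‖v - u‖ / (‖v‖ * ‖u‖) * ‖v‖ := by gcongr
    _ = _ := by
      field_simp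
      ring

lemma ket_smul_of_pos {N : ℕ} (v : EuclideanSpace ℂ (Fin N)) {c : ℝ} (hc : 0 < c) :
    ket (c • v) = ket v := by
  have hc' : (c : ℂ) ≠ 0 := by exact_mod_cast hc.ne'
  rw [ket, ket, norm_smul, Real.norm_of_nonneg hc.le, ← Complex.coe_smul, smul_smul]
  congr 1
  push_cast
  rw [mul_inv, mul_right_comm, inv_mul_cancel₀ hc', one_mul]

/-- The number of qubits of a grid with at least `Z` cells. -/
def gridBits (Z : ℝ) : ℕ := ⌈Real.logb 2 (1 + Z)⌉₊ + 1

lemma gridBits_pos (Z : ℝ) : 0 < gridBits Z := Nat.succ_pos _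

lemma le_gridM_gridBits {Z : ℝ} (hZ : 0 ≤ Z) : Z ≤ gridM (gridBits Z) := by
  have h1 : Real.logb 2 (1 + Z) ≤ (gridBits Z : ℝ) := by
    rw [gridBits]
    push_cast
    linarith [Nat.le_ceil (Real.logb 2 (1 + Z))]
  rw [Real.logb_le_iff_le_rpow (by norm_num) (by linarith), Real.rpow_natCast] at h1
  unfold gridM
  linarith

lemma one_le_log_of_four_le {Y : ℝ} (hY : 4 ≤ Y) : 1 ≤ Real.log Y := by
  have h1 : Real.log 4 ≤ Real.log Y := Real.log_le_log (by norm_num) hY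
  have h2 : Real.log 4 = 2 * Real.log 2 := by
    rw [show (4 : ℝ) = 2 ^ 2 by norm_num, Real.log_pow]
    norm_num
  linarith [Real.log_two_gt_d9]

/-- Since `log Y ≥ 1`, the constants from `log B` and from rounding can be absorbed into a multiple
of `log Y`. -/
lemma gridBits_le {Z B Y : ℝ} {k : ℕ} (hZ : 0 ≤ Z) (hB : 1 ≤ B) (hY : 4 ≤ Y)
    (h : 1 + Z ≤ B * Y ^ k) : (gridBits Z : ℝ) ≤ (2 * Real.log B + 2 * k + 2) * Real.log Y := by
  have hlog := one_le_log_of_four_le hY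
  have hB' := Real.log_nonneg hB
  have h1 : Real.log (1 + Z) ≤ Real.log B + k * Real.log Y := by
    rw [← Real.log_pow, ← Real.log_mul (by positivity) (by positivity)]
    exact Real.log_le_log (by linarith) h
  have h0 : 0 ≤ Real.log (1 + Z) := Real.log_nonneg (by linarith)
  have h2 : Real.logb 2 (1 + Z) ≤ 2 * Real.log (1 + Z) := by
    rw [Real.logb, div_le_iff₀ (Real.log_pos (by norm_num))]
    nlinarith [Real.log_two_gt_d9]
  have h3 : (⌈Real.logb 2 (1 + Z)⌉₊ : ℝ) < Real.logb 2 (1 + Z) + 1 :=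
    Nat.ceil_lt_add_one (Real.logb_nonneg (by norm_num) (by linarith))
  rw [gridBits]
  push_cast
  nlinarith

end Elementary

/-! ### Gate counts -/

section Counts

variable {m mt w : ℕ}

/-- Whether a gate is a query to the input models of `H` and `L`. -/
def Gate.isMatrixQuery : Gate m mt w → Bool
  | .query (.simL _ _) _ _ => true
  | .query (.simH _ _) _ _ => true
  | .query (.simLT _ _ _ _) _ _ => true
  | .query (.simHT _ _ _ _) _ _ => true
  | _ => false

/-- Whether a gate is a query to the initial state or the source. -/
def Gate.isStateQuery : Gate m mt w → Bool
  | .query (.prep _) _ _ => true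
  | .query (.src _ _) _ _ => true
  | _ => false

/-- Whether a gate is a query to the coefficient oracles. -/
def Gate.isCoefQuery : Gate m mt w → Bool
  | .query (.coef _ _) _ _ => true
  | .query (.coefB _ _) _ _ => true
  | _ => false

/-- Whether a gate is a one-qubit gate or a reflection. -/
def Gate.isOther : Gate m mt w → Bool
  | .query _ _ _ => false
  | _ => true

lemma Circuit.matrixQueries_eq (Q : Circuit) :
    Q.matrixQueries = Q.gates.countP Gate.isMatrixQuery := by
  unfold Circuit.matrixQueries
  congr 1
  funext g
  rcases g with _ | _ | ⟨o, _, _⟩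
  · rfl
  · rfl
  · cases o <;> rfl

lemma Circuit.stateQueries_eq (Q : Circuit) :
    Q.stateQueries = Q.gates.countP Gate.isStateQuery := by
  unfold Circuit.stateQueries
  congr 1
  funext g
  rcases g with _ | _ | ⟨o, _, _⟩
  · rfl
  · rfl
  · cases o <;> rfl

lemma Circuit.coefQueries_eq (Q : Circuit) :
    Q.coefQueries = Q.gates.countP Gate.isCoefQuery := by
  unfold Circuit.coefQueries
  congr 1
  funext g
  rcases g with _ | _ | ⟨o, _, _⟩
  · rfl
  · rfl
  · cases o <;> rfl

lemma Circuit.otherGates_eq (Q : Circuit) :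
    Q.otherGates = Q.gates.countP Gate.isOther := by
  unfold Circuit.otherGates
  congr 1
  funext g
  rcases g with _ | _ | ⟨o, _, _⟩
  · rfl
  · rfl
  · rfl

lemma countP_inverseGates {f : Gate m mt w → Bool} (hf : ∀ g, f g.inverse = f g)
    (l : List (Gate m mt w)) : (inverseGates l).countP f = l.countP f := by
  rw [inverseGates, List.countP_reverse, List.countP_map]
  congr 1
  funext g
  exact hf g

lemma countP_amplified {f : Gate m mt w → Bool} (hf : ∀ g, f g.inverse = f g) (i : Fin w)
    (l : List (Gate m mt w)) (n : ℕ) : (amplified i l n).countP f =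
      (2 * n + 1) * l.countP f + n * ([.reflect Finset.univ false, .reflect Finset.univ true,
        .oneQubit i (-1)] : List (Gate m mt w)).countP f := by
  induction n with
  | zero => simp [amplified]
  | succ n ih =>
    rw [amplified, List.countP_append, ih, amplifyRound]
    simp only [List.countP_cons, List.countP_append, countP_inverseGates hf, List.countP_nil]
    ring

lemma isMatrixQuery_inverse (g : Gate m mt w) : g.inverse.isMatrixQuery = g.isMatrixQuery := by
  rcases g with _ | _ | ⟨o, _, _⟩
  · rfl
  · rfl
  · cases o <;> rfl

lemma isStateQuery_inverse (g : Gate m mt w) : g.inverse.isStateQuery = g.isStateQuery := by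
  rcases g with _ | _ | ⟨o, _, _⟩
  · rfl
  · rfl
  · cases o <;> rfl

lemma isCoefQuery_inverse (g : Gate m mt w) : g.inverse.isCoefQuery = g.isCoefQuery := by
  rcases g with _ | _ | ⟨o, _, _⟩
  · rfl
  · rfl
  · cases o <;> rfl

lemma isOther_inverse (g : Gate m mt w) : g.inverse.isOther = g.isOther := by
  rcases g with _ | _ | ⟨o, _, _⟩
  · rfl
  · rfl
  · cases o <;> rfl

variable (lay : Unit ⊕ (Fin mt ⊕ Fin m) ≃ Fin w) (p : ℕ) (T K : ℝ) (r : ℕ) (θ : ℝ)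

lemma countP_selectGates_eq_zero {f : Gate m mt w → Bool}
    (hf : ∀ g, g.isMatrixQuery = true → f g = false) :
    (selectGates lay p T K r).countP f = 0 := by
  rw [List.countP_eq_zero]
  intro g hg
  simp only [selectGates, List.mem_flatMap, List.mem_range, List.mem_reverse] at hg
  obtain ⟨ℓ, hℓ, a, ha, hg⟩ := hg
  rw [hf g]
  · simp
  unfold stageGates at hg
  split_ifs at hg
  · rcases List.mem_cons.1 hg with rfl | hg
    · rfl
    · obtain ⟨l, _, rfl⟩ := List.mem_map.1 hg
      rfl
  · rw [List.mem_singleton] at hg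
    subst hg
    rfl

lemma countP_flatMap_le {α β : Type*} (f : β → Bool) (l : List α) (g : α → List β) (B : ℕ)
    (h : ∀ a ∈ l, (g a).countP f ≤ B) : (l.flatMap g).countP f ≤ l.length * B := by
  induction l with
  | nil => simp
  | cons a l ih =>
    rw [List.flatMap_cons, List.countP_append, List.length_cons, add_mul, one_mul, add_comm]
    exact Nat.add_le_add (ih fun b hb => h b (List.mem_cons_of_mem _ hb)) (h a List.mem_cons_self)

lemma countP_selectGates_le (f : Gate m mt w → Bool) :
    (selectGates lay p T K r).countP f ≤ r * ((suzuki p).length * (m + 1)) := by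
  have := countP_flatMap_le f (List.range r)
    (fun ℓ => (suzuki p).reverse.flatMap (stageGates lay T K r ℓ)) ((suzuki p).length * (m + 1))
    fun ℓ _ => by
      have := countP_flatMap_le f (suzuki p).reverse (stageGates lay T K r ℓ) (m + 1) fun a _ => by
        refine (List.countP_le_length).trans ?_
        unfold stageGates
        split_ifs <;> simp
      rwa [List.length_reverse] at this
  rwa [List.length_range] at this

lemma matrixQueries_lchsGates :
    (lchsGates lay p T K r θ).countP Gate.isMatrixQuery ≤ r * ((suzuki p).length * (m + 1)) := by
  simp only [lchsGates, List.countP_append, countP_inverseGates isMatrixQuery_inverse]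
  have := countP_selectGates_le lay p T K r Gate.isMatrixQuery
  have h1 : (coefGates lay θ).countP Gate.isMatrixQuery = 0 := rfl
  have h2 : (loadGates lay).countP Gate.isMatrixQuery = 0 := rfl
  omega

lemma stateQueries_lchsGates :
    (lchsGates lay p T K r θ).countP Gate.isStateQuery = 2 := by
  simp only [lchsGates, List.countP_append, countP_inverseGates isStateQuery_inverse]
  rw [countP_selectGates_eq_zero]
  · rfl
  · rintro (_ | _ | ⟨o, _, _⟩) hg
    · rfl
    · rfl
    · cases o <;> first | rfl | exact absurd hg (by simp [Gate.isMatrixQuery])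

lemma coefQueries_lchsGates :
    (lchsGates lay p T K r θ).countP Gate.isCoefQuery = 4 := by
  simp only [lchsGates, List.countP_append, countP_inverseGates isCoefQuery_inverse]
  rw [countP_selectGates_eq_zero]
  · rfl
  · rintro (_ | _ | ⟨o, _, _⟩) hg
    · rfl
    · rfl
    · cases o <;> first | rfl | exact absurd hg (by simp [Gate.isMatrixQuery])

lemma otherGates_lchsGates :
    (lchsGates lay p T K r θ).countP Gate.isOther = 2 := by
  simp only [lchsGates, List.countP_append, countP_inverseGates isOther_inverse]
  rw [countP_selectGates_eq_zero]
  · rfl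
  · rintro (_ | _ | ⟨o, _, _⟩) hg
    · exact absurd hg (by simp [Gate.isMatrixQuery])
    · exact absurd hg (by simp [Gate.isMatrixQuery])
    · rfl

end Counts

/-! ### The algorithm -/

namespace ClassicalData

variable (p : ℕ) (D : ℝ) (d : ClassicalData)

/-- `(‖u₀‖ + ‖b‖_{L¹}) / ‖u(T)‖` -/
def normRatio : ℝ := (d.u₀Norm + ∫ s in (0 : ℝ)..d.T, d.bNorm s) / d.uTNorm

/-- The cutoff `K` of the `k`-integral. -/
def cutoff : ℝ := max 2 (64 * D * d.normRatio / d.ε)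

/-- The number of qubits for the `k`-grid. -/
def nodeBits : ℕ := gridBits (d.cutoff D ^ 3 * (1 + d.T * d.Γ₁))

/-- The number of qubits for the time grid. -/
def timeBits : ℕ := gridBits (32 * (d.T ^ 2 * ((1 + d.Γ₁) * d.bC2)) / (d.ε * d.uTNorm))

/-- The number of steps of the product formula. -/
def steps : ℕ :=
  if d.cutoff D * d.Γp * d.T ≤ 1 then 0
  else ⌈D * (d.cutoff D * d.Γp * d.T) ^ (1 + 1 / (p : ℝ))⌉₊

/-- `‖c‖₁` -/
def coefSum : ℝ := ∑ x : Bits (Fin (d.nodeBits D)), cCoef (d.cutoff D) (d.nodeBits D) (val x)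

/-- The trapezoidal approximation of `‖b‖_{L¹}`. -/
def sourceSum : ℝ := ∑ y : Bits (Fin d.timeBits),
  endFactor d.timeBits (val y) * d.T / (2 * gridM d.timeBits) *
    d.bNorm (tNode d.T d.timeBits (val y))

/-- The angle of the rotation of the flag qubit. -/
def angle : ℝ := Real.arcsin √(d.sourceSum / (d.u₀Norm + d.sourceSum))

/-- The approximate amplitude of the solution before amplification. -/
def amplitude : ℝ := d.uTNorm / (d.coefSum D * (d.u₀Norm + d.sourceSum))

/-- The number of rounds of amplitude amplification. -/
def rounds : ℕ := ⌊(1 / d.amplitude D - 1) / 2⌋₊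

end ClassicalData

/-- The standard layout of the ancilla qubits. -/
def stdLayout (mt m : ℕ) : Unit ⊕ (Fin mt ⊕ Fin m) ≃ Fin (1 + (mt + m)) :=
  Fintype.equivFinOfCardEq (by simp)

/-- The circuit for the given classical data. -/
def lchsCircuit (p : ℕ) (D : ℝ) (d : ClassicalData) : Circuit where
  K := d.cutoff D
  m := d.nodeBits D
  mt := d.timeBits
  w := 1 + (d.timeBits + d.nodeBits D)
  gates := amplified (flagWire (stdLayout d.timeBits (d.nodeBits D)))
    (lchsGates (stdLayout d.timeBits (d.nodeBits D)) p d.T (d.cutoff D) (d.steps p D) d.angle)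
    (d.rounds D)
  K_pos := lt_max_of_lt_left two_pos
  m_pos := gridBits_pos _
  mt_pos := gridBits_pos _

lemma stateQueries_lchsCircuit (p : ℕ) (D : ℝ) (d : ClassicalData) :
    (lchsCircuit p D d).stateQueries = 2 * (2 * d.rounds D + 1) := by
  rw [Circuit.stateQueries_eq, lchsCircuit, countP_amplified isStateQuery_inverse,
    stateQueries_lchsGates]
  simp [Gate.isStateQuery]
  ring

lemma coefQueries_lchsCircuit (p : ℕ) (D : ℝ) (d : ClassicalData) :
    (lchsCircuit p D d).coefQueries = 4 * (2 * d.rounds D + 1) := by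
  rw [Circuit.coefQueries_eq, lchsCircuit, countP_amplified isCoefQuery_inverse,
    coefQueries_lchsGates]
  simp [Gate.isCoefQuery]
  ring

lemma otherGates_lchsCircuit (p : ℕ) (D : ℝ) (d : ClassicalData) :
    (lchsCircuit p D d).otherGates = 2 * (2 * d.rounds D + 1) + 3 * d.rounds D := by
  rw [Circuit.otherGates_eq, lchsCircuit, countP_amplified isOther_inverse,
    otherGates_lchsGates]
  change _ + d.rounds D * 3 = _
  ring

lemma matrixQueries_lchsCircuit_le (p : ℕ) (D : ℝ) (d : ClassicalData) :
    (lchsCircuit p D d).matrixQueries ≤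
      (2 * d.rounds D + 1) * (d.steps p D * ((suzuki p).length * (d.nodeBits D + 1))) := by
  rw [Circuit.matrixQueries_eq, lchsCircuit, countP_amplified isMatrixQuery_inverse]
  simp only [Gate.isMatrixQuery, List.countP_cons, List.countP_nil]
  simp only [Bool.false_eq_true, if_false, add_zero, mul_zero]
  exact Nat.mul_le_mul_left _ (matrixQueries_lchsGates _ _ _ _ _ _)

/-! ### Analysis of the algorithm -/

section Analysis

variable {N : ℕ} [NeZero N] {P : ODEData N} {p : ℕ} {u : ℝ → EuclideanSpace ℂ (Fin N)} {ε : ℝ}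

lemma normRatio_classicalData (hP : P.Admissible p) :
    (classicalData P u p ε).normRatio = ratio P u := by
  unfold ClassicalData.normRatio ratio ODEData.bL1
  congr 2
  refine intervalIntegral.integral_congr fun s hs => ?_
  change s ∈ [[0, P.T]] at hs
  rw [uIcc_of_le hP.T_pos.le] at hs
  change (Icc 0 P.T).indicator (fun s => ‖P.b s‖) s = _
  rw [indicator_of_mem hs]

lemma sourceSum_classicalData (hP : P.Admissible p) :
    (classicalData P u p ε).sourceSum = ∑ y : Bits (Fin (classicalData P u p ε).timeBits),
      P.tWeight (classicalData P u p ε).timeBits (val y) *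
        ‖P.b (tNode P.T (classicalData P u p ε).timeBits (val y))‖ := by
  refine Finset.sum_congr rfl fun y _ => ?_
  change _ * (Icc 0 P.T).indicator (fun s => ‖P.b s‖) _ = _
  rw [indicator_of_mem]
  · rfl
  · exact hP.tNode_mem (gridBits_pos _) y

lemma one_le_ratio (hP : P.Admissible p) (hu : P.IsSolution u) (huT : u P.T ≠ 0) :
    1 ≤ ratio P u := by
  rw [ratio, one_le_div (norm_pos_iff.2 huT)]
  exact hP.norm_solution_le hu

/-- As `ε ≤ 1 ≤ q`, the lower limit `2` in the cutoff is not active. -/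
lemma cutoff_classicalData (hP : P.Admissible p) (hu : P.IsSolution u) (huT : u P.T ≠ 0)
    (hε : 0 < ε) (hε1 : ε ≤ 1) {D : ℝ} (hD : 2 ≤ D) :
    (classicalData P u p ε).cutoff D = 64 * D * (ratio P u / ε) := by
  have hq := one_le_ratio hP hu huT
  have h1 : 1 ≤ ratio P u / ε := (one_le_div hε).2 (hε1.trans hq)
  rw [ClassicalData.cutoff, normRatio_classicalData hP]
  change max 2 (64 * D * ratio P u / ε) = _
  rw [mul_div_assoc, max_eq_right]
  nlinarith

/-- The parameters chosen by the algorithm are sufficient. -/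
lemma steps_classicalData {D C : ℝ} (hD : 2 ≤ D) (hC : C ≤ D) :
    P.StepsSuffice p C ((classicalData P u p ε).cutoff D) ((classicalData P u p ε).steps p D) ∧
    StepsInRange P p ((classicalData P u p ε).cutoff D) ((classicalData P u p ε).steps p D) := by
  set K := (classicalData P u p ε).cutoff D
  have hs : (classicalData P u p ε).steps p D = if K * P.Gam p * P.T ≤ 1 then 0
    else ⌈D * (K * P.Gam p * P.T) ^ (1 + 1 / (p : ℝ))⌉₊ := rfl
  by_cases h : K * P.Gam p * P.T ≤ 1
  · rw [hs, if_pos h]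
    exact ⟨Or.inl ⟨rfl, h⟩, fun h => absurd rfl h⟩
  · rw [hs, if_neg h]
    push Not at h
    have hle := Nat.le_ceil (D * (K * P.Gam p * P.T) ^ (1 + 1 / (p : ℝ)))
    have hpow : K * P.Gam p * P.T ≤ (K * P.Gam p * P.T) ^ (1 + 1 / (p : ℝ)) := by
      refine Real.self_le_rpow_of_one_le h.le ?_
      have : (0 : ℝ) ≤ 1 / p := by positivity
      linarith
    refine ⟨Or.inr ⟨h, le_trans ?_ hle⟩, fun _ => le_trans ?_ hle⟩
    · gcongr
    · calc 2 * K * P.Gam p * P.T = 2 * (K * P.Gam p * P.T) := by ring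
        _ ≤ D * (K * P.Gam p * P.T) ^ (1 + 1 / (p : ℝ)) := by gcongr

/-- The cutoff and the `k`-grid make the relative error `ε / (32 q)`, the time grid makes the
absolute error `ε ‖u(T)‖ / 32`. With `‖u₀‖ + ‖b‖ = q ‖u(T)‖` in the `L¹` norm, the total is at most
`1/32 + 1/32 + 1/1024 < 1/15` times `ε ‖u(T)‖`. -/
lemma error_classicalData (hp : 1 ≤ p) (hP : P.Admissible p) (hu : P.IsSolution u)
    (huT : u P.T ≠ 0) (hε : 0 < ε) (hε1 : ε ≤ 1) {C D : ℝ} (hC : LCHSErrorConstant p C)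
    (hD : 2 ≤ D) (hCD : C ≤ D) :
    |(classicalData P u p ε).coefSum D - 1| ≤ 1 / 32 ∧
    |(classicalData P u p ε).sourceSum - P.bL1| ≤ ‖u P.T‖ / 32 ∧
    ‖P.lchsVector p ((classicalData P u p ε).steps p D) ((classicalData P u p ε).cutoff D)
      ((classicalData P u p ε).nodeBits D) (classicalData P u p ε).timeBits - u P.T‖ ≤
      ε * ‖u P.T‖ / 15 := by
  set d := classicalData P u p ε with hd
  have hU : 0 < ‖u P.T‖ := norm_pos_iff.2 huT
  have hq := one_le_ratio hP hu huT
  have hΓ := hP.Gam_nonneg hp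
  have hT := hP.T_pos
  have hB := hP.bC2_nonneg
  have hK := cutoff_classicalData hP hu huT hε hε1 hD
  have hK2 : 2 ≤ d.cutoff D := le_max_left _ _
  have hK0 : 0 < d.cutoff D := by linarith
  have hX : ‖P.u₀‖ + P.bL1 = ratio P u * ‖u P.T‖ := by
    rw [ratio, div_mul_cancel₀ _ hU.ne']
  set q := ratio P u with hqdef
  have hm : d.cutoff D ^ 3 * (1 + P.T * P.Gam 1) ≤ gridM (d.nodeBits D) :=
    le_gridM_gridBits (by positivity)
  have hmt : 32 * (P.T ^ 2 * ((1 + P.Gam 1) * P.bC2)) / (ε * ‖u P.T‖) ≤ gridM d.timeBits :=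
    le_gridM_gridBits (by positivity)
  have hM := one_le_gridM (gridBits_pos (d.cutoff D ^ 3 * (1 + d.T * d.Γ₁)))
  have hMt := one_le_gridM (gridBits_pos (32 * (d.T ^ 2 * ((1 + d.Γ₁) * d.bC2)) / (d.ε * d.uTNorm)))
  change 1 ≤ gridM (d.nodeBits D) at hM
  change 1 ≤ gridM d.timeBits at hMt
  have he₁ : C / d.cutoff D + C * d.cutoff D ^ 2 * (1 + P.T * P.Gam 1) / gridM (d.nodeBits D) ≤
      ε / (32 * q) := by
    have h1 : d.cutoff D ^ 2 * (1 + P.T * P.Gam 1) / gridM (d.nodeBits D) ≤ 1 / d.cutoff D := by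
      rw [div_le_div_iff₀ (by linarith) hK0]
      linarith
    have h1' : 0 ≤ d.cutoff D ^ 2 * (1 + P.T * P.Gam 1) / gridM (d.nodeBits D) := by positivity
    calc _ = C * (1 / d.cutoff D + d.cutoff D ^ 2 * (1 + P.T * P.Gam 1) / gridM (d.nodeBits D)) := by
          ring
      _ ≤ D * (1 / d.cutoff D + 1 / d.cutoff D) := by
          refine mul_le_mul hCD (by linarith) (by positivity) (by linarith)
      _ = ε / (32 * q) := by
          rw [hK]
          field_simp
          norm_num
  have he₂ : P.T ^ 2 * ((1 + P.Gam 1) * P.bC2) / gridM d.timeBits ≤ ε * ‖u P.T‖ / 32 := by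
    rw [div_le_iff₀ (by linarith)]
    rw [div_le_iff₀ (by positivity)] at hmt
    linarith
  obtain ⟨h1, h2, h3⟩ := hC N P u hP hu (d.cutoff D) (d.steps p D) (d.nodeBits D) d.timeBits hK2
    (steps_classicalData hD hCD).1 (gridBits_pos _) (gridBits_pos _) _ _ he₁ he₂
  have hεq : ε / (32 * q) ≤ 1 / 32 := by
    rw [div_le_div_iff₀ (by positivity) (by norm_num)]
    linarith
  refine ⟨h1.trans hεq, ?_, ?_⟩
  · rw [sourceSum_classicalData hP]
    refine h2.trans ?_
    nlinarith
  · refine h3.trans ?_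
    rw [hX]
    have h4 : ε / (32 * q) * (q * ‖u P.T‖) = ε * ‖u P.T‖ / 32 := by field_simp
    have h5 : ε / (32 * q) * (ε * ‖u P.T‖ / 32) ≤ 1 / 32 * (ε * ‖u P.T‖ / 32) := by gcongr
    have h6 : 0 < ε * ‖u P.T‖ := by positivity
    rw [mul_add, h4]
    linarith

/-- The inverse amplitude is `S (‖u₀‖ + β) / ‖u(T)‖`, with `S ≤ 3 / 2` and `‖u₀‖ + β ≤ 2 q ‖u(T)‖`.
-/
lemma rounds_classicalData (hp : 1 ≤ p) (hP : P.Admissible p) (hu : P.IsSolution u)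
    (huT : u P.T ≠ 0) (hε : 0 < ε) (hε1 : ε ≤ 1) {C D : ℝ} (hC : LCHSErrorConstant p C)
    (hD : 2 ≤ D) (hCD : C ≤ D) :
    2 * ((classicalData P u p ε).rounds D : ℝ) + 1 ≤ 3 * ratio P u := by
  obtain ⟨h1, h2, -⟩ := error_classicalData hp hP hu huT hε hε1 hC hD hCD
  set d := classicalData P u p ε with hd
  have hU : 0 < ‖u P.T‖ := norm_pos_iff.2 huT
  have hq := one_le_ratio hP hu huT
  have hX : ‖P.u₀‖ + P.bL1 = ratio P u * ‖u P.T‖ := by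
    rw [ratio, div_mul_cancel₀ _ hU.ne']
  refine (amplification_rounds_le _).trans (max_le (by linarith) ?_)
  have e : 1 / d.amplitude D = d.coefSum D * (‖P.u₀‖ + d.sourceSum) / ‖u P.T‖ := one_div_div _ _
  rw [e, div_le_iff₀ hU]
  have h3 := (abs_le.1 h1).2
  have h4 := (abs_le.1 h1).1
  have h5 := (abs_le.1 h2).2
  have h6 := (abs_le.1 h2).1
  have h7 : ‖P.u₀‖ + d.sourceSum ≤ 2 * (ratio P u * ‖u P.T‖) := by nlinarith
  have h8 : 0 ≤ ratio P u * ‖u P.T‖ := by positivity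
  calc _ ≤ d.coefSum D * (2 * (ratio P u * ‖u P.T‖)) := by
        gcongr
        linarith
    _ ≤ (3 / 2) * (2 * (ratio P u * ‖u P.T‖)) := by
        gcongr
        linarith
    _ = _ := by ring

/-- Amplification multiplies the encoded vector by a positive scalar, so the output has the
direction of `lchsVector`. Its length is a sine that is bounded below because the amplitude is known
up to a relative error of `1 / 15`. -/
theorem output_lchsCircuit (hp : 1 ≤ p) (hP : P.Admissible p) (hu : P.IsSolution u)
    (huT : u P.T ≠ 0) (hε : 0 < ε) (hε1 : ε ≤ 1) {C D : ℝ} (hC : LCHSErrorConstant p C)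
    (hD : 2 ≤ D) (hCD : C ≤ D) :
    ∀ O : Oracles (lchsCircuit p D (classicalData P u p ε)).m
      (lchsCircuit p D (classicalData P u p ε)).mt N,
    O.Implements P (lchsCircuit p D (classicalData P u p ε)).K →
    1 / 6 ≤ ‖(lchsCircuit p D (classicalData P u p ε)).output O‖ ∧
    ‖ket ((lchsCircuit p D (classicalData P u p ε)).output O) - ket (u P.T)‖ ≤ ε := by
  obtain ⟨h1, h2, h3⟩ := error_classicalData hp hP hu huT hε hε1 hC hD hCD
  have hsrc := sourceSum_classicalData (u := u) (ε := ε) hP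
  obtain ⟨-, hrange⟩ := steps_classicalData (P := P) (u := u) (p := p) (ε := ε) hD hCD
  set d := classicalData P u p ε with hd
  have hK2 : 2 ≤ d.cutoff D := le_max_left _ _
  have hU : 0 < ‖u P.T‖ := norm_pos_iff.2 huT
  have hq := one_le_ratio hP hu huT
  have hX : ‖P.u₀‖ + P.bL1 = ratio P u * ‖u P.T‖ := by
    rw [ratio, div_mul_cancel₀ _ hU.ne']
  have hS0 : 0 < d.coefSum D := by linarith [(abs_le.1 h1).1]
  have hpos : 0 < ‖P.u₀‖ + d.sourceSum := by
    have := (abs_le.1 h2).1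
    nlinarith
  have hβ0 : 0 ≤ d.sourceSum := by
    rw [hsrc]
    exact Finset.sum_nonneg fun y _ =>
      mul_nonneg (hP.tWeight_nonneg (gridBits_pos _) _) (norm_nonneg _)
  set v := P.lchsVector p (d.steps p D) (d.cutoff D) (d.nodeBits D) d.timeBits with hv
  set Λ := d.coefSum D * (‖P.u₀‖ + d.sourceSum) with hΛ
  have hΛ0 : 0 < Λ := mul_pos hS0 hpos
  have hβ1 : d.sourceSum / (‖P.u₀‖ + d.sourceSum) ≤ 1 :=
    (div_le_one hpos).2 (by linarith [norm_nonneg P.u₀])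
  have hangle : d.angle = Real.arcsin √(d.sourceSum / (‖P.u₀‖ + d.sourceSum)) := rfl
  have hsin : Real.sin d.angle = √(d.sourceSum / (‖P.u₀‖ + d.sourceSum)) := by
    have := Real.sqrt_nonneg (d.sourceSum / (‖P.u₀‖ + d.sourceSum))
    rw [hangle, Real.sin_arcsin (by linarith) (Real.sqrt_le_one.2 hβ1)]
  have hcos : Real.cos d.angle = √(‖P.u₀‖ / (‖P.u₀‖ + d.sourceSum)) := by
    rw [hangle, Real.cos_arcsin, Real.sq_sqrt (by positivity)]
    congr 1
    field_simp
    ring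
  intro O hO
  change Oracles.Implements (m := d.nodeBits D) (mt := d.timeBits) O P (d.cutoff D) at hO
  set lay := stdLayout d.timeBits (d.nodeBits D)
  set l := lchsGates lay p P.T (d.cutoff D) (d.steps p D) d.angle with hl
  have hblock : zeroBlock O l = Λ⁻¹ • v :=
    zeroBlock_lchsGates lay hO hP (by linarith) (gridBits_pos _) (gridBits_pos _) hrange
      (S := d.coefSum D) rfl hS0 hsrc hpos hcos hsin
  have hamp := norm_smul_zeroBlock_amplified O (flagWire lay)
    (lchsGates_reversible lay hO hP (by linarith) (gridBits_pos _) hrange d.angle) (d.rounds D)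
  have hσ1 := (sum_normSq_zeroBlock O l _ rfl).2.2
  rw [← hl] at hamp
  change ‖zeroBlock O l‖ • (lchsCircuit p D d).output O = _ at hamp
  set out := (lchsCircuit p D d).output O
  have hvU : |‖v‖ - ‖u P.T‖| ≤ ‖u P.T‖ / 15 := by
    refine (abs_norm_sub_norm_le _ _).trans (h3.trans ?_)
    nlinarith
  have hv0 : 0 < ‖v‖ := by linarith [(abs_le.1 hvU).1]
  have hσ : ‖zeroBlock O l‖ = ‖v‖ / Λ := by
    rw [hblock, norm_smul, Real.norm_of_nonneg (by positivity)]
    ring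
  have hx : d.amplitude D = ‖u P.T‖ / Λ := rfl
  have hsinφ := amplified_sin_ge (x := d.amplitude D) (σ := ‖zeroBlock O l‖) (by rw [hx]; positivity)
    hσ1 (by
      rw [hσ, hx, ← sub_div, abs_div, abs_of_pos hΛ0, div_right_comm]
      gcongr)
  change 1 / 6 ≤ Real.sin ((2 * (d.rounds D : ℝ) + 1) * Real.arcsin ‖zeroBlock O l‖) at hsinφ
  set s := Real.sin ((2 * (d.rounds D : ℝ) + 1) * Real.arcsin ‖zeroBlock O l‖)
  have hout : out = (s / ‖v‖) • v := by
    have hne : ‖zeroBlock O l‖ ≠ 0 := by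
      rw [hσ]
      positivity
    refine smul_right_injective _ hne ?_
    show ‖zeroBlock O l‖ • out = ‖zeroBlock O l‖ • (s / ‖v‖) • v
    rw [hamp, hσ, hblock, smul_smul, smul_smul]
    congr 1
    field_simp
  have hs0 : 0 < s := by linarith
  constructor
  · rw [hout, norm_smul, Real.norm_of_nonneg (by positivity), div_mul_cancel₀ _ hv0.ne']
    exact hsinφ
  · rw [hout, ket_smul_of_pos _ (by positivity)]
    refine (norm_ket_sub_ket_le (norm_pos_iff.1 hv0) huT).trans ?_
    rw [div_le_iff₀ hU]
    have : 0 < ε * ‖u P.T‖ := by positivity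
    linarith

end Analysis

/-! ### Complexity -/

section Complexity

variable {N : ℕ} [NeZero N] {P : ODEData N} {p : ℕ} {u : ℝ → EuclideanSpace ℂ (Fin N)} {ε : ℝ}

lemma one_add_cube_mul_le {K B Y a : ℝ} (hK : 0 ≤ K) (hB : 1 ≤ B) (hY : 1 ≤ Y) (hKY : K ≤ B * Y)
    (ha : 0 ≤ a) (haY : a ≤ Y) : 1 + K ^ 3 * a ≤ (2 * B ^ 3) * Y ^ 4 := by
  have h1 : K ^ 3 * a ≤ (B * Y) ^ 3 * Y := by gcongr
  have h2 : 1 ≤ B ^ 3 * Y ^ 4 := one_le_mul_of_one_le_of_one_le (one_le_pow₀ hB) (one_le_pow₀ hY)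
  nlinarith

lemma one_le_inv_of_le_one (hε : 0 < ε) (hε1 : ε ≤ 1) : 1 ≤ ε⁻¹ := (one_le_inv₀ hε).2 hε1

lemma nodeBits_classicalData (D : ℝ) : (classicalData P u p ε).nodeBits D =
    gridBits ((classicalData P u p ε).cutoff D ^ 3 * (1 + P.T * P.Gam 1)) := rfl

lemma timeBits_classicalData : (classicalData P u p ε).timeBits =
    gridBits (32 * (P.T ^ 2 * ((1 + P.Gam 1) * P.bC2)) / (ε * ‖u P.T‖)) := rfl

lemma ancillas_lchsCircuit (p : ℕ) (D : ℝ) (d : ClassicalData) :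
    (lchsCircuit p D d).w = 1 + (d.timeBits + d.nodeBits D) := rfl

/-- The logarithm of the cost in terms of `Γ_p`. -/
lemma nodeBits_add_one_le (hp : 1 ≤ p) (hP : P.Admissible p) (hu : P.IsSolution u)
    (huT : u P.T ≠ 0) (hε : 0 < ε) (hε1 : ε ≤ 1) {D : ℝ} (hD : 2 ≤ D) :
    (((classicalData P u p ε).nodeBits D : ℝ) + 1) ≤ (2 * Real.log (2 * (64 * D) ^ 3) + 11) *
      Real.log ((2 + ratio P u) * (2 + P.Gam p * P.T) / ε) := by
  have hq := one_le_ratio hP hu huT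
  have hΓ1 := hP.Gam_nonneg hp
  have hΓ := hP.Gam_mono hp
  have hT := hP.T_pos
  have hK := cutoff_classicalData hP hu huT hε hε1 hD
  have hi := one_le_inv_of_le_one hε hε1
  have hΓp := hΓ1.trans hΓ
  have hq0 := zero_le_one.trans hq
  have hΓT : P.Gam 1 * P.T ≤ P.Gam p * P.T := by gcongr
  have hΓT0 : 0 ≤ P.Gam 1 * P.T := by positivity
  set q := ratio P u with hqdef
  set Y := (2 + q) * (2 + P.Gam p * P.T) / ε with hY
  have hY' : Y = (2 + q) * (2 + P.Gam p * P.T) * ε⁻¹ := div_eq_mul_inv _ _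
  have hY4 : 4 ≤ Y := by
    rw [hY']
    calc (4 : ℝ) = (2 * 2) * 1 := by norm_num
      _ ≤ _ := by gcongr <;> linarith
  have hqY : q / ε ≤ Y := by
    rw [hY]
    gcongr
    nlinarith
  have haY : 1 + P.T * P.Gam 1 ≤ Y := by
    rw [hY']
    calc 1 + P.T * P.Gam 1 ≤ (1 * (2 + P.Gam p * P.T)) * 1 := by linarith
      _ ≤ _ := by gcongr; linarith
  have hbits := gridBits_le (Z := (classicalData P u p ε).cutoff D ^ 3 * (1 + P.T * P.Gam 1))
    (B := 2 * (64 * D) ^ 3) (Y := Y) (k := 4) (by rw [hK]; positivity)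
    (by linarith [one_le_pow₀ (by linarith : 1 ≤ 64 * D) (n := 3)]) hY4
    (one_add_cube_mul_le (by rw [hK]; positivity) (by linarith) (by linarith)
      (by rw [hK]; gcongr) (by positivity) haY)
  have hlog := one_le_log_of_four_le hY4
  rw [← nodeBits_classicalData] at hbits
  push_cast at hbits
  generalize Real.log (2 * (64 * D) ^ 3) = b at hbits ⊢
  generalize Real.log Y = y at hbits hlog ⊢
  linarith

/-- One logarithm has to dominate all quantities that enter the grid sizes. The product is compared
factor by factor, with `1` or `2` in place of the factors not wanted. -/
lemma le_prod_of_nonneg {q g t b e : ℝ} (hq : 0 ≤ q) (hg : 0 ≤ g) (ht : 0 ≤ t) (hb : 0 ≤ b)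
    (he : 1 ≤ e) : 4 ≤ (2 + q) * (2 + g) * (2 + t) * (2 + b) * e ∧
      q * e ≤ (2 + q) * (2 + g) * (2 + t) * (2 + b) * e ∧
      1 + t * g ≤ (2 + q) * (2 + g) * (2 + t) * (2 + b) * e ∧
      t ≤ (2 + q) * (2 + g) * (2 + t) * (2 + b) * e ∧
      1 + g ≤ (2 + q) * (2 + g) * (2 + t) * (2 + b) * e ∧
      b * e ≤ (2 + q) * (2 + g) * (2 + t) * (2 + b) * e := by
  have key : ∀ {q' g' t' b' e'}, 0 ≤ q' → 0 ≤ g' → 0 ≤ t' → 0 ≤ b' → 0 ≤ e' → q' ≤ 2 + q →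
      g' ≤ 2 + g → t' ≤ 2 + t → b' ≤ 2 + b → e' ≤ e →
      q' * g' * t' * b' * e' ≤ (2 + q) * (2 + g) * (2 + t) * (2 + b) * e := by
    intro q' g' t' b' e' _ _ _ _ _ _ _ _ _ _
    gcongr
  have h1 := zero_le_one (α := ℝ)
  have h2 := zero_le_two (α := ℝ)
  have he0 := h1.trans he
  refine ⟨?_, ?_, ?_, ?_, ?_, ?_⟩
  · exact le_trans (by norm_num) (key h2 h2 h1 h1 h1 (le_add_of_nonneg_right hq)
      (le_add_of_nonneg_right hg) (by linarith) (by linarith) he)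
  · exact le_trans (by linarith) (key hq h1 h1 h1 he0 (le_add_of_nonneg_left h2) (by linarith)
      (by linarith) (by linarith) le_rfl)
  · exact le_trans (by nlinarith [mul_nonneg ht hg]) (key h1 (add_nonneg h2 hg) (add_nonneg h2 ht)
      h1 h1 (by linarith) le_rfl le_rfl (by linarith) he)
  · exact le_trans (by linarith) (key h1 h1 ht h1 h1 (by linarith) (by linarith)
      (le_add_of_nonneg_left h2) (by linarith) he)
  · exact le_trans (by linarith) (key h1 (add_nonneg h1 hg) h1 h1 h1 (by linarith) (by linarith)
      (by linarith) (by linarith) he)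
  · exact le_trans (by linarith) (key h1 h1 h1 hb he0 (by linarith) (by linarith) (by linarith)
      (le_add_of_nonneg_left h2) le_rfl)

lemma ancillas_le (hp : 1 ≤ p) (hP : P.Admissible p) (hu : P.IsSolution u)
    (huT : u P.T ≠ 0) (hε : 0 < ε) (hε1 : ε ≤ 1) {D : ℝ} (hD : 2 ≤ D) :
    ((lchsCircuit p D (classicalData P u p ε)).w : ℝ) ≤
      (2 * Real.log (2 * (64 * D) ^ 3) + 2 * Real.log 34 + 23) *
      Real.log ((2 + ratio P u) * (2 + P.Gam 1) * (2 + P.T) * (2 + P.bC2 / ‖u P.T‖) / ε) := by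
  have hq := one_le_ratio hP hu huT
  have hΓ := hP.Gam_nonneg hp
  have hT := hP.T_pos
  have hU : 0 < ‖u P.T‖ := norm_pos_iff.2 huT
  have hB := hP.bC2_nonneg
  have hK := cutoff_classicalData hP hu huT hε hε1 hD
  have hi := one_le_inv_of_le_one hε hε1
  have hb : 0 ≤ P.bC2 / ‖u P.T‖ := by positivity
  set q := ratio P u with hqdef
  set b := P.bC2 / ‖u P.T‖ with hbdef
  set Y := (2 + q) * (2 + P.Gam 1) * (2 + P.T) * (2 + b) / ε with hY
  have hY' : Y = (2 + q) * (2 + P.Gam 1) * (2 + P.T) * (2 + b) * ε⁻¹ := div_eq_mul_inv _ _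
  obtain ⟨hY4, hqY, haY, hTY, hΓY, hbY⟩ :=
    le_prod_of_nonneg (zero_le_one.trans hq) hΓ hT.le hb hi
  rw [← hY'] at hY4 hqY haY hTY hΓY hbY
  rw [← div_eq_mul_inv] at hqY
  clear_value Y
  have hlog := one_le_log_of_four_le hY4
  have hbits := gridBits_le (Z := (classicalData P u p ε).cutoff D ^ 3 * (1 + P.T * P.Gam 1))
    (B := 2 * (64 * D) ^ 3) (Y := Y) (k := 4) (by rw [hK]; positivity)
    (by linarith [one_le_pow₀ (by linarith : 1 ≤ 64 * D) (n := 3)]) hY4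
    (one_add_cube_mul_le (by rw [hK]; positivity) (by linarith) (by linarith)
      (by rw [hK]; gcongr) (by positivity) haY)
  have e : 32 * (P.T ^ 2 * ((1 + P.Gam 1) * P.bC2)) / (ε * ‖u P.T‖) =
      32 * (P.T ^ 2 * ((1 + P.Gam 1) * (b * ε⁻¹))) := by
    rw [hbdef]
    field_simp
  have htime := gridBits_le (Z := 32 * (P.T ^ 2 * ((1 + P.Gam 1) * P.bC2)) / (ε * ‖u P.T‖))
    (B := 34) (Y := Y) (k := 4) (by positivity) (by norm_num) hY4 (by
      rw [e]
      have h1 : P.T ^ 2 * ((1 + P.Gam 1) * (b * ε⁻¹)) ≤ Y ^ 2 * (Y * Y) := by gcongr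
      have h2 : 1 ≤ Y ^ 4 := one_le_pow₀ (le_trans (by norm_num) hY4)
      rw [show Y ^ 2 * (Y * Y) = Y ^ 4 by ring] at h1
      generalize P.T ^ 2 * ((1 + P.Gam 1) * (b * ε⁻¹)) = z at h1 ⊢
      generalize Y ^ 4 = y at h1 h2 ⊢
      linarith)
  rw [← nodeBits_classicalData] at hbits
  rw [← timeBits_classicalData (p := p)] at htime
  rw [ancillas_lchsCircuit]
  push_cast at hbits htime ⊢
  generalize Real.log (2 * (64 * D) ^ 3) = b at hbits ⊢
  generalize Real.log 34 = b' at htime ⊢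
  generalize Real.log Y = y at hbits htime hlog ⊢
  linarith

/-- The computation gives `q ^ (2 + 1 / p)` and `ε ^ (-(1 + 1 / p))`; as `q ≥ 1` and `ε ≤ 1`, these
are weakened to the exponents of the claim. -/
lemma ratio_mul_steps_le (hp : 1 ≤ p) (hP : P.Admissible p) (hu : P.IsSolution u)
    (huT : u P.T ≠ 0) (hε : 0 < ε) (hε1 : ε ≤ 1) {D : ℝ} (hD : 2 ≤ D) :
    ratio P u * ((classicalData P u p ε).steps p D : ℝ) ≤
      2 * D * (64 * D) ^ (1 + 1 / (p : ℝ)) * (ratio P u ^ (2 + 2 / (p : ℝ)) *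
        (P.Gam p ^ (1 + 1 / (p : ℝ)) * P.T ^ (1 + 1 / (p : ℝ)) / ε ^ (1 + 2 / (p : ℝ)))) := by
  have hq := one_le_ratio hP hu huT
  have hΓ := hP.Gam_nonneg (le_refl p)
  have hT := hP.T_pos
  have hK := cutoff_classicalData hP hu huT hε hε1 hD
  have hp0 : (0 : ℝ) < 1 / p := by positivity
  have hp2 : 2 / (p : ℝ) = 2 * (1 / p) := by ring
  set q := ratio P u with hqdef
  rw [hp2]
  set a := 1 / (p : ℝ) with ha
  have hs : (classicalData P u p ε).steps p D =
      if (classicalData P u p ε).cutoff D * P.Gam p * P.T ≤ 1 then 0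
      else ⌈D * ((classicalData P u p ε).cutoff D * P.Gam p * P.T) ^ (1 + a)⌉₊ := rfl
  -- Taking no step at all is what permits a bound without additive constant when `Γ_p T` is small.
  by_cases h : (classicalData P u p ε).cutoff D * P.Gam p * P.T ≤ 1
  · rw [hs, if_pos h, Nat.cast_zero, mul_zero]
    positivity
  · rw [hs, if_neg h]
    push Not at h
    set X := (classicalData P u p ε).cutoff D * P.Gam p * P.T with hX
    -- This lets a factor `2` absorb the rounding up.
    have hX1 : 1 ≤ X ^ (1 + a) := Real.one_le_rpow h.le (by linarith)
    have hceil : (⌈D * X ^ (1 + a)⌉₊ : ℝ) ≤ 2 * D * X ^ (1 + a) := by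
      have := Nat.ceil_lt_add_one (by positivity : 0 ≤ D * X ^ (1 + a))
      nlinarith
    have hXpow : X ^ (1 + a) =
        (64 * D) ^ (1 + a) * (q ^ (1 + a) * (P.Gam p ^ (1 + a) * P.T ^ (1 + a) / ε ^ (1 + a))) := by
      have : X = 64 * D * (q / ε) * P.Gam p * P.T := by rw [hX, hK]
      rw [this, Real.mul_rpow (by positivity) hT.le, Real.mul_rpow (by positivity) hΓ,
        Real.mul_rpow (by positivity) (by positivity), Real.div_rpow (by positivity) hε.le]
      ring
    have hqq : q * q ^ (1 + a) ≤ q ^ (2 + 2 * a) := by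
      calc q * q ^ (1 + a) = q ^ (1 + (1 + a)) := by
            rw [Real.rpow_add (by linarith) 1 (1 + a), Real.rpow_one]
        _ ≤ _ := Real.rpow_le_rpow_of_exponent_le hq (by linarith)
    have hεε : ε ^ (1 + 2 * a) ≤ ε ^ (1 + a) :=
      Real.rpow_le_rpow_of_exponent_ge hε hε1 (by linarith)
    calc q * (⌈D * X ^ (1 + a)⌉₊ : ℝ) ≤ q * (2 * D * X ^ (1 + a)) := by gcongr
      _ = 2 * D * (64 * D) ^ (1 + a) * ((q * q ^ (1 + a)) *
          (P.Gam p ^ (1 + a) * P.T ^ (1 + a) / ε ^ (1 + a))) := by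
          rw [hXpow]
          ring
      _ ≤ _ := by gcongr

end Complexity

end LCHS

end

/-! ### Choice of the constants and assembly of the bounds. -/

theorem theorem2 :
    ∃ δ : ℝ, 0 < δ ∧ ∀ p : ℕ, 1 ≤ p →
    ∃ (C : ℝ) (c : ℕ) (alg : LCHS.ClassicalData → LCHS.Circuit), 0 < C ∧
    ∀ (N : ℕ) [NeZero N] (P : LCHS.ODEData N) (u : ℝ → EuclideanSpace ℂ (Fin N)) (ε : ℝ),
      P.Admissible p → P.IsSolution u → u P.T ≠ 0 → 0 < ε → ε ≤ 1 →
      ((alg (LCHS.classicalData P u p ε)).matrixQueries : ℝ) ≤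
          C * (LCHS.ratio P u ^ (2 + 2 / (p : ℝ)) *
              (P.Gam p ^ (1 + 1 / (p : ℝ)) * P.T ^ (1 + 1 / (p : ℝ)) /
                ε ^ (1 + 2 / (p : ℝ)))) *
            Real.log ((2 + LCHS.ratio P u) * (2 + P.Gam p * P.T) / ε) ^ c ∧
      ((alg (LCHS.classicalData P u p ε)).stateQueries : ℝ) ≤ C * LCHS.ratio P u ∧
      ((alg (LCHS.classicalData P u p ε)).coefQueries : ℝ) ≤ C * LCHS.ratio P u ∧
      ((alg (LCHS.classicalData P u p ε)).w : ℝ) ≤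
          C * Real.log ((2 + LCHS.ratio P u) * (2 + P.Gam 1) * (2 + P.T) *
            (2 + P.bC2 / ‖u P.T‖) / ε) ∧
      ((alg (LCHS.classicalData P u p ε)).otherGates : ℝ) ≤ C * LCHS.ratio P u ∧
      ∀ O : LCHS.Oracles (alg (LCHS.classicalData P u p ε)).m
          (alg (LCHS.classicalData P u p ε)).mt N,
        O.Implements P (alg (LCHS.classicalData P u p ε)).K →
          δ ≤ ‖(alg (LCHS.classicalData P u p ε)).output O‖ ^ 2 ∧
          ‖LCHS.ket ((alg (LCHS.classicalData P u p ε)).output O) - LCHS.ket (u P.T)‖ ≤ ε := by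
  -- The square of the lower bound `1 / 6` for the amplified amplitude.
  refine ⟨1 / 36, by norm_num, fun p hp => ?_⟩
  obtain ⟨C, -, hC⟩ := LCHS.exists_lchsVector_error p hp
  set D : ℝ := max C 2 with hDdef
  have hD : 2 ≤ D := le_max_right _ _
  have hCD : C ≤ D := le_max_left _ _
  set C₁ : ℝ := 2 * Real.log (2 * (64 * D) ^ 3) + 11 with hC₁
  set C₂ : ℝ := 2 * Real.log (2 * (64 * D) ^ 3) + 2 * Real.log 34 + 23 with hC₂
  set C₃ : ℝ := 3 * (suzuki p).length * C₁ * (2 * D * (64 * D) ^ (1 + 1 / (p : ℝ))) with hC₃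
  have hlog : 0 ≤ Real.log (2 * (64 * D) ^ 3) := by
    refine Real.log_nonneg ?_
    linarith [one_le_pow₀ (by linarith : 1 ≤ 64 * D) (n := 3)]
  have hlog34 : 0 ≤ Real.log 34 := Real.log_nonneg (by norm_num)
  have hC₁0 : 0 ≤ C₁ := by linarith
  have hC₂0 : 0 ≤ C₂ := by linarith
  have hC₃0 : 0 ≤ C₃ := by positivity
  -- A single logarithm, due to the at most `m + 1` queries per stage. `12 = 4 * 3`: four
  -- coefficient queries in each of at most `3 q` uses of the block encoding or its inverse.
  refine ⟨C₃ + C₂ + 12, 1, LCHS.lchsCircuit p D, by linarith, ?_⟩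
  intro N _ P u ε hP hu huT hε hε1
  have hq := LCHS.one_le_ratio hP hu huT
  have hrounds := LCHS.rounds_classicalData hp hP hu huT hε hε1 hC hD hCD
  have hsteps := LCHS.ratio_mul_steps_le hp hP hu huT hε hε1 hD
  have hbits := LCHS.nodeBits_add_one_le hp hP hu huT hε hε1 hD
  have hanc := LCHS.ancillas_le hp hP hu huT hε hε1 hD
  have hn0 : (0 : ℝ) ≤ (LCHS.classicalData P u p ε).rounds D := Nat.cast_nonneg _
  have hcount : ∀ x : ℝ, x ≤ 12 * LCHS.ratio P u → x ≤ (C₃ + C₂ + 12) * LCHS.ratio P u := by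
    intro x hx
    refine hx.trans ?_
    gcongr
    linarith
  refine ⟨?_, ?_, ?_, ?_, ?_, ?_⟩
  · have h1 : ((LCHS.lchsCircuit p D (LCHS.classicalData P u p ε)).matrixQueries : ℝ) ≤ _ :=
      Nat.cast_le.2 (LCHS.matrixQueries_lchsCircuit_le p D (LCHS.classicalData P u p ε))
    push_cast at h1
    refine h1.trans ?_
    rw [pow_one]
    set y := Real.log ((2 + LCHS.ratio P u) * (2 + P.Gam p * P.T) / ε)
    set F := LCHS.ratio P u ^ (2 + 2 / (p : ℝ)) * (P.Gam p ^ (1 + 1 / (p : ℝ)) *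
      P.T ^ (1 + 1 / (p : ℝ)) / ε ^ (1 + 2 / (p : ℝ)))
    have hF : 0 ≤ F := by
      have := hP.Gam_nonneg (le_refl p)
      have := hP.T_pos
      positivity
    -- The bound on the number of qubits already forces the logarithm to be nonnegative.
    have hy : 0 ≤ y := by
      by_contra hy
      push Not at hy
      have : C₁ * y ≤ 0 := mul_nonpos_of_nonneg_of_nonpos hC₁0 hy.le
      have : (0 : ℝ) ≤ (LCHS.classicalData P u p ε).nodeBits D := Nat.cast_nonneg _
      linarith
    calc _ ≤ (3 * LCHS.ratio P u) * ((LCHS.classicalData P u p ε).steps p D *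
          ((suzuki p).length * (C₁ * y))) := by gcongr
      _ = 3 * (suzuki p).length * C₁ *
          (LCHS.ratio P u * (LCHS.classicalData P u p ε).steps p D) * y := by ring
      _ ≤ 3 * (suzuki p).length * C₁ * (2 * D * (64 * D) ^ (1 + 1 / (p : ℝ)) * F) * y := by
          gcongr
      _ = C₃ * F * y := by
          rw [hC₃]
          ring
      _ ≤ (C₃ + C₂ + 12) * F * y := by
          gcongr
          linarith
  · refine hcount _ ?_
    rw [LCHS.stateQueries_lchsCircuit]
    push_cast
    linarith
  · refine hcount _ ?_
    rw [LCHS.coefQueries_lchsCircuit]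
    push_cast
    linarith
  · have hw : 0 ≤ Real.log ((2 + LCHS.ratio P u) * (2 + P.Gam 1) * (2 + P.T) *
        (2 + P.bC2 / ‖u P.T‖) / ε) := by
      by_contra hy
      push Not at hy
      have := mul_nonpos_of_nonneg_of_nonpos hC₂0 hy.le
      have : (1 : ℝ) ≤ (LCHS.lchsCircuit p D (LCHS.classicalData P u p ε)).w := by
        rw [LCHS.ancillas_lchsCircuit]
        push_cast
        linarith [Nat.cast_nonneg (α := ℝ) (LCHS.classicalData P u p ε).timeBits,
          Nat.cast_nonneg (α := ℝ) ((LCHS.classicalData P u p ε).nodeBits D)]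
      linarith
    exact hanc.trans (mul_le_mul_of_nonneg_right (by linarith) hw)
  · refine hcount _ ?_
    rw [LCHS.otherGates_lchsCircuit]
    push_cast
    linarith
  · intro O hO
    obtain ⟨h1, h2⟩ := LCHS.output_lchsCircuit hp hP hu huT hε hε1 hC hD hCD O hO
    refine ⟨?_, h2⟩
    nlinarith
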